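/- **Setting.** Let $(M_p)_{p\ge 0}$ be a sequence of positive numbers with $M_0=1$, monotonically increasing to infinity, such that $(M.1)$ $M_p^2\le M_{p-1}M_{p+1}$ for $p\ge 1$; $(M.2)$ $M_{p+q}\le A H^{p+q}M_pM_q$ for all $p,q$ and some $A,H>0$; $(M.3)'$ $\sum_{p\ge1} M_{p-1}/M_p<\infty$. Let $M(\rho)=\sup_{p}\ln_+(\rho^p M_0/M_p)$ be its associated function. A weight on $\mathbb R^d$ is a measurable function $\omega>0$; $\mathcal M_{M(\rho)}(\mathbb R^d)$ is the set of weights with $\omega(x+y)\lesssim e^{M(|x|)}\omega(y)$ for all $x,y\in\mathbb R^d$. $\mathcal S^{(1)}(\mathbb R^d)$ is the space of all smooth $f$ such that $\sup_{x,\alpha,\beta}|x^\alpha\partial^\beta f(x)|/(h^{|\alpha|+|\beta|}|\alpha|!\,|\beta|!)<\infty$ for every $h>0$, topologized by these seminorms, and $(\mathcal S^{(1)})'(\mathbb R^d)$ is its dual. $\mathcal D^{(M_p)}(\mathbb R^d)$ is the space of compactly supported smooth $\varphi$ with $\sup_{x,\beta}|\partial^\beta\varphi(x)|/(h^{|\beta|}M_{|\beta|})<\infty$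 for every $h>0$, and its dual $(\mathcal D^{(M_p)})'(\mathbb R^d)$ is the space of ultradistributions of Beurling type. For $f\in(\mathcal D^{(M_p)})'$ and $\varphi\in\mathcal D^{(M_p)}$ the product $\varphi f$ is regarded as an element of $(\mathcal S^{(1)})'$. The Fourier transform is $\widehat f(\xi)=\int f(x)e^{-2\pi i x\cdot\xi}\,dx$, extended to $(\mathcal S^{(1)})'$ by duality. For $q\in[1,\infty]$, $\omega\in\mathcal M_{M(\rho)}(\mathbb R^d)$ and $\Gamma\subseteq\mathbb R^d$ let $|u|_{\mathcal FL^{q,\Gamma}_{(\omega)}}=\|\widehat u\,\omega\|_{L^q(\Gamma)}$ (and $\infty$ if $\widehat u$ is not a function). $\mathcal FL^q_{(\omega)}(\mathbb R^d)$ is the space of $u\in(\mathcal S^{(1)})'(\mathbb R^d)$ with finite norm $\|\widehat u\,\omega\|_{L^q(\mathbb R^d)}$, and $\mathcal FL^q_{(\omega),loc}(\mathbb R^d)$ is the set of $f\in(\mathcal D^{(M_p)})'(\mathbb R^d)$ with $\varphi f\in\mathcal FL^q_{(\omega)}(\mathbb R^d)$ for all $\varphi\in\mathcal D^{(M_p)}(\mathbb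 R^d)$. The wave-front set $\mathrm{WF}_{\mathcal FL^q_{(\omega)}}(f)$ of $f\in(\mathcal D^{(M_p)})'(\mathbb R^d)$ consists of all $(x_0,\xi_0)\in\mathbb R^d\times(\mathbb R^d\setminus0)$ such that $|\varphi f|_{\mathcal FL^{q,\Gamma}_{(\omega)}}=\infty$ for every $\varphi\in\mathcal D^{(M_p)}(\mathbb R^d)$ with $\varphi(x_0)\ne0$ and every open cone $\Gamma\subseteq\mathbb R^d\setminus0$ containing $\xi_0$. **Theorem.** Let $q,q_1,q_2\in[1,\infty]$ and $\omega,\omega_1,\omega_2\in\mathcal M_{M(\rho)}(\mathbb R^d)$ satisfy $$\frac1{q_1}+\frac1{q_2}=\frac1q\qquad\text{and}\qquad \omega(\xi)\lesssim\omega_1(\xi)\,\omega_2(\xi).$$ 1. The convolution map from $\mathcal S^{(1)}(\mathbb R^d)\times\mathcal S^{(1)}(\mathbb R^d)$ to $\mathcal S^{(1)}(\mathbb R^d)$ extends to a continuous bilinear map $T$ from $\mathcal FL^{q_1}_{(\omega_1)}(\mathbb R^d)\times\mathcal FL^{q_2}_{(\omega_2)}(\mathbb R^d)$ to $\mathcal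 FL^q_{(\omega)}(\mathbb R^d)$, which agrees with the usual convolution of an element of $\mathcal S^{(1)}$ and an element of $(\mathcal S^{(1)})'$ whenever one of the two arguments belongs to $\mathcal S^{(1)}(\mathbb R^d)$. If $q_1<\infty$, then $T$ is the only continuous map between these spaces that agrees with this convolution on $\mathcal S^{(1)}\times\mathcal FL^{q_2}_{(\omega_2)}$; if $q_2<\infty$, it is the only continuous map that agrees with it on $\mathcal FL^{q_1}_{(\omega_1)}\times\mathcal S^{(1)}$; if $q_1,q_2<\infty$, it is the only continuous map that extends the convolution from $\mathcal S^{(1)}\times\mathcal S^{(1)}$. 2. Assume that the weight $e^{M(|\cdot|)}$ is submultiplicative up to a constant, i.e. $e^{M(|x+y|)}\lesssim e^{M(|x|)}e^{M(|y|)}$ for $x,y\in\mathbb R^d$. If $f_1\in\mathcal FL^{q_1}_{(\omega_1),loc}(\mathbb R^d)$, $f_2\in(\mathcal D^{(M_p)})'(\mathbb R^d)$ and $f_1$ or $f_2$ has compact support, then the convolution $f_1*f_2\in(\mathcal D^{(M_p)})'(\mathbb R^d)$ is well defined and $$\mathrm{WF}_{\mathcal FL^q_{(\omega)}}(f_1*f_2)\subseteq\{(x+y,\xi)\,:\,x\in\operatorname{supp}f_1\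 \text{and}\ (y,\xi)\in\mathrm{WF}_{\mathcal FL^{q_2}_{(\omega_2)}}(f_2)\}.$$ -/

import Mathlib

open MeasureTheory Filter Set Topology
open scoped ENNReal FourierTransform

namespace UltraWF

/-- Euclidean space `ℝ^d`. -/
abbrev E (d : ℕ) : Type := EuclideanSpace ℝ (Fin d)

/-! ### Non-quasianalytic sequences and weights -/

/-- A sequence `(M_p)` of positive numbers with `M_0 = 1`, monotonically increasing to infinity, which
satisfies Komatsu's conditions `(M.1)`, `(M.2)` and `(M.3)'`.  (The requirement that `M_p ^ (1/p)` is
bounded below is automatic, since `1 = M_0 ≤ M_p`.) -/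
structure DefiningSequence where
  seq : ℕ → ℝ
  pos : ∀ p, 0 < seq p
  zero : seq 0 = 1
  mono : Monotone seq
  tendsto : Tendsto seq atTop atTop
  logConvex : ∀ p, seq (p + 1) ^ 2 ≤ seq p * seq (p + 2)
  stable : ∃ A > 0, ∃ H > 0, ∀ p q, seq (p + q) ≤ A * H ^ (p + q) * seq p * seq q
  nonQuasianalytic : Summable fun p => seq p / seq (p + 1)

/-- The associated function `M(ρ) = sup_p ln_+ (ρ ^ p M_0 / M_p)`. -/
noncomputable def DefiningSequence.assoc (M : DefiningSequence) (ρ : ℝ) : ℝ :=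
  ⨆ p : ℕ, Real.posLog (ρ ^ p * M.seq 0 / M.seq p)

/-- The weight `v(x) = e^{M(|x|)}` on `ℝ^d`. -/
noncomputable def DefiningSequence.expWeight (M : DefiningSequence) {d : ℕ} (x : E d) : ℝ :=
  Real.exp (M.assoc ‖x‖)

/-- `v` is submultiplicative, up to a constant factor. -/
def Submultiplicative {d : ℕ} (v : E d → ℝ) : Prop :=
  ∃ C, ∀ x y, v (x + y) ≤ C * (v x * v y)

/-- The class of weights on `ℝ^d` that are moderate with respect to `e^{M(|·|)}`.
Local boundedness follows from `moderate`. -/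
structure ModerateWeight (M : DefiningSequence) (d : ℕ) where
  toFun : E d → ℝ
  pos : ∀ x, 0 < toFun x
  aemeasurable : AEMeasurable toFun volume
  moderate : ∃ C, ∀ x y, toFun (x + y) ≤ C * (M.expWeight x * toFun y)

instance (M : DefiningSequence) (d : ℕ) : CoeFun (ModerateWeight M d) (fun _ => E d → ℝ) :=
  ⟨ModerateWeight.toFun⟩

/-! ### The Gelfand–Shilov space `𝓢^{(1)}` and its dual -/

/-- `‖x‖ ^ k ‖D^n f(x)‖ ≤ B h ^ (k+n) k! n!` for all `k`, `n`, `x`. The least such `B` is the value at `f`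
of the seminorm with index `h` of the Gelfand–Shilov space of Beurling type. (Using the operator norm
of the `n`-th derivative instead of the partial derivatives of order `n` only changes `h` by a factor
depending on `d`.) -/
def GSBound {d : ℕ} (f : E d → ℂ) (h B : ℝ) : Prop :=
  ∀ (k n : ℕ) (x : E d), ‖x‖ ^ k * ‖iteratedFDeriv ℝ n f x‖ ≤ B * (h ^ (k + n) * k.factorial * n.factorial)

theorem GSBound.nonneg {d : ℕ} {f : E d → ℂ} {h B : ℝ} (H : GSBound f h B) : 0 ≤ B := by
  have h0 := H 0 0 0
  have : (0 : ℝ) ≤ ‖(0 : E d)‖ ^ 0 * ‖iteratedFDeriv ℝ 0 f 0‖ := by positivity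
  simpa using this.trans h0

theorem GSBound.mono {d : ℕ} {f : E d → ℂ} {h h' B : ℝ} (H : GSBound f h B) (h0 : 0 ≤ h)
    (hh : h ≤ h') : GSBound f h' B := by
  intro k n x
  refine (H k n x).trans ?_
  have := H.nonneg
  gcongr

theorem GSBound.add {d : ℕ} {f g : E d → ℂ} {h B B' : ℝ} (hf : ContDiff ℝ (⊤ : ℕ∞) f)
    (hg : ContDiff ℝ (⊤ : ℕ∞) g) (H : GSBound f h B) (H' : GSBound g h B') : GSBound (f + g) h (B + B') := by
  intro k n x
  rw [iteratedFDeriv_add_apply (hf.contDiffAt.of_le (by exact_mod_cast le_top))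
    (hg.contDiffAt.of_le (by exact_mod_cast le_top))]
  calc _ ≤ ‖x‖ ^ k * (‖iteratedFDeriv ℝ n f x‖ + ‖iteratedFDeriv ℝ n g x‖) := by
        gcongr
        exact norm_add_le _ _
    _ ≤ _ := by
        have := H k n x
        have := H' k n x
        linarith

theorem GSBound.smul {d : ℕ} {f : E d → ℂ} {h B : ℝ} (c : ℂ) (hf : ContDiff ℝ (⊤ : ℕ∞) f)
    (H : GSBound f h B) : GSBound (c • f) h (‖c‖ * B) := by
  intro k n x
  rw [iteratedFDeriv_const_smul_apply (hf.contDiffAt.of_le (by exact_mod_cast le_top)), norm_smul]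
  have := mul_le_mul_of_nonneg_left (H k n x) (norm_nonneg c)
  linarith

/-- The Gelfand–Shilov space `𝓢^{(1)}(ℝ^d) = Σ_1^1(ℝ^d)`. -/
def GS (d : ℕ) : Submodule ℂ (E d → ℂ) where
  carrier := {f | ContDiff ℝ (⊤ : ℕ∞) f ∧ ∀ h > 0, ∃ B, GSBound f h B}
  zero_mem' := by
    refine ⟨contDiff_const, fun h _ => ⟨0, fun k n x => ?_⟩⟩
    simp [show (0 : E d → ℂ) = fun _ => 0 from rfl]
  add_mem' := by
    rintro f g ⟨hf, Hf⟩ ⟨hg, Hg⟩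
    refine ⟨hf.add hg, fun h hh => ?_⟩
    obtain ⟨B, hB⟩ := Hf h hh
    obtain ⟨B', hB'⟩ := Hg h hh
    exact ⟨_, hB.add hf hg hB'⟩
  smul_mem' := by
    rintro c f ⟨hf, Hf⟩
    refine ⟨contDiff_const.smul hf, fun h hh => ?_⟩
    obtain ⟨B, hB⟩ := Hf h hh
    exact ⟨_, hB.smul c hf⟩

/-- The dual `(𝓢^{(1)})'(ℝ^d)`: the linear functionals on `𝓢^{(1)}(ℝ^d)` that are continuous, i.e. bounded
by a multiple of one of the (directed) defining seminorms. -/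
def GSDual (d : ℕ) : Submodule ℂ (GS d →ₗ[ℂ] ℂ) where
  carrier := {u | ∃ h > 0, ∃ C, ∀ (f : GS d) (B : ℝ), GSBound (f : E d → ℂ) h B → ‖u f‖ ≤ C * B}
  zero_mem' := ⟨1, one_pos, 0, fun f B _ => by simp⟩
  add_mem' := by
    rintro u v ⟨h, hh, C, H⟩ ⟨h', hh', C', H'⟩
    refine ⟨min h h', lt_min hh hh', C + C', fun f B hB => ?_⟩
    have h1 := H f B (hB.mono (lt_min hh hh').le (min_le_left _ _))
    have h2 := H' f B (hB.mono (lt_min hh hh').le (min_le_right _ _))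
    calc ‖(u + v) f‖ ≤ ‖u f‖ + ‖v f‖ := norm_add_le _ _
      _ ≤ _ := by linarith
  smul_mem' := by
    rintro c u ⟨h, hh, C, H⟩
    refine ⟨h, hh, ‖c‖ * C, fun f B hB => ?_⟩
    have h1 := mul_le_mul_of_nonneg_left (H f B hB) (norm_nonneg c)
    simp only [LinearMap.smul_apply, norm_smul]
    linarith

instance (d : ℕ) : CoeFun (GSDual d) (fun _ => GS d → ℂ) := ⟨fun u f => u.1 f⟩

/-- Elements of `𝓢^{(1)}` are Schwartz functions. -/
noncomputable def GS.toSchwartz {d : ℕ} (f : GS d) : SchwartzMap (E d) ℂ where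
  toFun := f.1
  smooth' := f.2.1
  decay' := fun k n => by
    obtain ⟨B, hB⟩ := f.2.2 1 one_pos
    exact ⟨_, fun x => hB k n x⟩

theorem GS.integrable {d : ℕ} (f : GS d) : Integrable (f : E d → ℂ) volume :=
  (GS.toSchwartz f).integrable

theorem GSBound.norm_le {d : ℕ} {f : E d → ℂ} {h B : ℝ} (H : GSBound f h B) (x : E d) :
    ‖f x‖ ≤ B := by
  simpa using H 0 0 x

theorem GS.integrable_mul {d : ℕ} (f ψ : GS d) :
    Integrable (fun x => (f : E d → ℂ) x * (ψ : E d → ℂ) x) volume := by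
  obtain ⟨B, hB⟩ := ψ.2.2 1 one_pos
  exact (GS.integrable f).mul_bdd (c := B) ψ.2.1.continuous.aestronglyMeasurable
    (Eventually.of_forall fun x => hB.norm_le x)

/-- The embedding `𝓢^{(1)} ⊆ (𝓢^{(1)})'`, `⟨f, ψ⟩ = ∫ f ψ`. -/
noncomputable def GS.toDual {d : ℕ} (f : GS d) : GSDual d :=
  ⟨{ toFun := fun ψ => ∫ x, (f : E d → ℂ) x * (ψ : E d → ℂ) x
     map_add' := fun ψ χ => by
       rw [← integral_add (GS.integrable_mul f ψ) (GS.integrable_mul f χ)]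
       simp [mul_add]
     map_smul' := fun c ψ => by
       rw [RingHom.id_apply, smul_eq_mul, ← integral_const_mul]
       congr 1
       ext x
       simp only [Submodule.coe_smul, Pi.smul_apply, smul_eq_mul]
       ring },
   ⟨1, one_pos, ∫ x, ‖(f : E d → ℂ) x‖, fun ψ B hB => by
     change ‖∫ x, (f : E d → ℂ) x * (ψ : E d → ℂ) x‖ ≤ _
     rw [mul_comm (∫ x, ‖(f : E d → ℂ) x‖) B, ← integral_const_mul]
     refine norm_integral_le_of_norm_le ((GS.integrable f).norm.const_mul B)
       (Eventually.of_forall fun x => ?_)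
     rw [norm_mul, mul_comm]
     exact mul_le_mul_of_nonneg_right (hB.norm_le x) (norm_nonneg _)⟩⟩

/-- `y ↦ f (x - y)`, an element of `𝓢^{(1)}`. -/
def GS.reflTranslate {d : ℕ} (x : E d) (f : GS d) : GS d :=
  ⟨fun y => (f : E d → ℂ) (x - y), by
    refine ⟨f.2.1.comp (contDiff_const.sub contDiff_id), fun h hh => ?_⟩
    obtain ⟨B, hB⟩ := f.2.2 (h / 2) (by positivity)
    refine ⟨B * (Real.exp (‖x‖ / (h / 2)) + 1), fun k n y => ?_⟩
    have hd : ‖iteratedFDeriv ℝ n (fun y => (f : E d → ℂ) (x - y)) y‖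
        = ‖iteratedFDeriv ℝ n (f : E d → ℂ) (x - y)‖ := by
      have h1 := (LinearIsometryEquiv.neg ℝ (E := E d)).norm_iteratedFDeriv_comp_right
        (fun z => (f : E d → ℂ) (x + z)) y n
      rw [iteratedFDeriv_comp_add_left] at h1
      simpa [Function.comp_def, sub_eq_add_neg] using h1
    rw [hd]
    have hB0 := hB.nonneg
    have hyx : ‖y‖ ≤ ‖x‖ + ‖x - y‖ := by
      calc ‖y‖ = ‖x - (x - y)‖ := by simp
        _ ≤ _ := norm_sub_le _ _
    have h1 : ‖y‖ ^ k ≤ 2 ^ k * (‖x‖ ^ k + ‖x - y‖ ^ k) := by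
      refine (pow_le_pow_left₀ (norm_nonneg _) hyx k).trans ?_
      refine (add_pow_le (norm_nonneg _) (norm_nonneg _) k).trans ?_
      gcongr
      · norm_num
      · exact Nat.sub_le _ _
    have h2 : ‖x‖ ^ k ≤ Real.exp (‖x‖ / (h / 2)) * ((h / 2) ^ k * k.factorial) := by
      have := Real.pow_div_factorial_le_exp (‖x‖ / (h / 2)) (by positivity) k
      rw [div_le_iff₀ (by positivity), div_pow, div_le_iff₀ (by positivity)] at this
      linarith
    have h3 := hB 0 n (x - y)
    have h4 := hB k n (x - y)
    simp only [pow_zero, one_mul, zero_add, Nat.factorial_zero, Nat.cast_one, mul_one] at h3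
    calc ‖y‖ ^ k * ‖iteratedFDeriv ℝ n (f : E d → ℂ) (x - y)‖
        ≤ 2 ^ k * (‖x‖ ^ k + ‖x - y‖ ^ k) * ‖iteratedFDeriv ℝ n (f : E d → ℂ) (x - y)‖ := by
          gcongr
      _ = 2 ^ k * (‖x‖ ^ k * ‖iteratedFDeriv ℝ n (f : E d → ℂ) (x - y)‖
          + ‖x - y‖ ^ k * ‖iteratedFDeriv ℝ n (f : E d → ℂ) (x - y)‖) := by ring
      _ ≤ 2 ^ k * (Real.exp (‖x‖ / (h / 2)) * ((h / 2) ^ k * k.factorial) * (B * ((h / 2) ^ n * n.factorial))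
          + B * ((h / 2) ^ (k + n) * k.factorial * n.factorial)) := by
          gcongr
      _ = B * (Real.exp (‖x‖ / (h / 2)) + 1) * (2 ^ k * (h / 2) ^ (k + n) * k.factorial * n.factorial) := by ring
      _ ≤ B * (Real.exp (‖x‖ / (h / 2)) + 1) * (h ^ (k + n) * k.factorial * n.factorial) := by
          have : (2 : ℝ) ^ k * (h / 2) ^ (k + n) ≤ h ^ (k + n) := by
            rw [div_pow, mul_div_assoc', div_le_iff₀ (by positivity), mul_comm]
            gcongr
            · norm_num
            · exact Nat.le_add_right _ _
          gcongr⟩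

/-- The convolution `(f * g)(x) = ∫ f(t) g(x - t) dt` of functions. -/
noncomputable def conv {d : ℕ} (f g : E d → ℂ) (x : E d) : ℂ := ∫ t, f t * g (x - t)

/-- The convolution `f * u` of `f ∈ 𝓢^{(1)}` and `u ∈ (𝓢^{(1)})'`, which is the function
`x ↦ ⟨u, f(x - ·)⟩`. -/
noncomputable def GS.convDual {d : ℕ} (f : GS d) (u : GSDual d) (x : E d) : ℂ :=
  u (GS.reflTranslate x f)

/-! ### Fourier transform on `(𝓢^{(1)})'` and Fourier–Lebesgue spaces -/

/-- The Fourier transform of `u ∈ (𝓢^{(1)})'` is the function `g`, i.e. `u` is the inverse Fourier transform of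
`g`: `⟨u, ψ⟩ = ⟨g, 𝓕⁻¹ ψ⟩` for all test functions `ψ`. Here `𝓕⁻¹ ψ (ξ) = ∫ e^{2πi⟨x, ξ⟩} ψ(x) dx`. -/
def HasFourier {d : ℕ} (u : GSDual d) (g : E d → ℂ) : Prop :=
  AEStronglyMeasurable g volume ∧ ∀ ψ : GS d,
    Integrable (fun ξ => g ξ * 𝓕⁻ (ψ : E d → ℂ) ξ) volume ∧
      u ψ = ∫ ξ, g ξ * 𝓕⁻ (ψ : E d → ℂ) ξ

/-- `|u|_{𝓕L^{q,Γ}_{(ω)}} = ‖û ω‖_{L^q(Γ)}`, with the value `∞` if `û` is not a function. (The function `û`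
is unique almost everywhere, if it exists, so that the infimum is over equal numbers.) -/
noncomputable def flSeminorm {M : DefiningSequence} {d : ℕ} (q : ℝ≥0∞) (ω : ModerateWeight M d)
    (Γ : Set (E d)) (u : GSDual d) : ℝ≥0∞ :=
  ⨅ (g : E d → ℂ) (_ : HasFourier u g), eLpNorm (fun ξ => g ξ * (ω ξ : ℂ)) q (volume.restrict Γ)

section Norm

variable {M : DefiningSequence} {d : ℕ} (q : ℝ≥0∞) (ω : ModerateWeight M d) (Γ : Set (E d))

theorem HasFourier.zero : HasFourier (0 : GSDual d) 0 :=
  ⟨aestronglyMeasurable_const, fun ψ => ⟨by simp, by simp⟩⟩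

theorem HasFourier.add {u v : GSDual d} {g g' : E d → ℂ} (h : HasFourier u g)
    (h' : HasFourier v g') : HasFourier (u + v) (g + g') := by
  refine ⟨h.1.add h'.1, fun ψ => ?_⟩
  have e : (fun ξ => (g + g') ξ * 𝓕⁻ (ψ : E d → ℂ) ξ)
      = fun ξ => g ξ * 𝓕⁻ (ψ : E d → ℂ) ξ + g' ξ * 𝓕⁻ (ψ : E d → ℂ) ξ := by
    ext ξ; simp [add_mul]
  rw [e]
  refine ⟨(h.2 ψ).1.add (h'.2 ψ).1, ?_⟩
  rw [integral_add (h.2 ψ).1 (h'.2 ψ).1, ← (h.2 ψ).2, ← (h'.2 ψ).2]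
  rfl

theorem HasFourier.smul (c : ℂ) {u : GSDual d} {g : E d → ℂ} (h : HasFourier u g) :
    HasFourier (c • u) (c • g) := by
  refine ⟨h.1.const_smul c, fun ψ => ?_⟩
  have e : (fun ξ => (c • g) ξ * 𝓕⁻ (ψ : E d → ℂ) ξ)
      = fun ξ => c * (g ξ * 𝓕⁻ (ψ : E d → ℂ) ξ) := by
    ext ξ; simp [mul_assoc]
  rw [e]
  refine ⟨(h.2 ψ).1.const_mul c, ?_⟩
  rw [integral_const_mul, ← (h.2 ψ).2]
  rfl

theorem flSeminorm_zero : flSeminorm q ω Γ 0 = 0 := by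
  refine le_antisymm (iInf₂_le_of_le 0 HasFourier.zero ?_) zero_le
  simp

theorem flSeminorm_add [Fact (1 ≤ q)] (u v : GSDual d) :
    flSeminorm q ω Γ (u + v) ≤ flSeminorm q ω Γ u + flSeminorm q ω Γ v := by
  unfold flSeminorm
  simp only [ENNReal.iInf_add, ENNReal.add_iInf]
  refine le_iInf₂ fun g hg => le_iInf₂ fun g' hg' => ?_
  refine iInf₂_le_of_le _ (hg'.add hg) ?_
  have m : AEStronglyMeasurable (fun ξ => (ω ξ : ℂ)) volume :=
    (Complex.measurable_ofReal.comp_aemeasurable ω.aemeasurable).aestronglyMeasurable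
  have e : (fun ξ => (g' + g) ξ * (ω ξ : ℂ))
      = (fun ξ => g' ξ * (ω ξ : ℂ)) + fun ξ => g ξ * (ω ξ : ℂ) := by
    ext ξ; simp [add_mul]
  rw [e]
  exact eLpNorm_add_le (hg'.1.mul m).restrict (hg.1.mul m).restrict Fact.out

theorem flSeminorm_smul_le (c : ℂ) (u : GSDual d) :
    flSeminorm q ω Γ (c • u) ≤ ‖c‖ₑ * flSeminorm q ω Γ u := by
  unfold flSeminorm
  rcases eq_or_ne c 0 with rfl | hc
  · rw [zero_smul]
    refine iInf₂_le_of_le 0 HasFourier.zero ?_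
    simp
  · simp only [ENNReal.mul_iInf_of_ne (enorm_ne_zero.2 hc) enorm_ne_top]
    refine le_iInf₂ fun g hg => iInf₂_le_of_le _ (hg.smul c) ?_
    have e : (fun ξ => (c • g) ξ * (ω ξ : ℂ)) = c • fun ξ => g ξ * (ω ξ : ℂ) := by
      ext ξ; simp [mul_assoc]
    rw [e]
    exact eLpNorm_const_smul_le

theorem flSeminorm_smul (c : ℂ) (u : GSDual d) :
    flSeminorm q ω Γ (c • u) = ‖c‖ₑ * flSeminorm q ω Γ u := by
  rcases eq_or_ne c 0 with rfl | hc
  · simp [flSeminorm_zero]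
  · refine le_antisymm (flSeminorm_smul_le q ω Γ c u) ?_
    have h := flSeminorm_smul_le q ω Γ c⁻¹ (c • u)
    rw [inv_smul_smul₀ hc] at h
    calc ‖c‖ₑ * flSeminorm q ω Γ u ≤ ‖c‖ₑ * (‖c⁻¹‖ₑ * flSeminorm q ω Γ (c • u)) := by gcongr
      _ = flSeminorm q ω Γ (c • u) := by
        rw [← mul_assoc, ← enorm_mul, mul_inv_cancel₀ hc, enorm_one, one_mul]

end Norm

/-- The Fourier–Lebesgue space `𝓕L^q_{(ω)}(ℝ^d)`. -/
def FL {M : DefiningSequence} {d : ℕ} (q : ℝ≥0∞) [Fact (1 ≤ q)] (ω : ModerateWeight M d) :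
    Submodule ℂ (GSDual d) where
  carrier := {u | flSeminorm q ω univ u < ∞}
  zero_mem' := by simp [flSeminorm_zero]
  add_mem' := fun {u v} hu hv =>
    (flSeminorm_add q ω univ u v).trans_lt (ENNReal.add_lt_top.2 ⟨hu, hv⟩)
  smul_mem' := fun c u hu => by
    change flSeminorm q ω univ (c • u) < ∞
    rw [flSeminorm_smul]
    exact ENNReal.mul_lt_top enorm_lt_top hu

section FLInstances

variable {M : DefiningSequence} {d : ℕ} (q : ℝ≥0∞) [Fact (1 ≤ q)] (ω : ModerateWeight M d)

/-- `‖u‖ = ‖û ω‖_{L^q}`. -/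
noncomputable instance : Norm (FL q ω) := ⟨fun u => (flSeminorm q ω univ (u : GSDual d)).toReal⟩

theorem FL.core : SeminormedSpace.Core ℂ (FL q ω) where
  norm_nonneg _ := ENNReal.toReal_nonneg
  norm_smul c u := by
    change (flSeminorm q ω univ (c • (u : GSDual d))).toReal = _
    rw [flSeminorm_smul, ENNReal.toReal_mul, toReal_enorm]
    rfl
  norm_triangle u v := by
    change (flSeminorm q ω univ ((u : GSDual d) + v)).toReal ≤ _
    refine (ENNReal.toReal_mono (ENNReal.add_lt_top.2 ⟨u.2, v.2⟩).ne
      (flSeminorm_add q ω univ (u : GSDual d) v)).trans ?_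
    rw [ENNReal.toReal_add u.2.ne v.2.ne]
    rfl

/-- The norm topology of `𝓕L^q_{(ω)}`. -/
noncomputable instance : SeminormedAddCommGroup (FL q ω) := SeminormedAddCommGroup.ofCore (FL.core q ω)

end FLInstances

/-! ### Ultradifferentiable test functions and ultradistributions of Beurling type -/

/-- `‖D^n f(x)‖ ≤ B h ^ n M_n` for all `n` and `x`. -/
def UDBound (M : DefiningSequence) {d : ℕ} (f : E d → ℂ) (h B : ℝ) : Prop :=
  ∀ (n : ℕ) (x : E d), ‖iteratedFDeriv ℝ n f x‖ ≤ B * (h ^ n * M.seq n)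

section UD

variable {M : DefiningSequence} {d : ℕ}

theorem UDBound.nonneg {f : E d → ℂ} {h B : ℝ} (H : UDBound M f h B) : 0 ≤ B := by
  have h0 := H 0 0
  rw [pow_zero, one_mul, M.zero, mul_one] at h0
  exact (norm_nonneg _).trans h0

theorem UDBound.mono {f : E d → ℂ} {h h' B : ℝ} (H : UDBound M f h B) (h0 : 0 ≤ h)
    (hh : h ≤ h') : UDBound M f h' B := by
  intro n x
  refine (H n x).trans ?_
  have := H.nonneg
  have := (M.pos n).le
  gcongr

theorem UDBound.add {f g : E d → ℂ} {h B B' : ℝ} (hf : ContDiff ℝ (⊤ : ℕ∞) f)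
    (hg : ContDiff ℝ (⊤ : ℕ∞) g) (H : UDBound M f h B) (H' : UDBound M g h B') :
    UDBound M (f + g) h (B + B') := by
  intro n x
  rw [iteratedFDeriv_add_apply (hf.contDiffAt.of_le (by exact_mod_cast le_top))
    (hg.contDiffAt.of_le (by exact_mod_cast le_top)), add_mul]
  exact (norm_add_le _ _).trans (add_le_add (H n x) (H' n x))

theorem UDBound.smul {f : E d → ℂ} {h B : ℝ} (c : ℂ) (hf : ContDiff ℝ (⊤ : ℕ∞) f)
    (H : UDBound M f h B) : UDBound M (c • f) h (‖c‖ * B) := by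
  intro n x
  rw [iteratedFDeriv_const_smul_apply (hf.contDiffAt.of_le (by exact_mod_cast le_top)), norm_smul,
    mul_assoc]
  exact mul_le_mul_of_nonneg_left (H n x) (norm_nonneg c)

variable (M) in
theorem DefiningSequence.mul_le (p q : ℕ) : M.seq p * M.seq q ≤ M.seq (p + q) := by
  have hr : Monotone fun p => M.seq (p + 1) / M.seq p := by
    refine monotone_nat_of_le_succ fun p => ?_
    rw [div_le_div_iff₀ (M.pos _) (M.pos _)]
    have := M.logConvex p
    nlinarith
  induction q with
  | zero => simp [M.zero]
  | succ q ih =>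
    have h1 : M.seq (q + 1) / M.seq q ≤ M.seq (p + q + 1) / M.seq (p + q) :=
      hr (Nat.le_add_left q p)
    have e1 : M.seq (q + 1) = M.seq q * (M.seq (q + 1) / M.seq q) := by
      have := (M.pos q).ne'
      field_simp
    have e2 : M.seq (p + q + 1) = M.seq (p + q) * (M.seq (p + q + 1) / M.seq (p + q)) := by
      have := (M.pos (p + q)).ne'
      field_simp
    rw [← add_assoc, e1, e2, ← mul_assoc]
    have := M.pos q
    have := M.pos (q + 1)
    have := M.pos (p + q)
    gcongr

variable (M) in
/-- Real-analytic-type bounds are stronger than ultradifferentiable ones: `n! ≤ S ^ n M_n`. -/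
theorem DefiningSequence.exists_factorial_le : ∃ S > 0, ∀ n : ℕ, (n.factorial : ℝ) ≤ S ^ n * M.seq n := by
  set a : ℕ → ℝ := fun p => M.seq p / M.seq (p + 1) with ha
  have ha0 : ∀ p, 0 < a p := fun p => div_pos (M.pos _) (M.pos _)
  have hanti : Antitone a := by
    refine antitone_nat_of_succ_le fun p => ?_
    rw [ha, div_le_div_iff₀ (M.pos _) (M.pos _)]
    have := M.logConvex p
    nlinarith
  have hS : 0 < ∑' p, a p := M.nonQuasianalytic.tsum_pos (fun p => (ha0 p).le) 0 (ha0 0)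
  refine ⟨∑' p, a p, hS, fun n => ?_⟩
  induction n with
  | zero => simp [M.zero]
  | succ n ih =>
    have h1 : ((n + 1 : ℕ) : ℝ) * a n ≤ ∑' p, a p := by
      calc ((n + 1 : ℕ) : ℝ) * a n = ∑ i ∈ Finset.range (n + 1), a n := by simp
        _ ≤ ∑ i ∈ Finset.range (n + 1), a i :=
          Finset.sum_le_sum fun i hi => hanti (Nat.lt_succ_iff.1 (Finset.mem_range.1 hi))
        _ ≤ _ := M.nonQuasianalytic.sum_le_tsum _ fun p _ => (ha0 p).le
    have e : M.seq n = a n * M.seq (n + 1) := by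
      have := (M.pos (n + 1)).ne'
      simp only [ha]
      field_simp
    rw [Nat.factorial_succ, Nat.cast_mul]
    calc ((n + 1 : ℕ) : ℝ) * (n.factorial : ℝ) ≤ ((n + 1 : ℕ) : ℝ) * ((∑' p, a p) ^ n * M.seq n) := by gcongr
      _ = (((n + 1 : ℕ) : ℝ) * a n) * ((∑' p, a p) ^ n * M.seq (n + 1)) := by rw [e]; ring
      _ ≤ (∑' p, a p) * ((∑' p, a p) ^ n * M.seq (n + 1)) := by
        have := M.pos (n + 1)
        gcongr
      _ = _ := by ring

theorem UDBound.mul {f g : E d → ℂ} {h B B' : ℝ} (h0 : 0 ≤ h) (hf : ContDiff ℝ (⊤ : ℕ∞) f)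
    (hg : ContDiff ℝ (⊤ : ℕ∞) g) (H : UDBound M f h B) (H' : UDBound M g h B') :
    UDBound M (fun x => f x * g x) (2 * h) (B * B') := by
  intro n x
  have hB := H.nonneg
  have hB' := H'.nonneg
  refine (norm_iteratedFDeriv_mul_le hf hg x (n := n) (by exact_mod_cast le_top)).trans ?_
  calc _ ≤ ∑ i ∈ Finset.range (n + 1), (n.choose i : ℝ) * (B * B' * (h ^ n * M.seq n)) := by
        refine Finset.sum_le_sum fun i hi => ?_
        have hi' : i ≤ n := Nat.lt_succ_iff.1 (Finset.mem_range.1 hi)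
        have hM := M.mul_le i (n - i)
        rw [Nat.add_sub_cancel' hi'] at hM
        have hp : h ^ n = h ^ i * h ^ (n - i) := by rw [← pow_add, Nat.add_sub_cancel' hi']
        have := (M.pos i).le
        have := (M.pos (n - i)).le
        calc (n.choose i : ℝ) * ‖iteratedFDeriv ℝ i f x‖ * ‖iteratedFDeriv ℝ (n - i) g x‖
            ≤ (n.choose i : ℝ) * (B * (h ^ i * M.seq i)) * (B' * (h ^ (n - i) * M.seq (n - i))) := by
              gcongr
              · exact H i x
              · exact H' (n - i) x
          _ = (n.choose i : ℝ) * (B * B' * (h ^ n * (M.seq i * M.seq (n - i)))) := by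
              rw [hp]; ring
          _ ≤ _ := by gcongr
    _ = _ := by
        rw [← Finset.sum_mul]
        have := Nat.sum_range_choose n
        have h2 : (∑ i ∈ Finset.range (n + 1), (n.choose i : ℝ)) = 2 ^ n := by exact_mod_cast this
        rw [h2, mul_pow]; ring

end UD

/-- The space `𝓓^{(M_p)}(ℝ^d)` of compactly supported ultradifferentiable functions of Beurling type. -/
def TestFun (M : DefiningSequence) (d : ℕ) : Submodule ℂ (E d → ℂ) where
  carrier := {f | ContDiff ℝ (⊤ : ℕ∞) f ∧ HasCompactSupport f ∧ ∀ h > 0, ∃ B, UDBound M f h B}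
  zero_mem' := by
    refine ⟨contDiff_const, HasCompactSupport.zero, fun h _ => ⟨0, fun n x => ?_⟩⟩
    simp [show (0 : E d → ℂ) = fun _ => 0 from rfl]
  add_mem' := by
    rintro f g ⟨hf, cf, Hf⟩ ⟨hg, cg, Hg⟩
    refine ⟨hf.add hg, cf.add cg, fun h hh => ?_⟩
    obtain ⟨B, hB⟩ := Hf h hh
    obtain ⟨B', hB'⟩ := Hg h hh
    exact ⟨_, hB.add hf hg hB'⟩
  smul_mem' := by
    rintro c f ⟨hf, cf, Hf⟩
    refine ⟨contDiff_const.smul hf, cf.smul_left (f := fun _ => c), fun h hh => ?_⟩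
    obtain ⟨B, hB⟩ := Hf h hh
    exact ⟨_, hB.smul c hf⟩

/-- The space `(𝓓^{(M_p)})'(ℝ^d)` of ultradistributions of Beurling type: linear functionals on `𝓓^{(M_p)}(ℝ^d)`
whose restriction to the test functions supported in `K` is continuous for each compact `K` (this is
continuity for the inductive limit topology). -/
def UDist (M : DefiningSequence) (d : ℕ) : Submodule ℂ (TestFun M d →ₗ[ℂ] ℂ) where
  carrier := {f | ∀ K : Set (E d), IsCompact K → ∃ h > 0, ∃ C, ∀ φ : TestFun M d,
    tsupport (φ : E d → ℂ) ⊆ K → ∀ B, UDBound M (φ : E d → ℂ) h B → ‖f φ‖ ≤ C * B}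
  zero_mem' := fun _ _ => ⟨1, one_pos, 0, fun _ _ _ _ => by simp⟩
  add_mem' := by
    intro f g Hf Hg K hK
    obtain ⟨h, hh, C, H⟩ := Hf K hK
    obtain ⟨h', hh', C', H'⟩ := Hg K hK
    refine ⟨min h h', lt_min hh hh', C + C', fun φ hφ B hB => ?_⟩
    have h1 := H φ hφ B (hB.mono (lt_min hh hh').le (min_le_left _ _))
    have h2 := H' φ hφ B (hB.mono (lt_min hh hh').le (min_le_right _ _))
    calc ‖(f + g) φ‖ ≤ ‖f φ‖ + ‖g φ‖ := norm_add_le _ _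
      _ ≤ _ := by linarith
  smul_mem' := by
    intro c f Hf K hK
    obtain ⟨h, hh, C, H⟩ := Hf K hK
    refine ⟨h, hh, ‖c‖ * C, fun φ hφ B hB => ?_⟩
    have h1 := mul_le_mul_of_nonneg_left (H φ hφ B hB) (norm_nonneg c)
    simp only [LinearMap.smul_apply, norm_smul]
    linarith

instance (M : DefiningSequence) (d : ℕ) : CoeFun (UDist M d) (fun _ => TestFun M d → ℂ) :=
  ⟨fun u f => u.1 f⟩

section Operations

variable {M : DefiningSequence} {d : ℕ}

/-- Elements of `𝓢^{(1)}` are ultradifferentiable. -/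
theorem exists_udBound_of_gsBound (M : DefiningSequence) : ∃ S > 0, ∀ {d : ℕ} {f : E d → ℂ} {h B : ℝ},
    0 ≤ h → GSBound f h B → UDBound M f (h * S) B := by
  obtain ⟨S, hS, H⟩ := M.exists_factorial_le
  refine ⟨S, hS, fun {d f h B} h0 hB n x => ?_⟩
  have h1 := hB 0 n x
  have := hB.nonneg
  simp only [pow_zero, one_mul, zero_add, Nat.factorial_zero, Nat.cast_one, mul_one] at h1
  refine h1.trans ?_
  rw [mul_pow, mul_assoc]
  gcongr
  exact H n

theorem GS.exists_udBound (ψ : GS d) (h : ℝ) (hh : 0 < h) : ∃ B, UDBound M (ψ : E d → ℂ) h B := by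
  obtain ⟨S, hS, H⟩ := exists_udBound_of_gsBound M
  obtain ⟨B, hB⟩ := ψ.2.2 (h / S) (by positivity)
  refine ⟨B, ?_⟩
  have := H (by positivity) hB
  rwa [div_mul_cancel₀ _ hS.ne'] at this

/-- The product `φ ψ ∈ 𝓓^{(M_p)}` of `φ ∈ 𝓓^{(M_p)}` and `ψ ∈ 𝓢^{(1)}`. -/
def TestFun.mulGS (φ : TestFun M d) (ψ : GS d) : TestFun M d :=
  ⟨fun x => (φ : E d → ℂ) x * (ψ : E d → ℂ) x, by
    refine ⟨φ.2.1.mul ψ.2.1, φ.2.2.1.mul_right, fun h hh => ?_⟩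
    obtain ⟨B, hB⟩ := φ.2.2.2 (h / 2) (by positivity)
    obtain ⟨B', hB'⟩ := GS.exists_udBound (M := M) ψ (h / 2) (by positivity)
    refine ⟨B * B', ?_⟩
    have := hB.mul (by positivity) φ.2.1 ψ.2.1 hB'
    rwa [mul_div_cancel₀ _ (two_ne_zero)] at this⟩

/-- The compactly supported ultradistribution `φ f`, for `φ ∈ 𝓓^{(M_p)}` and `f ∈ (𝓓^{(M_p)})'`, as an element of
`(𝓢^{(1)})'`: `⟨φ f, ψ⟩ = ⟨f, φ ψ⟩`. -/
def UDist.cutoff (φ : TestFun M d) (f : UDist M d) : GSDual d :=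
  ⟨{ toFun := fun ψ => f (TestFun.mulGS φ ψ)
     map_add' := fun ψ χ => by
       rw [← map_add]
       congr 1
       ext x
       simp [TestFun.mulGS, mul_add]
     map_smul' := fun c ψ => by
       rw [← map_smul]
       congr 1
       ext x
       simp only [TestFun.mulGS, Submodule.coe_smul, Pi.smul_apply, smul_eq_mul, RingHom.id_apply]
       ring },
   by
     obtain ⟨S, hS, HS⟩ := exists_udBound_of_gsBound M
     obtain ⟨h, hh, C, H⟩ := f.2 _ φ.2.2.1
     obtain ⟨B', hB'⟩ := φ.2.2.2 (h / 2) (by positivity)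
     refine ⟨h / 2 / S, by positivity, C * B', fun ψ B hB => ?_⟩
     have h1 := HS (by positivity) hB
     rw [div_mul_cancel₀ _ hS.ne'] at h1
     have h2 := hB'.mul (by positivity) φ.2.1 ψ.2.1 h1
     rw [mul_div_cancel₀ _ (two_ne_zero)] at h2
     rw [mul_assoc]
     exact H (TestFun.mulGS φ ψ) (tsupport_mul_subset_left) _ h2⟩

/-- `y ↦ φ (x + y)`, an element of `𝓓^{(M_p)}`. -/
def TestFun.translate (x : E d) (φ : TestFun M d) : TestFun M d :=
  ⟨fun y => (φ : E d → ℂ) (x + y), by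
    refine ⟨φ.2.1.comp (contDiff_const.add contDiff_id),
      φ.2.2.1.comp_homeomorph (Homeomorph.addLeft x), fun h hh => ?_⟩
    obtain ⟨B, hB⟩ := φ.2.2.2 h hh
    refine ⟨B, fun n y => ?_⟩
    rw [iteratedFDeriv_comp_add_left]
    exact hB n _⟩

/-- The support of an ultradistribution: `x ∉ supp f` iff `f` vanishes in some neighbourhood of `x`. -/
def UDist.supp (f : UDist M d) : Set (E d) :=
  {x | ∀ U : Set (E d), IsOpen U → x ∈ U →
    ∃ φ : TestFun M d, tsupport (φ : E d → ℂ) ⊆ U ∧ f φ ≠ 0}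

/-- `w` is the convolution `f₁ * f₂`, i.e. `⟨w, φ⟩ = ⟨f₁(x), ⟨f₂(y), φ(x + y)⟩⟩` for every test function `φ`.
When `supp f₁` or `supp f₂` is compact, the points `x ∈ supp f₁` with `x + y ∈ supp φ` for some `y ∈ supp f₂`
form a compact set, and in order to apply `f₁` one multiplies by a cut-off function `χ` that is equal to `1`
in a neighbourhood of this set. -/
def IsConvolution (f₁ f₂ w : UDist M d) : Prop :=
  ∀ φ χ : TestFun M d,
    (∀ᶠ x in 𝓝ˢ {x | x ∈ UDist.supp f₁ ∧ ∃ y ∈ UDist.supp f₂, x + y ∈ tsupport (φ : E d → ℂ)},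
      (χ : E d → ℂ) x = 1) →
    ∃ θ : TestFun M d,
      (∀ x, (θ : E d → ℂ) x = (χ : E d → ℂ) x * f₂ (TestFun.translate x φ)) ∧ w φ = f₁ θ

end Operations

/-! ### Local Fourier–Lebesgue spaces and wave-front sets -/

section WaveFront

variable {M : DefiningSequence} {d : ℕ}

/-- The local Fourier–Lebesgue space `𝓕L^q_{(ω),loc}(ℝ^d)`. -/
def FLloc (q : ℝ≥0∞) [Fact (1 ≤ q)] (ω : ModerateWeight M d) : Set (UDist M d) :=
  {f | ∀ φ : TestFun M d, UDist.cutoff φ f ∈ FL q ω}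

/-- `Γ ⊆ ℝ^d \ 0` is an open cone. -/
def IsOpenCone (Γ : Set (E d)) : Prop :=
  IsOpen Γ ∧ (0 : E d) ∉ Γ ∧ ∀ ξ ∈ Γ, ∀ t : ℝ, 0 < t → t • ξ ∈ Γ

/-- `Θ(u)`: the directions `ξ ≠ 0` such that `|u|_{𝓕L^{q,Γ}_{(ω)}} < ∞` for some open conical neighbourhood `Γ`
of `ξ`. -/
def regularDirections (q : ℝ≥0∞) (ω : ModerateWeight M d) (u : GSDual d) : Set (E d) :=
  {ξ | ∃ Γ, IsOpenCone Γ ∧ ξ ∈ Γ ∧ flSeminorm q ω Γ u < ∞}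

/-- `Σ(u)`: the complement of `Θ(u)` in `ℝ^d \ 0`. -/
def singularDirections (q : ℝ≥0∞) (ω : ModerateWeight M d) (u : GSDual d) : Set (E d) :=
  {ξ | ξ ≠ 0 ∧ ξ ∉ regularDirections q ω u}

/-- The wave-front set of an ultradistribution with respect to `𝓕L^q_{(ω)}`. -/
def waveFrontSet (q : ℝ≥0∞) (ω : ModerateWeight M d) (f : UDist M d) : Set (E d × E d) :=
  {p | p.2 ≠ 0 ∧ ∀ φ : TestFun M d, (φ : E d → ℂ) p.1 ≠ 0 →
    p.2 ∈ singularDirections q ω (UDist.cutoff φ f)}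

end WaveFront

/-! ### Extensions of the convolution to Fourier–Lebesgue spaces -/

section Extension

variable {M : DefiningSequence} {d : ℕ} {q q₁ q₂ : ℝ≥0∞} [Fact (1 ≤ q)] [Fact (1 ≤ q₁)] [Fact (1 ≤ q₂)]
  {ω ω₁ ω₂ : ModerateWeight M d}

/-- `T` extends the convolution map from `𝓢^{(1)} × 𝓢^{(1)}` to `𝓢^{(1)}`. -/
def ExtendsConv (T : FL q₁ ω₁ × FL q₂ ω₂ → FL q ω) : Prop :=
  ∀ f₁ f₂ : GS d, ∃ (h₁ : GS.toDual f₁ ∈ FL q₁ ω₁) (h₂ : GS.toDual f₂ ∈ FL q₂ ω₂) (h : conv f₁ f₂ ∈ GS d),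
    (T (⟨GS.toDual f₁, h₁⟩, ⟨GS.toDual f₂, h₂⟩) : GSDual d) = GS.toDual ⟨conv f₁ f₂, h⟩

/-- `T(f₁, u₂) = f₁ * u₂` for `f₁ ∈ 𝓢^{(1)}` and all `u₂`, where `f₁ * u₂` is the convolution of a test function
and an element of `(𝓢^{(1)})'`. -/
def ExtendsConvLeft (T : FL q₁ ω₁ × FL q₂ ω₂ → FL q ω) : Prop :=
  ∀ (f₁ : GS d) (u₂ : FL q₂ ω₂), ∃ h₁ : GS.toDual f₁ ∈ FL q₁ ω₁, ∀ ψ : GS d,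
    (T (⟨GS.toDual f₁, h₁⟩, u₂) : GSDual d) ψ = ∫ x, GS.convDual f₁ u₂ x * (ψ : E d → ℂ) x

/-- `T(u₁, f₂) = u₁ * f₂` for all `u₁` and `f₂ ∈ 𝓢^{(1)}`. -/
def ExtendsConvRight (T : FL q₁ ω₁ × FL q₂ ω₂ → FL q ω) : Prop :=
  ∀ (u₁ : FL q₁ ω₁) (f₂ : GS d), ∃ h₂ : GS.toDual f₂ ∈ FL q₂ ω₂, ∀ ψ : GS d,
    (T (u₁, ⟨GS.toDual f₂, h₂⟩) : GSDual d) ψ = ∫ x, GS.convDual f₂ u₁ x * (ψ : E d → ℂ) x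

end Extension

end UltraWF

open UltraWF

/-!
# Convolution in Fourier–Lebesgue spaces and wave-front sets of ultradistributions

The Fourier transform turns both parts of the theorem into statements about products.

**The convolution map.** The element `T(u₁, u₂)` is the functional with Fourier transform `û₁ û₂`. It is well
defined because the Fourier transform of a functional on `𝓢^{(1)}` is unique almost everywhere
(`HasFourier.ae_eq`; one tests with translates of a Gaussian) and because every element of a weighted `L^q` space
is the Fourier transform of a functional on `𝓢^{(1)}` (`UltraTempered.of_memLp`). Hölder's inequality with
weights, `eLpNorm_mul_weight_le`, gives continuity. For `f ∈ 𝓢^{(1)}` the value `(f * u)(x)` of the usual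
convolution is the inverse Fourier transform of `f̂ û` at `x`, so that `T` extends the convolution by Fubini's
theorem (`HasFourier.apply_eq_integral_convDual`). Uniqueness holds because `𝓢^{(1)}` is dense in `𝓕L^q_{(ω)}` for
`q < ∞` (`GS.denseRange_toFL`): on the Fourier side, `C_c` is dense, and `g ∈ C_c` is the limit of its
convolutions with heat kernels, which are the Fourier transforms of the products of the band-limited function
`𝓕⁻ g` with Gaussians.

**Localization.** Non-quasianalyticity provides test functions (`DefiningSequence.exists_bump`, the Denjoy–Carleman
theorem), hence cut-off functions and partitions of unity. If `f` is an ultradistribution and `χ` a test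
function, the Fourier transform of `χ f` is a function bounded by a multiple of `e^{M(k|ξ|)}` for some `k`: the
continuity of `f` is an estimate in a weighted `L²` norm on the Fourier side, and the Riesz representation theorem
applies (`UDist.exists_isFourierOf`). The function `x ↦ ⟨f₂(y), φ(x + y)⟩` therefore coincides on each compact set
with `𝓕 (F₂ 𝓕⁻ φ)`, which is ultradifferentiable, and
`⟨f₁ * f₂, φ⟩ = ⟨f₁(x), χ(x) ⟨f₂(y), φ(x + y)⟩⟩` defines the convolution when `χ = 1` near the compact set of all
`x ∈ supp f₁` with `x + y ∈ supp φ` for some `y ∈ supp f₂` (`UDist.exists_convolution`).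

**Wave-front sets.** Two facts reduce the inclusion to Hölder's inequality on a cone. Convolution with a rapidly
decreasing function preserves the weighted `L^q` space on a cone, after the cone has been shrunk
(`exists_cone_eLpNorm_conv_lt_top`). And a cut-off function `χ` with `χ(y) ≠ 0` divides every test function with
support near `y` (`TestFun.exists_eq_mul`), so that regularity at `(y, ξ₀)` may be expressed by cut-off functions
equal to `1` near `y` (`exists_cutoff_of_notMem_waveFrontSet`). The division rests on the submultiplicativity of
`e^{M(|·|)}`: the functions `b` with `b = O(e^{-M(k|ξ|)})` then behave like Banach algebras under convolution, in
which the spectral radius of `𝓕⁻ r` is `sup |r|` because the weights grow subexponentially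
(`TestFun.exists_fourierInv_pow_le`), and `(1 - r)⁻¹` is a Neumann series.

If `f₁` is cut off near `x`, and `f₁ * f₂` by a test function `φ` near `x + y`, only a neighbourhood of `y` matters
for `f₂`; with `F₁` and `F₂` the Fourier transforms of the localizations, the localized convolution has the Fourier
transform `(F₁ F₂) * 𝓕 φ`, which is regular toward `ξ₀` if `F₂` is (`exists_ball_regularToward`). A partition of
unity on the compact support of `χ` combines the contributions of all `x`
(`exists_ball_regularToward_convTest`).
-/

namespace UltraWF

/-! ### The associated function of a defining sequence -/

namespace DefiningSequence

variable (M : DefiningSequence)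

/-- The function `ρ ↦ e^{M(ρ)}`, so that `M.expWeight x = M.wt ‖x‖`. -/
noncomputable def wt (ρ : ℝ) : ℝ := Real.exp (M.assoc ρ)

theorem antitone_ratio : Antitone fun p => M.seq p / M.seq (p + 1) := by
  refine antitone_nat_of_succ_le fun p => ?_
  rw [div_le_div_iff₀ (M.pos _) (M.pos _)]
  have := M.logConvex p
  nlinarith

/-- The terms of a decreasing summable sequence are `o(1/n)`; here the sequence is `M_n / M_{n+1}`. -/
theorem eventually_succ_mul_ratio_le {ε : ℝ} (hε : 0 < ε) :
    ∀ᶠ n : ℕ in atTop, ((n + 1 : ℕ) : ℝ) * (M.seq n / M.seq (n + 1)) ≤ ε := by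
  set a : ℕ → ℝ := fun p => M.seq p / M.seq (p + 1) with ha
  have ha0 : ∀ p, 0 < a p := fun p => div_pos (M.pos _) (M.pos _)
  have hanti : Antitone a := M.antitone_ratio
  have hs : Summable a := M.nonQuasianalytic
  have htail := tendsto_sum_nat_add a
  obtain ⟨N, hN⟩ := ((tendsto_order.1 htail).2 (ε / 2) (by positivity)).exists
  filter_upwards [eventually_ge_atTop (2 * N)] with n hn
  have h1 : ((n + 1 - N : ℕ) : ℝ) * a n ≤ ε / 2 := by
    calc ((n + 1 - N : ℕ) : ℝ) * a n = ∑ i ∈ Finset.range (n + 1 - N), a n := by simp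
      _ ≤ ∑ i ∈ Finset.range (n + 1 - N), a (i + N) :=
        Finset.sum_le_sum fun i hi => hanti (by have := Finset.mem_range.1 hi; omega)
      _ ≤ ∑' i, a (i + N) := ((summable_nat_add_iff N).2 hs).sum_le_tsum _ fun p _ => (ha0 _).le
      _ ≤ _ := hN.le
  have h2 : ((n + 1 : ℕ) : ℝ) ≤ 2 * ((n + 1 - N : ℕ) : ℝ) := by
    rw [Nat.cast_sub (by omega)]
    have : (2 * N : ℝ) ≤ n := by exact_mod_cast hn
    push_cast
    linarith
  have := ha0 n
  change _ * a n ≤ ε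
  nlinarith

/-- Analytic growth of every positive type is dominated: `n! ≤ C ε^n M_n`. -/
theorem exists_factorial_le_pow {ε : ℝ} (hε : 0 < ε) :
    ∃ C > 0, ∀ n : ℕ, (n.factorial : ℝ) ≤ C * (ε ^ n * M.seq n) := by
  obtain ⟨N, hN⟩ := eventually_atTop.1 (M.eventually_succ_mul_ratio_le hε)
  set b : ℕ → ℝ := fun n => (n.factorial : ℝ) / (ε ^ n * M.seq n) with hb
  have hb0 : ∀ n, 0 < b n := fun n => by have := M.pos n; positivity
  have hstep : ∀ n, N ≤ n → b (n + 1) ≤ b n := by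
    intro n hn
    have h := hN n hn
    have hM := M.pos n
    have hM' := M.pos (n + 1)
    have : b (n + 1) = b n * ((((n + 1 : ℕ) : ℝ) * (M.seq n / M.seq (n + 1))) / ε) := by
      simp only [hb, Nat.factorial_succ, Nat.cast_mul, pow_succ]
      field_simp
    rw [this]
    refine mul_le_of_le_one_right (hb0 n).le ?_
    rwa [div_le_one hε]
  refine ⟨∑ i ∈ Finset.range (N + 1), b i, Finset.sum_pos (fun i _ => hb0 i) (by simp), fun n => ?_⟩
  have hM := M.pos n
  rw [← div_le_iff₀ (by positivity)]
  have hle : ∀ i ≤ N, b i ≤ ∑ i ∈ Finset.range (N + 1), b i := fun i hi =>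
    Finset.single_le_sum (f := b) (fun i _ => (hb0 i).le) (Finset.mem_range.2 (by omega))
  rcases le_total n N with h | h
  · exact hle n h
  · refine le_trans ?_ (hle N le_rfl)
    change b n ≤ b N
    induction n, h using Nat.le_induction with
    | base => exact le_rfl
    | succ n hn ih => exact (hstep n hn).trans (ih (M.pos n))

theorem bddAbove_posLog (ρ : ℝ) :
    BddAbove (range fun p : ℕ => Real.posLog (ρ ^ p * M.seq 0 / M.seq p)) := by
  obtain ⟨C, hC, H⟩ := M.exists_factorial_le_pow one_pos
  refine ⟨max 0 (Real.log (C * Real.exp |ρ|)), ?_⟩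
  rintro _ ⟨p, rfl⟩
  change Real.posLog (ρ ^ p * M.seq 0 / M.seq p) ≤ _
  rw [← Real.posLog_abs]
  refine max_le_max le_rfl ?_
  -- `Real.log 0 = 0` is not the least value of `Real.log`, so that `ρ = 0` is a separate case
  rcases eq_or_ne ρ 0 with rfl | hρ
  · rcases Nat.eq_zero_or_pos p with rfl | hp
    · have := H 0
      simp [M.zero] at this ⊢
      exact Real.log_nonneg this
    · have := H 0
      simp [hp.ne', M.zero] at this ⊢
      exact Real.log_nonneg this
  have hM := M.pos p
  have hz := M.pos 0
  refine Real.log_le_log (by positivity) ?_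
  rw [M.zero, mul_one, abs_div, abs_pow, abs_of_pos hM, div_le_iff₀ hM]
  have h1 := Real.pow_div_factorial_le_exp |ρ| (abs_nonneg _) p
  rw [div_le_iff₀ (by positivity)] at h1
  have h2 := H p
  rw [one_pow, one_mul] at h2
  calc |ρ| ^ p ≤ Real.exp |ρ| * p.factorial := h1
    _ ≤ Real.exp |ρ| * (C * M.seq p) := by gcongr
    _ = _ := by ring

theorem wt_pos (ρ : ℝ) : 0 < M.wt ρ := Real.exp_pos _

theorem one_le_wt (ρ : ℝ) : 1 ≤ M.wt ρ := by
  refine Real.one_le_exp ?_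
  refine le_ciSup_of_le (M.bddAbove_posLog ρ) 0 ?_
  simp [M.zero]

/-- By `wt_le`, `M.wt ρ` is the least constant with this property. -/
theorem pow_le_wt {ρ : ℝ} (hρ : 0 ≤ ρ) (p : ℕ) : ρ ^ p ≤ M.seq p * M.wt ρ := by
  have hM := M.pos p
  rcases hρ.eq_or_lt with rfl | hρ
  · rcases Nat.eq_zero_or_pos p with rfl | hp
    · simpa [M.zero] using M.one_le_wt 0
    · simp only [zero_pow hp.ne']
      exact mul_nonneg hM.le (M.wt_pos _).le
  rw [mul_comm, ← div_le_iff₀ hM]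
  have h1 : Real.posLog (ρ ^ p * M.seq 0 / M.seq p) ≤ M.assoc ρ := le_ciSup (M.bddAbove_posLog ρ) p
  rw [M.zero, mul_one] at h1
  have h2 : Real.log (ρ ^ p / M.seq p) ≤ M.assoc ρ := (le_max_right _ _).trans h1
  rwa [Real.log_le_iff_le_exp (by positivity)] at h2

theorem wt_le {ρ t : ℝ} (hρ : 0 ≤ ρ) (H : ∀ p, ρ ^ p ≤ M.seq p * t) : M.wt ρ ≤ t := by
  have ht : 1 ≤ t := by simpa [M.zero] using H 0
  have ht0 : 0 < t := by linarith
  rw [wt, ← Real.le_log_iff_exp_le ht0]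
  refine ciSup_le fun p => max_le (Real.log_nonneg ht) ?_
  have hM := M.pos p
  rw [M.zero, mul_one]
  rcases hρ.eq_or_lt with rfl | hρ
  · rcases Nat.eq_zero_or_pos p with rfl | hp
    · simpa [M.zero] using Real.log_nonneg ht
    · simpa [hp.ne'] using Real.log_nonneg ht
  · refine Real.log_le_log (by positivity) ?_
    rw [div_le_iff₀ hM, mul_comm]
    exact H p

theorem wt_mono {ρ σ : ℝ} (hρ : 0 ≤ ρ) (h : ρ ≤ σ) : M.wt ρ ≤ M.wt σ :=
  M.wt_le hρ fun p => (pow_le_pow_left₀ hρ h p).trans (M.pow_le_wt (hρ.trans h) p)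

/-- This holds for every defining sequence, at the expense of a dilation of the argument. -/
theorem wt_add_le {ρ σ : ℝ} (hρ : 0 ≤ ρ) (hσ : 0 ≤ σ) :
    M.wt (ρ + σ) ≤ M.wt (2 * ρ) * M.wt (2 * σ) := by
  rcases le_total ρ σ with h | h
  · exact (M.wt_mono (by positivity) (by linarith)).trans
      (le_mul_of_one_le_left (M.wt_pos _).le (M.one_le_wt _))
  · exact (M.wt_mono (by positivity) (by linarith)).trans
      (le_mul_of_one_le_right (M.wt_pos _).le (M.one_le_wt _))

/-- Powers of the weight are absorbed by dilations of its argument; this is condition `(M.2)` in terms of `M`. -/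
theorem exists_wt_sq_le : ∃ A ≥ 1, ∃ H ≥ 1, ∀ ρ, 0 ≤ ρ → M.wt ρ * M.wt ρ ≤ A * M.wt (H * ρ) := by
  obtain ⟨A, hA, H, hH, hAH⟩ := M.stable
  have key : ∀ ρ, 0 ≤ ρ → M.wt ρ * M.wt ρ ≤ A * M.wt (H * ρ) := by
    intro ρ hρ
    rw [← le_div_iff₀ (M.wt_pos _)]
    refine M.wt_le hρ fun p => ?_
    have hp := M.pos p
    rw [mul_div_assoc', le_div_iff₀ (M.wt_pos _), mul_comm]
    rcases (pow_nonneg hρ p).eq_or_lt with h | h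
    · rw [← h, mul_zero]
      have := M.wt_pos (H * ρ)
      positivity
    rw [← le_div_iff₀ h]
    refine M.wt_le hρ fun q => ?_
    have hq := M.pos q
    rw [mul_div_assoc', le_div_iff₀ h]
    have h1 := M.pow_le_wt (mul_nonneg hH.le hρ) (p + q)
    have h2 := hAH p q
    have hW := M.wt_pos (H * ρ)
    have hHp : 0 < H ^ (p + q) := by positivity
    rw [mul_pow] at h1
    have h3 : H ^ (p + q) * ρ ^ (p + q) ≤ H ^ (p + q) * (A * M.seq p * M.seq q * M.wt (H * ρ)) := by
      calc _ ≤ _ := h1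
        _ ≤ (A * H ^ (p + q) * M.seq p * M.seq q) * M.wt (H * ρ) := by gcongr
        _ = _ := by ring
    have h4 := le_of_mul_le_mul_left h3 hHp
    rw [pow_add] at h4
    linarith
  refine ⟨max A 1, le_max_right _ _, max H 1, le_max_right _ _, fun ρ hρ => (key ρ hρ).trans ?_⟩
  have : M.wt (H * ρ) ≤ M.wt (max H 1 * ρ) :=
    M.wt_mono (by positivity) (mul_le_mul_of_nonneg_right (le_max_left _ _) hρ)
  have := M.wt_pos (H * ρ)
  gcongr
  exact le_max_left _ _

/-- The weight `e^{M(ρ)}` has subexponential growth. -/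
theorem exists_wt_le_exp {ε : ℝ} (hε : 0 < ε) :
    ∃ C > 0, ∀ ρ, 0 ≤ ρ → M.wt ρ ≤ C * Real.exp (ε * ρ) := by
  obtain ⟨C, hC, H⟩ := M.exists_factorial_le_pow hε
  refine ⟨C, hC, fun ρ hρ => M.wt_le hρ fun p => ?_⟩
  have h1 := Real.pow_div_factorial_le_exp (ε * ρ) (by positivity) p
  rw [div_le_iff₀ (by positivity), mul_pow] at h1
  have h2 := H p
  have h3 : 0 < ε ^ p := by positivity
  refine le_of_mul_le_mul_left ?_ h3
  calc ε ^ p * ρ ^ p ≤ Real.exp (ε * ρ) * p.factorial := h1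
    _ ≤ Real.exp (ε * ρ) * (C * (ε ^ p * M.seq p)) := by gcongr
    _ = _ := by ring

theorem measurable_wt_norm {d : ℕ} (k : ℝ) : Measurable fun ξ : E d => M.wt (k * ‖ξ‖) := by
  have hm : Measurable M.wt := by
    -- `M.wt` is even, since `Real.posLog` takes absolute values, and monotone on `[0, ∞)`
    have e : M.wt = fun ρ => M.wt (max |ρ| 0) := by
      ext ρ
      simp only [wt, assoc]
      congr 2
      ext p
      rw [max_eq_left (abs_nonneg ρ), ← Real.posLog_abs]
      conv_rhs => rw [← Real.posLog_abs]
      simp [abs_div, abs_mul]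
    have hmono : Monotone fun ρ => M.wt (max ρ 0) := fun ρ σ h =>
      M.wt_mono (le_max_right _ _) (max_le_max h le_rfl)
    rw [e]
    exact hmono.measurable.comp measurable_norm
  exact hm.comp (measurable_const.mul measurable_norm)

theorem exists_one_add_pow_le {k : ℝ} (hk : 0 < k) (n : ℕ) :
    ∃ C > 0, ∀ ρ, 0 ≤ ρ → (1 + ρ) ^ n ≤ C * M.wt (k * ρ) := by
  have hM := M.pos n
  refine ⟨2 ^ n * (1 + M.seq n / k ^ n), by positivity, fun ρ hρ => ?_⟩
  have h1 := M.pow_le_wt (ρ := k * ρ) (by positivity) n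
  have h0 := M.one_le_wt (k * ρ)
  have h2 : ρ ^ n ≤ M.seq n / k ^ n * M.wt (k * ρ) := by
    rw [div_mul_eq_mul_div, le_div_iff₀ (by positivity)]
    rw [mul_pow] at h1
    linarith
  calc (1 + ρ) ^ n ≤ 2 ^ (n - 1) * (1 ^ n + ρ ^ n) := add_pow_le zero_le_one hρ n
    _ ≤ 2 ^ n * (M.wt (k * ρ) + M.seq n / k ^ n * M.wt (k * ρ)) := by
        gcongr
        · norm_num
        · omega
        · simpa using h0
    _ = _ := by ring

theorem integrable_inv_wt {d : ℕ} {k : ℝ} (hk : 0 < k) :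
    Integrable fun ξ : E d => (M.wt (k * ‖ξ‖))⁻¹ := by
  obtain ⟨C, hC, H⟩ := M.exists_one_add_pow_le hk (d + 1)
  have h1 : Integrable fun ξ : E d => C * (1 + ‖ξ‖) ^ (-((d + 1 : ℕ) : ℝ)) :=
    (integrable_one_add_norm (by simp)).const_mul C
  refine h1.mono' (M.measurable_wt_norm k).inv.aestronglyMeasurable (Eventually.of_forall fun ξ => ?_)
  have hw := M.wt_pos (k * ‖ξ‖)
  rw [Real.norm_of_nonneg (by positivity), Real.rpow_neg (by positivity), Real.rpow_natCast,
    inv_le_iff_one_le_mul₀ hw, mul_assoc, mul_comm _ (M.wt _), ← mul_assoc, ← div_eq_mul_inv,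
    le_div_iff₀ (by positivity), one_mul]
  exact H _ (norm_nonneg _)

end DefiningSequence

/-! ### Rapidly decreasing functions and the Fourier transform -/

section Rapid

variable {M : DefiningSequence} {d : ℕ}

/-- Functions `a` with `∫ e^{M(k|ξ|)} |a(ξ)| dξ < ∞` for every `k`. -/
def RapidL1 (M : DefiningSequence) (a : E d → ℂ) : Prop :=
  AEStronglyMeasurable a ∧ ∀ k, 0 ≤ k → Integrable fun ξ => M.wt (k * ‖ξ‖) * ‖a ξ‖

/-- Functions `a` with `a(ξ) = O(e^{-M(k|ξ|)})` for every `k`. -/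
def Rapid (M : DefiningSequence) (a : E d → ℂ) : Prop :=
  AEStronglyMeasurable a ∧ ∀ k, 0 ≤ k → ∃ C, ∀ ξ, M.wt (k * ‖ξ‖) * ‖a ξ‖ ≤ C

theorem DefiningSequence.exists_wt_mul_wt_le (M : DefiningSequence) {k : ℝ} (hk : 0 ≤ k) {l : ℝ}
    (hl : 0 ≤ l) :
    ∃ C ≥ 1, ∃ K ≥ 1, ∀ ρ, 0 ≤ ρ → M.wt (k * ρ) * M.wt (l * ρ) ≤ C * M.wt (K * ρ) := by
  obtain ⟨A, hA, H, hH, h⟩ := M.exists_wt_sq_le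
  refine ⟨A, hA, H * (k + l + 1), by nlinarith, fun ρ hρ => ?_⟩
  have h1 : M.wt (k * ρ) ≤ M.wt ((k + l + 1) * ρ) := M.wt_mono (by positivity) (by nlinarith)
  have h2 : M.wt (l * ρ) ≤ M.wt ((k + l + 1) * ρ) := M.wt_mono (by positivity) (by nlinarith)
  calc _ ≤ M.wt ((k + l + 1) * ρ) * M.wt ((k + l + 1) * ρ) :=
        mul_le_mul h1 h2 (M.wt_pos _).le (M.wt_pos _).le
    _ ≤ _ := by
        rw [mul_assoc H]
        exact h _ (by positivity)

/-- A function with the growth `e^{M(k|ξ|)}` is integrable against a rapidly decreasing one. -/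
theorem exists_integrable_of_wt_le {k : ℝ} (hk : 0 ≤ k) :
    ∃ K ≥ 0, ∀ (a : E d → ℂ) (C : ℝ), AEStronglyMeasurable a → (∀ ξ, M.wt (K * ‖ξ‖) * ‖a ξ‖ ≤ C) →
      Integrable fun ξ => M.wt (k * ‖ξ‖) * ‖a ξ‖ := by
  obtain ⟨A, hA, K, hK, h⟩ := M.exists_wt_mul_wt_le hk zero_le_one
  refine ⟨K, by linarith, fun a C ha hC => ?_⟩
  refine ((M.integrable_inv_wt (d := d) one_pos).const_mul (A * C)).mono'
    ((M.measurable_wt_norm k).aestronglyMeasurable.mul ha.norm) (Eventually.of_forall fun ξ => ?_)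
  have h1 := h ‖ξ‖ (norm_nonneg _)
  have := M.wt_pos (k * ‖ξ‖)
  have hw := M.wt_pos (1 * ‖ξ‖)
  rw [Real.norm_of_nonneg (by positivity), ← div_eq_mul_inv, le_div_iff₀ hw]
  calc M.wt (k * ‖ξ‖) * ‖a ξ‖ * M.wt (1 * ‖ξ‖) = (M.wt (k * ‖ξ‖) * M.wt (1 * ‖ξ‖)) * ‖a ξ‖ := by ring
    _ ≤ (A * M.wt (K * ‖ξ‖)) * ‖a ξ‖ := by gcongr
    _ = A * (M.wt (K * ‖ξ‖) * ‖a ξ‖) := by ring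
    _ ≤ A * C := by gcongr; exact hC ξ

theorem Rapid.rapidL1 {a : E d → ℂ} (ha : Rapid M a) : RapidL1 M a := by
  refine ⟨ha.1, fun k hk => ?_⟩
  obtain ⟨K, hK, h⟩ := exists_integrable_of_wt_le (M := M) (d := d) hk
  obtain ⟨C, hC⟩ := ha.2 K hK
  exact h a C ha.1 hC

theorem RapidL1.integrable {a : E d → ℂ} (ha : RapidL1 M a) : Integrable a := by
  refine (ha.2 0 le_rfl).mono' ha.1 (Eventually.of_forall fun ξ => ?_)
  exact le_mul_of_one_le_left (norm_nonneg _) (M.one_le_wt _)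

theorem Rapid.integrable {a : E d → ℂ} (ha : Rapid M a) : Integrable a := ha.rapidL1.integrable

theorem RapidL1.integrable_pow {a : E d → ℂ} (ha : RapidL1 M a) (n : ℕ) :
    Integrable fun ξ => ‖ξ‖ ^ n * ‖a ξ‖ := by
  refine ((ha.2 1 zero_le_one).const_mul (M.seq n)).mono'
    ((by fun_prop : AEStronglyMeasurable (fun ξ : E d => ‖ξ‖ ^ n)).mul ha.1.norm)
    (Eventually.of_forall fun ξ => ?_)
  rw [Real.norm_of_nonneg (by positivity), ← mul_assoc, one_mul]
  gcongr
  exact M.pow_le_wt (norm_nonneg _) n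

theorem RapidL1.contDiff_fourier {a : E d → ℂ} (ha : RapidL1 M a) : ContDiff ℝ (⊤ : ℕ∞) (𝓕 a) :=
  Real.contDiff_fourier fun n _ => ha.integrable_pow n

theorem norm_iteratedFDeriv_fourier_le {a : E d → ℂ} (ha : AEStronglyMeasurable a)
    (hi : ∀ n : ℕ, Integrable fun ξ => ‖ξ‖ ^ n * ‖a ξ‖) (n : ℕ) (x : E d) :
    ‖iteratedFDeriv ℝ n (𝓕 a) x‖ ≤ (2 * Real.pi) ^ n * ∫ ξ, ‖ξ‖ ^ n * ‖a ξ‖ := by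
  have e := Real.iteratedFDeriv_fourier (N := ⊤) (fun n _ => hi n) ha (n := n)
    (by exact_mod_cast le_top)
  rw [e]
  have hpi := Real.pi_pos
  have h1 : ‖𝓕 (fun v => VectorFourier.fourierPowSMulRight (innerSL ℝ) a v n) x‖
      ≤ ∫ v, ‖VectorFourier.fourierPowSMulRight (innerSL ℝ) a v n‖ :=
    VectorFourier.norm_fourierIntegral_le_integral_norm _ _ _ _ _
  refine h1.trans ?_
  rw [← integral_const_mul]
  refine integral_mono_of_nonneg (Eventually.of_forall fun v => norm_nonneg _)
    ((hi n).const_mul _) (Eventually.of_forall fun v => ?_)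
  refine (VectorFourier.norm_fourierPowSMulRight_le (innerSL ℝ) a v n).trans ?_
  have h3 : (2 * Real.pi * ‖innerSL (E := E d) ℝ‖) ^ n ≤ (2 * Real.pi) ^ n := by
    exact pow_le_pow_left₀ (by positivity)
      (mul_le_of_le_one_right (by positivity) (norm_innerSL_le ℝ)) n
  calc _ ≤ (2 * Real.pi) ^ n * ‖v‖ ^ n * ‖a v‖ := by gcongr
    _ = _ := by ring

/-- `ρ ^ n ≤ M_n e^{M(ρ)}` at `ρ = 2π|ξ|/h` bounds the moments of `a`. -/
theorem RapidL1.udBound_fourier {a : E d → ℂ} (ha : RapidL1 M a) {h : ℝ} (hh : 0 < h) :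
    UDBound M (𝓕 a) h (∫ ξ, M.wt (2 * Real.pi / h * ‖ξ‖) * ‖a ξ‖) := by
  intro n x
  refine (norm_iteratedFDeriv_fourier_le ha.1 ha.integrable_pow n x).trans ?_
  have hpi := Real.pi_pos
  have hM := M.pos n
  rw [← integral_mul_const, ← integral_const_mul]
  refine integral_mono_of_nonneg (Eventually.of_forall fun v => by positivity)
    ((ha.2 _ (by positivity)).mul_const _) (Eventually.of_forall fun v => ?_)
  have h2 := M.pow_le_wt (ρ := 2 * Real.pi / h * ‖v‖) (by positivity) n
  calc (2 * Real.pi) ^ n * (‖v‖ ^ n * ‖a v‖)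
      = h ^ n * (2 * Real.pi / h * ‖v‖) ^ n * ‖a v‖ := by
        rw [mul_pow (2 * Real.pi / h), div_pow]; field_simp
    _ ≤ h ^ n * (M.seq n * M.wt (2 * Real.pi / h * ‖v‖)) * ‖a v‖ := by gcongr
    _ = _ := by ring

theorem norm_fourier_le (f : E d → ℂ) (ξ : E d) : ‖𝓕 f ξ‖ ≤ ∫ x, ‖f x‖ :=
  VectorFourier.norm_fourierIntegral_le_integral_norm _ _ _ _ _

theorem pow_mul_norm_fourier_le {f : E d → ℂ} (hf : ContDiff ℝ (⊤ : ℕ∞) f)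
    (hi : ∀ n : ℕ, Integrable (iteratedFDeriv ℝ n f)) (n : ℕ) (ξ : E d) :
    (2 * Real.pi * ‖ξ‖) ^ n * ‖𝓕 f ξ‖ ≤ ∫ x, ‖iteratedFDeriv ℝ n f x‖ := by
  have hpi := Real.pi_pos
  have e := congrFun (Real.fourier_iteratedFDeriv (N := ⊤) hf (fun n _ => hi n) (n := n)
    (by exact_mod_cast le_top)) ξ
  have h1 : ‖𝓕 (iteratedFDeriv ℝ n f) ξ‖ ≤ ∫ v, ‖iteratedFDeriv ℝ n f v‖ :=
    VectorFourier.norm_fourierIntegral_le_integral_norm _ _ _ _ _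
  rcases eq_or_ne ξ 0 with rfl | hξ
  · rcases Nat.eq_zero_or_pos n with rfl | hn
    · simpa using norm_fourier_le f 0
    · rw [norm_zero, mul_zero, zero_pow hn.ne', zero_mul]
      exact integral_nonneg fun x => norm_nonneg _
  have h2 := ContinuousMultilinearMap.le_opNorm (𝓕 (iteratedFDeriv ℝ n f) ξ) (fun _ => ξ)
  have h3 : ‖𝓕 (iteratedFDeriv ℝ n f) ξ (fun _ => ξ)‖
      = (2 * Real.pi * ‖ξ‖) ^ n * ‖𝓕 f ξ‖ * ‖ξ‖ ^ n := by
    rw [e]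
    have e2 : |(innerSL ℝ : E d →L[ℝ] E d →L[ℝ] ℝ) ξ ξ| = ‖ξ‖ * ‖ξ‖ := by
      change |inner ℝ ξ ξ| = _
      rw [real_inner_self_eq_norm_mul_norm, abs_of_nonneg (by positivity)]
    simp only [VectorFourier.fourierPowSMulRight_apply, norm_smul, norm_pow, norm_neg, norm_mul,
      Finset.prod_const, Finset.card_univ, Fintype.card_fin, neg_apply,
      Real.norm_eq_abs, e2, Complex.norm_I,
      Complex.norm_real, abs_of_pos hpi, Complex.norm_ofNat]
    ring
  rw [h3] at h2
  simp only [Finset.prod_const, Finset.card_univ, Fintype.card_fin] at h2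
  have := norm_pos_iff.2 hξ
  exact (le_of_mul_le_mul_right h2 (by positivity)).trans h1

/-- Bounds for all derivatives in `L¹` give the decay `e^{-M(2π|ξ|/h)}` of the Fourier transform, by
minimizing over the order of differentiation. -/
theorem wt_mul_norm_fourier_le {f : E d → ℂ} (hf : ContDiff ℝ (⊤ : ℕ∞) f)
    (hi : ∀ n : ℕ, Integrable (iteratedFDeriv ℝ n f)) {h B : ℝ} (hh : 0 < h)
    (hB : ∀ n : ℕ, ∫ x, ‖iteratedFDeriv ℝ n f x‖ ≤ B * (h ^ n * M.seq n)) (ξ : E d) :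
    M.wt (2 * Real.pi / h * ‖ξ‖) * ‖𝓕 f ξ‖ ≤ B := by
  have hpi := Real.pi_pos
  rcases (norm_nonneg (𝓕 f ξ)).eq_or_lt with h0 | h0
  · rw [← h0, mul_zero]
    have := (integral_nonneg fun x => norm_nonneg _).trans (hB 0)
    simpa [M.zero] using this
  rw [← le_div_iff₀ h0]
  refine M.wt_le (by positivity) fun p => ?_
  rw [mul_div_assoc', le_div_iff₀ h0]
  have h1 := (pow_mul_norm_fourier_le hf hi p ξ).trans (hB p)
  have h2 : 0 < h ^ p := by positivity
  refine le_of_mul_le_mul_left ?_ h2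
  calc h ^ p * ((2 * Real.pi / h * ‖ξ‖) ^ p * ‖𝓕 f ξ‖) = (2 * Real.pi * ‖ξ‖) ^ p * ‖𝓕 f ξ‖ := by
        rw [mul_pow (2 * Real.pi / h), div_pow]; field_simp; ring
    _ ≤ _ := h1
    _ = _ := by ring

theorem continuous_fourier {f : E d → ℂ} (hf : Integrable f) : Continuous (𝓕 f) :=
  VectorFourier.fourierIntegral_continuous Real.continuous_fourierChar
    (by exact continuous_inner) hf

theorem continuous_fourierInv {f : E d → ℂ} (hf : Integrable f) : Continuous (𝓕⁻ f) := by
  have : 𝓕⁻ f = fun w => 𝓕 f (-w) := by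
    ext w
    exact Real.fourierInv_eq_fourier_neg f w
  rw [this]
  exact (continuous_fourier hf).comp continuous_neg

theorem norm_fourierInv_le (f : E d → ℂ) (ξ : E d) : ‖𝓕⁻ f ξ‖ ≤ ∫ x, ‖f x‖ := by
  rw [Real.fourierInv_eq_fourier_neg]
  exact norm_fourier_le f _

theorem GSBound.exists_integral_le {h : ℝ} (hh : 0 < h) : ∃ C > 0, ∀ (f : E d → ℂ) (B : ℝ),
    ContDiff ℝ (⊤ : ℕ∞) f → GSBound f h B → ∀ n : ℕ,
      Integrable (iteratedFDeriv ℝ n f) ∧ ∫ x, ‖iteratedFDeriv ℝ n f x‖ ≤ C * B * (h ^ n * n.factorial) := by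
  have hint : Integrable fun x : E d => (1 + ‖x‖) ^ (-((d + 1 : ℕ) : ℝ)) :=
    integrable_one_add_norm (by simp)
  set D : ℝ := 2 ^ (d + 1) * (1 + h ^ (d + 1) * (d + 1).factorial) with hD
  have hI : 0 ≤ ∫ x : E d, (1 + ‖x‖) ^ (-((d + 1 : ℕ) : ℝ)) :=
    integral_nonneg fun x => by positivity
  refine ⟨D * (∫ x : E d, (1 + ‖x‖) ^ (-((d + 1 : ℕ) : ℝ))) + 1, by positivity,
    fun f B hf hB n => ?_⟩
  have hB0 := hB.nonneg
  have key : ∀ x, ‖iteratedFDeriv ℝ n f x‖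
      ≤ (D * B * (h ^ n * n.factorial)) * (1 + ‖x‖) ^ (-((d + 1 : ℕ) : ℝ)) := by
    intro x
    rw [Real.rpow_neg (by positivity), Real.rpow_natCast, ← div_eq_mul_inv, le_div_iff₀ (by positivity)]
    have h1 : (1 + ‖x‖) ^ (d + 1) ≤ 2 ^ (d + 1) * (1 + ‖x‖ ^ (d + 1)) := by
      refine (add_pow_le zero_le_one (norm_nonneg _) _).trans ?_
      rw [one_pow]
      gcongr
      · norm_num
      · omega
    have h2 := hB 0 n x
    have h3 := hB (d + 1) n x
    simp only [pow_zero, one_mul, zero_add, Nat.factorial_zero, Nat.cast_one, mul_one] at h2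
    calc ‖iteratedFDeriv ℝ n f x‖ * (1 + ‖x‖) ^ (d + 1)
        ≤ ‖iteratedFDeriv ℝ n f x‖ * (2 ^ (d + 1) * (1 + ‖x‖ ^ (d + 1))) := by gcongr
      _ = 2 ^ (d + 1) * (‖iteratedFDeriv ℝ n f x‖ + ‖x‖ ^ (d + 1) * ‖iteratedFDeriv ℝ n f x‖) := by ring
      _ ≤ 2 ^ (d + 1) * (B * (h ^ n * n.factorial)
          + B * (h ^ (d + 1 + n) * (d + 1).factorial * n.factorial)) := by gcongr
      _ = _ := by rw [hD, pow_add h]; ring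
  have hm : AEStronglyMeasurable (iteratedFDeriv ℝ n f) :=
    (hf.continuous_iteratedFDeriv (by exact_mod_cast le_top)).aestronglyMeasurable
  have hint2 := hint.const_mul (D * B * (h ^ n * n.factorial))
  refine ⟨hint2.mono' hm (Eventually.of_forall key), ?_⟩
  refine (integral_mono_of_nonneg (Eventually.of_forall fun x => norm_nonneg _) hint2
    (Eventually.of_forall key)).trans ?_
  rw [integral_const_mul]
  have : 0 ≤ B * (h ^ n * n.factorial) := by positivity
  nlinarith

/-- The Fourier transform maps `𝓢^{(1)}` continuously to rapidly decreasing functions. -/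
theorem GSBound.exists_wt_mul_fourier_le (M : DefiningSequence) (d : ℕ) {k : ℝ} (hk : 0 ≤ k) :
    ∃ h > 0, ∃ C > 0, ∀ (f : E d → ℂ) (B : ℝ), ContDiff ℝ (⊤ : ℕ∞) f → GSBound f h B → ∀ ξ,
      M.wt (k * ‖ξ‖) * ‖𝓕 f ξ‖ ≤ C * B := by
  obtain ⟨S, hS, H⟩ := M.exists_factorial_le
  have hpi := Real.pi_pos
  set h : ℝ := 2 * Real.pi / ((k + 1) * S) with hh
  have hh0 : 0 < h := by positivity
  obtain ⟨C, hC, h1⟩ := GSBound.exists_integral_le (d := d) hh0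
  refine ⟨h, hh0, C, hC, fun f B hf hB ξ => ?_⟩
  have hB0 := hB.nonneg
  have h2 := wt_mul_norm_fourier_le (M := M) hf (fun n => (h1 f B hf hB n).1) (h := h * S)
    (B := C * B) (by positivity) (fun n => ((h1 f B hf hB n).2).trans (by
      rw [mul_pow, mul_assoc (h ^ n)]
      gcongr
      exact H n)) ξ
  refine le_trans ?_ h2
  have e : 2 * Real.pi / (h * S) = k + 1 := by rw [hh]; field_simp
  rw [e]
  gcongr
  exact M.wt_mono (by positivity) (by gcongr; linarith)

theorem rapid_fourierInv_of_fourier {f : E d → ℂ} (hf : Rapid M (𝓕 f)) (hi : Integrable f) :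
    Rapid M (𝓕⁻ f) := by
  refine ⟨(continuous_fourierInv hi).aestronglyMeasurable, fun k hk => ?_⟩
  obtain ⟨C, hC⟩ := hf.2 k hk
  refine ⟨C, fun ξ => ?_⟩
  have := hC (-ξ)
  rwa [norm_neg, ← Real.fourierInv_eq_fourier_neg] at this

theorem GS.rapid_fourier (f : GS d) : Rapid M (𝓕 (f : E d → ℂ)) := by
  refine ⟨(continuous_fourier (GS.integrable f)).aestronglyMeasurable, fun k hk => ?_⟩
  obtain ⟨h, hh, C, hC, H⟩ := GSBound.exists_wt_mul_fourier_le M d hk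
  obtain ⟨B, hB⟩ := f.2.2 h hh
  exact ⟨C * B, H _ B f.2.1 hB⟩

theorem GS.rapid_fourierInv (f : GS d) : Rapid M (𝓕⁻ (f : E d → ℂ)) :=
  rapid_fourierInv_of_fourier (GS.rapid_fourier f) (GS.integrable f)

theorem UDBound.exists_wt_mul_fourier_le (M : DefiningSequence) {K : Set (E d)} (hK : IsCompact K)
    {h : ℝ} (hh : 0 < h) : ∃ C > 0, ∀ (φ : TestFun M d) (B : ℝ), tsupport (φ : E d → ℂ) ⊆ K →
      UDBound M (φ : E d → ℂ) h B → ∀ ξ,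
      M.wt (2 * Real.pi / h * ‖ξ‖) * ‖𝓕 (φ : E d → ℂ) ξ‖ ≤ C * B := by
  refine ⟨volume.real K + 1, by positivity, fun φ B hφ hB ξ => ?_⟩
  have hB0 := hB.nonneg
  have hc : ∀ n : ℕ, Continuous (iteratedFDeriv ℝ n (φ : E d → ℂ)) := fun n =>
    φ.2.1.continuous_iteratedFDeriv (by exact_mod_cast le_top)
  refine wt_mul_norm_fourier_le φ.2.1 (fun n => (hc n).integrable_of_hasCompactSupport
    (φ.2.2.1.iteratedFDeriv n)) hh (fun n => ?_) ξ
  have h0 : ∀ x ∉ K, ‖iteratedFDeriv ℝ n (φ : E d → ℂ) x‖ = 0 := by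
    intro x hx
    rw [norm_eq_zero]
    by_contra hne
    exact hx (hφ (support_iteratedFDeriv_subset n hne))
  rw [← setIntegral_eq_integral_of_forall_compl_eq_zero h0]
  have hMn := M.pos n
  have h1 : ‖∫ x in K, ‖iteratedFDeriv ℝ n (φ : E d → ℂ) x‖‖ ≤ B * (h ^ n * M.seq n) * volume.real K :=
    norm_setIntegral_le_of_norm_le_const hK.measure_lt_top fun x _ => by
      rw [norm_norm]
      exact hB n x
  refine (le_abs_self _).trans (h1.trans ?_)
  have : 0 ≤ B * (h ^ n * M.seq n) := by positivity
  nlinarith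

theorem TestFun.integrable (φ : TestFun M d) : Integrable (φ : E d → ℂ) :=
  φ.2.1.continuous.integrable_of_hasCompactSupport φ.2.2.1

theorem TestFun.rapid_fourier (φ : TestFun M d) : Rapid M (𝓕 (φ : E d → ℂ)) := by
  refine ⟨(continuous_fourier (TestFun.integrable φ)).aestronglyMeasurable, fun k hk => ?_⟩
  have hpi := Real.pi_pos
  -- the step `h` is chosen such that `2π/h = k + 1`, which also avoids a division by zero for `k = 0`
  obtain ⟨C, hC, H⟩ := UDBound.exists_wt_mul_fourier_le M φ.2.2.1 (h := 2 * Real.pi / (k + 1)) (by positivity)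
  obtain ⟨B, hB⟩ := φ.2.2.2 (2 * Real.pi / (k + 1)) (by positivity)
  refine ⟨C * B, fun ξ => le_trans ?_ (H φ B subset_rfl hB ξ)⟩
  have e : 2 * Real.pi / (2 * Real.pi / (k + 1)) = k + 1 := by field_simp
  rw [e]
  gcongr
  exact M.wt_mono (by positivity) (by gcongr; linarith)

theorem TestFun.rapid_fourierInv (φ : TestFun M d) : Rapid M (𝓕⁻ (φ : E d → ℂ)) :=
  rapid_fourierInv_of_fourier (TestFun.rapid_fourier φ) (TestFun.integrable φ)

theorem GS.fourier_fourierInv (M : DefiningSequence) (f : GS d) : 𝓕 (𝓕⁻ (f : E d → ℂ)) = (f : E d → ℂ) :=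
  f.2.1.continuous.fourier_fourierInv_eq (GS.integrable f) (GS.rapid_fourier (M := M) f).integrable

theorem TestFun.fourier_fourierInv (φ : TestFun M d) : 𝓕 (𝓕⁻ (φ : E d → ℂ)) = (φ : E d → ℂ) :=
  φ.2.1.continuous.fourier_fourierInv_eq (TestFun.integrable φ) (TestFun.rapid_fourier φ).integrable

end Rapid

/-! ### Gaussians and band-limited multipliers in the Gelfand–Shilov space -/

section Gaussian

variable {d : ℕ}

/-- The recurrence satisfied by the norms of the derivatives of a Gaussian forces factorial growth with
an arbitrarily small geometric rate. -/
theorem le_factorial_of_hermite_recurrence {a : ℕ → ℝ} {b ρ h g : ℝ} (hb : 0 ≤ b) (hρ : 0 ≤ ρ)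
    (hh : 0 < h) (hg : 0 ≤ g) (h0 : a 0 ≤ g)
    (hrec : ∀ n, a (n + 1) ≤ 2 * b * (ρ * a n + n * a (n - 1))) (n : ℕ) :
    a n ≤ g * Real.exp (2 * b * (ρ / h + 1 / h ^ 2)) * (h ^ n * n.factorial) := by
  set c : ℝ := 2 * b * (ρ / h + 1 / h ^ 2) with hc
  have hc0 : 0 ≤ c := by positivity
  set y : ℕ → ℝ := fun n => a n / (h ^ n * n.factorial) with hy
  have hya : ∀ n, a n = y n * (h ^ n * n.factorial) := fun n => by
    simp only [hy]; field_simp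
  -- the normalized sequence satisfies `y_{n+1} ≤ c / (n + 1) * max (y_n) (y_{n-1})`
  have step : ∀ n t, 0 ≤ t → y n ≤ t → (1 ≤ n → y (n - 1) ≤ t) → y (n + 1) ≤ c / (n + 1) * t := by
    intro n t ht h1 h2
    have hf : (0 : ℝ) < h ^ (n + 1) * (n + 1).factorial := by positivity
    simp only [hy]
    rw [div_le_iff₀ hf]
    refine (hrec n).trans ?_
    have e1 : a n ≤ t * (h ^ n * n.factorial) := by
      rw [hya n]; gcongr
    have e2 : n * a (n - 1) ≤ t * (h ^ n * n.factorial) / h := by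
      rcases Nat.eq_zero_or_pos n with rfl | hn
      · simp; positivity
      · obtain ⟨m, rfl⟩ : ∃ m, n = m + 1 := ⟨n - 1, by omega⟩
        rw [Nat.add_sub_cancel, hya m, Nat.factorial_succ]
        have := h2 hn
        rw [Nat.add_sub_cancel] at this
        push_cast
        rw [le_div_iff₀ hh, pow_succ]
        calc _ = y m * ((m + 1) * (h ^ m * h * m.factorial)) := by ring
          _ ≤ t * ((m + 1) * (h ^ m * h * m.factorial)) := by gcongr
          _ = _ := by ring
    calc 2 * b * (ρ * a n + n * a (n - 1))
        ≤ 2 * b * (ρ * (t * (h ^ n * n.factorial)) + t * (h ^ n * n.factorial) / h) := by gcongr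
      _ = _ := by
        rw [hc, Nat.factorial_succ, pow_succ]
        push_cast
        field_simp
        ring
  have hexp : ∀ n : ℕ, c ^ n / n.factorial ≤ Real.exp c := fun n => Real.pow_div_factorial_le_exp c hc0 n
  -- for `n ≤ c` the sequence is dominated by `g c^n / n!`, and beyond that the factor `c / (n + 1)` is at most `1`
  have key : ∀ n : ℕ, y n ≤ g * Real.exp c ∧ ((n : ℝ) ≤ c → y n ≤ g * (c ^ n / n.factorial)) := by
    intro n
    induction n using Nat.strong_induction_on with
    | _ n ih =>
      rcases Nat.eq_zero_or_pos n with rfl | hn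
      · have : y 0 ≤ g := by simpa [hy] using h0
        refine ⟨this.trans (le_mul_of_one_le_right hg (Real.one_le_exp hc0)), fun _ => by simpa using this⟩
      obtain ⟨m, rfl⟩ : ∃ m, n = m + 1 := ⟨n - 1, by omega⟩
      have im := ih m (by omega)
      by_cases hmc : ((m + 1 : ℕ) : ℝ) ≤ c
      · have hmc' : (m : ℝ) ≤ c := by push_cast at hmc; linarith
        have h3 : y (m + 1) ≤ g * (c ^ (m + 1) / (m + 1).factorial) := by
          refine (step m (g * (c ^ m / m.factorial)) (by positivity) (im.2 hmc') fun hm => ?_).trans_eq ?_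
          · obtain ⟨l, rfl⟩ : ∃ l, m = l + 1 := ⟨m - 1, by omega⟩
            rw [Nat.add_sub_cancel]
            refine ((ih l (by omega)).2 (by push_cast at hmc'; linarith)).trans ?_
            refine mul_le_mul_of_nonneg_left ?_ hg
            rw [div_le_div_iff₀ (by positivity) (by positivity), Nat.factorial_succ, pow_succ]
            push_cast at hmc' ⊢
            have : 0 ≤ c ^ l * (l.factorial : ℝ) := by positivity
            nlinarith
          · rw [Nat.factorial_succ, pow_succ]; push_cast; field_simp
        refine ⟨h3.trans ?_, fun _ => h3⟩
        gcongr
        exact hexp _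
      · refine ⟨?_, fun h => absurd h hmc⟩
        refine (step m (g * Real.exp c) (by positivity) im.1 fun hm => (ih _ (by omega)).1).trans ?_
        refine mul_le_of_le_one_left (by positivity) ?_
        rw [div_le_one (by positivity)]
        push Not at hmc
        push_cast at hmc
        exact hmc.le
  rw [hya n]
  have := (key n).1
  gcongr

/-- The Gaussian `x ↦ e^{-b|x|²}`. -/
noncomputable def gaussian (b : ℝ) (x : E d) : ℂ := Complex.exp (-b * ‖x‖ ^ 2)

theorem gaussian_eq_ofReal (b : ℝ) (x : E d) : gaussian b x = (Real.exp (-b * ‖x‖ ^ 2) : ℝ) := by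
  simp [gaussian]

theorem norm_gaussian (b : ℝ) (x : E d) : ‖gaussian b x‖ = Real.exp (-b * ‖x‖ ^ 2) := by
  rw [gaussian_eq_ofReal, Complex.norm_real, Real.norm_of_nonneg (Real.exp_pos _).le]

theorem contDiff_gaussian (b : ℝ) : ContDiff ℝ (⊤ : ℕ∞) (gaussian (d := d) b) := by
  have e : gaussian (d := d) b = fun x => ((Real.exp (-b * ‖x‖ ^ 2) : ℝ) : ℂ) :=
    funext (gaussian_eq_ofReal b)
  rw [e]
  exact Complex.ofRealCLM.contDiff.comp
    (Real.contDiff_exp.comp (contDiff_const.mul (contDiff_norm_sq ℝ)))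

theorem norm_iteratedFDeriv_gaussian_succ_le {b : ℝ} (hb : 0 ≤ b) (n : ℕ) (x : E d) :
    ‖iteratedFDeriv ℝ (n + 1) (gaussian b) x‖ ≤ 2 * b * (‖x‖ * ‖iteratedFDeriv ℝ n (gaussian b) x‖
      + n * ‖iteratedFDeriv ℝ (n - 1) (gaussian b) x‖) := by
  set L : E d →L[ℝ] (E d →L[ℝ] ℂ) :=
    (-(2 * b)) • ((ContinuousLinearMap.compL ℝ (E d) ℝ ℂ Complex.ofRealCLM).comp (innerSL ℝ)) with hL
  have hLx : ∀ x, ‖L x‖ ≤ 2 * b * ‖x‖ := by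
    intro x
    refine ContinuousLinearMap.opNorm_le_bound _ (by positivity) fun y => ?_
    have : L x y = ((-(2 * b) * inner ℝ x y : ℝ) : ℂ) := by
      rw [hL]
      simp only [smul_apply, ContinuousLinearMap.comp_apply,
        ContinuousLinearMap.compL_apply, Complex.ofRealCLM_apply]
      change (-(2 * b)) • ((inner ℝ x y : ℝ) : ℂ) = _
      simp
    rw [this, Complex.norm_real, norm_mul, norm_neg, Real.norm_of_nonneg (by positivity)]
    have := mul_le_mul_of_nonneg_left (norm_inner_le_norm (𝕜 := ℝ) x y) (by positivity : 0 ≤ 2 * b)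
    linarith
  have hLn : ‖L‖ ≤ 2 * b := ContinuousLinearMap.opNorm_le_bound _ (by positivity) hLx
  have hfd : fderiv ℝ (gaussian (d := d) b) = fun x => gaussian b x • L x := by
    ext x y
    have h1 : HasFDerivAt (fun x : E d => -b * ‖x‖ ^ 2) ((-b) • (2 • innerSL ℝ x)) x :=
      (hasStrictFDerivAt_norm_sq x).hasFDerivAt.const_mul (-b)
    have h2 := Complex.ofRealCLM.hasFDerivAt.comp x h1.exp
    have e : gaussian (d := d) b = Complex.ofRealCLM ∘ fun x => Real.exp (-b * ‖x‖ ^ 2) :=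
      funext (gaussian_eq_ofReal b)
    rw [e, h2.fderiv, hL]
    simp only [smul_apply, ContinuousLinearMap.comp_apply, Function.comp,
        ContinuousLinearMap.compL_apply, Complex.ofRealCLM_apply]
    simp
    ring
  -- `L` is linear, so that only two terms of the Leibniz formula survive
  have hLit : ∀ j, 2 ≤ j → iteratedFDeriv ℝ j L x = 0 := by
    intro j hj
    obtain ⟨i, rfl⟩ : ∃ i, j = i + 1 := ⟨j - 1, by omega⟩
    rw [← norm_eq_zero, ← norm_iteratedFDeriv_fderiv]
    have : fderiv ℝ (L : E d → _) = fun _ => L := by ext1 x; exact L.fderiv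
    rw [this, iteratedFDeriv_const_of_ne (by omega)]
    simp
  have hL0 : ∀ j, j = 0 → ‖iteratedFDeriv ℝ j L x‖ ≤ 2 * b * ‖x‖ := by
    rintro _ rfl
    rw [norm_iteratedFDeriv_zero]
    exact hLx x
  have hL1 : ∀ j, j = 0 + 1 → ‖iteratedFDeriv ℝ j L x‖ ≤ 2 * b := by
    rintro _ rfl
    rw [← norm_iteratedFDeriv_fderiv]
    have : fderiv ℝ (L : E d → _) = fun _ => L := by ext1 x; exact L.fderiv
    rw [this, norm_iteratedFDeriv_zero]
    exact hLn
  rw [← norm_iteratedFDeriv_fderiv, hfd]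
  refine (norm_iteratedFDeriv_smul_le (contDiff_gaussian b) L.contDiff x (n := n)
    (by exact_mod_cast le_top)).trans ?_
  rcases n with _ | n
  · simp only [zero_add, Finset.range_one, Finset.sum_singleton, Nat.choose_self]
    have := mul_le_mul_of_nonneg_left (hL0 (0 - 0) rfl) (norm_nonneg (iteratedFDeriv ℝ 0 (gaussian b) x))
    push_cast
    linarith
  · rw [Finset.sum_range_succ, Finset.sum_range_succ, Finset.sum_eq_zero (s := Finset.range n)]
    · have h1 := mul_le_mul_of_nonneg_left (hL0 (n + 1 - (n + 1)) (by omega))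
        (norm_nonneg (iteratedFDeriv ℝ (n + 1) (gaussian b) x))
      have h2 := mul_le_mul_of_nonneg_left (hL1 (n + 1 - n) (by omega))
        (by positivity : 0 ≤ ((n + 1 : ℕ) : ℝ) * ‖iteratedFDeriv ℝ n (gaussian b) x‖)
      rw [Nat.choose_self, Nat.choose_succ_self_right]
      change _ ≤ 2 * b * (‖x‖ * ‖iteratedFDeriv ℝ (n + 1) (gaussian b) x‖ +
        ((n + 1 : ℕ) : ℝ) * ‖iteratedFDeriv ℝ n (gaussian b) x‖)
      push_cast at h2 ⊢
      linarith
    · intro i hi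
      rw [hLit _ (by have := Finset.mem_range.1 hi; omega)]
      simp

theorem gaussian_mem_GS {b : ℝ} (hb : 0 < b) : gaussian (d := d) b ∈ GS d := by
  refine ⟨contDiff_gaussian b, fun h hh => ?_⟩
  refine ⟨Real.exp ((2 * b + 1) ^ 2 / (4 * b * h ^ 2) + 2 * b / h ^ 2), fun k n x => ?_⟩
  have h1 := le_factorial_of_hermite_recurrence (a := fun n => ‖iteratedFDeriv ℝ n (gaussian b) x‖)
    hb.le (norm_nonneg x) hh (Real.exp_pos (-b * ‖x‖ ^ 2)).le (by simp [norm_gaussian])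
    (fun n => norm_iteratedFDeriv_gaussian_succ_le hb.le n x) n
  have h2 : ‖x‖ ^ k ≤ Real.exp (‖x‖ / h) * (h ^ k * k.factorial) := by
    have := Real.pow_div_factorial_le_exp (‖x‖ / h) (by positivity) k
    rw [div_le_iff₀ (by positivity), div_pow, div_le_iff₀ (by positivity)] at this
    linarith
  calc ‖x‖ ^ k * ‖iteratedFDeriv ℝ n (gaussian b) x‖
      ≤ (Real.exp (‖x‖ / h) * (h ^ k * k.factorial)) * (Real.exp (-b * ‖x‖ ^ 2)
        * Real.exp (2 * b * (‖x‖ / h + 1 / h ^ 2)) * (h ^ n * n.factorial)) := by gcongr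
    _ = Real.exp (‖x‖ / h + -b * ‖x‖ ^ 2 + 2 * b * (‖x‖ / h + 1 / h ^ 2))
        * (h ^ (k + n) * k.factorial * n.factorial) := by
        rw [Real.exp_add, Real.exp_add, pow_add]; ring
    _ ≤ _ := by
        refine mul_le_mul_of_nonneg_right (Real.exp_le_exp.2 ?_) (by positivity)
        -- completing the square
        have e : (2 * b + 1) ^ 2 / (4 * b * h ^ 2) + 2 * b / h ^ 2
            - (‖x‖ / h + -b * ‖x‖ ^ 2 + 2 * b * (‖x‖ / h + 1 / h ^ 2))
            = b * (‖x‖ - (2 * b + 1) / (2 * b * h)) ^ 2 := by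
          field_simp
          ring
        have : 0 ≤ b * (‖x‖ - (2 * b + 1) / (2 * b * h)) ^ 2 := by positivity
        linarith

/-- `𝓢^{(1)}` is stable under multiplication by band-limited functions. -/
theorem GS.mul_mem {m : E d → ℂ} {C R : ℝ} (hR : 0 ≤ R) (hm : ContDiff ℝ (⊤ : ℕ∞) m)
    (hC : ∀ (n : ℕ) (x : E d), ‖iteratedFDeriv ℝ n m x‖ ≤ C * R ^ n) (f : GS d) :
    (fun x => m x * (f : E d → ℂ) x) ∈ GS d := by
  refine ⟨hm.mul f.2.1, fun h hh => ?_⟩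
  -- passing from `h / 2` to `h` gains a factor `2 ^ n`, which absorbs the number `n + 1` of Leibniz terms
  obtain ⟨B, hB⟩ := f.2.2 (h / 2) (by positivity)
  have hB0 := hB.nonneg
  have hC0 : 0 ≤ C := by
    have := (norm_nonneg _).trans (hC 0 0)
    simpa using this
  refine ⟨C * B * Real.exp (R / (h / 2)), fun k n x => ?_⟩
  set s := h / 2 with hs
  have hs0 : 0 < s := by positivity
  have hRi : ∀ i : ℕ, R ^ i ≤ Real.exp (R / s) * (s ^ i * i.factorial) := by
    intro i
    have := Real.pow_div_factorial_le_exp (R / s) (by positivity) i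
    rw [div_le_iff₀ (by positivity), div_pow, div_le_iff₀ (by positivity)] at this
    linarith
  have h1 := norm_iteratedFDeriv_mul_le hm f.2.1 x (n := n) (by exact_mod_cast le_top)
  calc ‖x‖ ^ k * ‖iteratedFDeriv ℝ n (fun x => m x * (f : E d → ℂ) x) x‖
      ≤ ‖x‖ ^ k * ∑ i ∈ Finset.range (n + 1), (n.choose i : ℝ) * ‖iteratedFDeriv ℝ i m x‖ *
          ‖iteratedFDeriv ℝ (n - i) (f : E d → ℂ) x‖ := by gcongr
    _ = ∑ i ∈ Finset.range (n + 1), (n.choose i : ℝ) * ‖iteratedFDeriv ℝ i m x‖ *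
          (‖x‖ ^ k * ‖iteratedFDeriv ℝ (n - i) (f : E d → ℂ) x‖) := by
        rw [Finset.mul_sum]
        exact Finset.sum_congr rfl fun i _ => by ring
    _ ≤ ∑ i ∈ Finset.range (n + 1),
          C * B * Real.exp (R / s) * (s ^ (k + n) * k.factorial * n.factorial) := by
        refine Finset.sum_le_sum fun i hi => ?_
        have hi' : i ≤ n := Nat.lt_succ_iff.1 (Finset.mem_range.1 hi)
        calc _ ≤ (n.choose i : ℝ) * (C * (Real.exp (R / s) * (s ^ i * i.factorial))) *
              (B * (s ^ (k + (n - i)) * k.factorial * (n - i).factorial)) := by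
              refine mul_le_mul (mul_le_mul_of_nonneg_left ?_ (by positivity)) (hB k (n - i) x)
                (by positivity) (by positivity)
              exact (hC i x).trans (mul_le_mul_of_nonneg_left (hRi i) hC0)
          _ = _ := by
              have e1 : s ^ (k + n) = s ^ i * s ^ (k + (n - i)) := by
                rw [← pow_add]; congr 1; omega
              have e2 : (n.factorial : ℝ) = n.choose i * i.factorial * (n - i).factorial := by
                exact_mod_cast (Nat.choose_mul_factorial_mul_factorial hi').symm
              rw [e1, e2]; ring
    _ = (n + 1) * s ^ (k + n) * (C * B * Real.exp (R / s) * (k.factorial * n.factorial)) := by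
        simp; ring
    _ ≤ h ^ (k + n) * (C * B * Real.exp (R / s) * (k.factorial * n.factorial)) := by
        gcongr
        have h2 : ((n : ℝ) + 1) ≤ 2 ^ (k + n) := by
          have h3 : n + 1 ≤ 2 ^ (k + n) :=
            (Nat.lt_pow_self (by norm_num : 1 < 2)).trans_le (Nat.pow_le_pow_right (by norm_num) (by omega))
          exact_mod_cast h3
        calc ((n : ℝ) + 1) * s ^ (k + n) ≤ 2 ^ (k + n) * s ^ (k + n) := by gcongr
          _ = h ^ (k + n) := by rw [← mul_pow, hs]; congr 1; ring
    _ = _ := by ring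

end Gaussian

/-! ### Uniqueness of the Fourier transform of a functional -/

section Uniqueness

variable {d : ℕ}

theorem integral_fourier_mul {f g : E d → ℂ} (hf : Integrable f) (hg : Integrable g) :
    ∫ ξ, 𝓕 f ξ * g ξ = ∫ x, f x * 𝓕 g x := by
  simpa using! VectorFourier.integral_fourierIntegral_smul_eq_flip (L := innerₗ (E d))
    Real.continuous_fourierChar continuous_inner hf hg

theorem integral_fourierInv_mul {f g : E d → ℂ} (hf : Integrable f) (hg : Integrable g) :
    ∫ ξ, 𝓕⁻ f ξ * g ξ = ∫ x, f x * 𝓕⁻ g x := by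
  have h := integral_fourier_mul hf hg.comp_neg
  have e1 : ∫ ξ, 𝓕⁻ f ξ * g ξ = ∫ ξ, 𝓕 f ξ * g (-ξ) := by
    rw [← integral_neg_eq_self]
    simp only [Real.fourierInv_eq_fourier_neg, neg_neg]
  rw [e1, h]
  simp only [Real.fourierInv_eq_fourier_comp_neg]

theorem fourierInv_reflTranslate (x : E d) (f : GS d) (ξ : E d) :
    𝓕⁻ (GS.reflTranslate x f : E d → ℂ) ξ = Real.fourierChar (inner ℝ x ξ) * 𝓕 (f : E d → ℂ) ξ := by
  rw [Real.fourierInv_eq, Real.fourier_eq]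
  have h := integral_sub_left_eq_self (fun v => Real.fourierChar (inner ℝ v ξ) •
    (GS.reflTranslate x f : E d → ℂ) v) volume x
  rw [← h, ← integral_const_mul]
  congr 1
  ext v
  simp only [GS.reflTranslate, sub_sub_cancel, inner_sub_left]
  simp only [sub_eq_add_neg, Circle.smul_def, AddChar.map_add_eq_mul, smul_eq_mul, Circle.coe_mul]
  ring

/-- The inverse Fourier transform is injective on `L¹`. -/
theorem ae_eq_zero_of_fourierInv_eq_zero {g : E d → ℂ} (hg : Integrable g) (h : ∀ x, 𝓕⁻ g x = 0) :
    g =ᵐ[volume] 0 := by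
  refine ae_eq_zero_of_integral_contDiff_smul_eq_zero hg.locallyIntegrable fun θ hθ hc => ?_
  have hθ' : ContDiff ℝ (⊤ : ℕ∞) fun x => (θ x : ℂ) := Complex.ofRealCLM.contDiff.comp hθ
  have hc' : HasCompactSupport fun x => (θ x : ℂ) := hc.comp_left (g := ((↑) : ℝ → ℂ)) rfl
  set s : SchwartzMap (E d) ℂ := hc'.toSchwartzMap hθ' with hs
  have e1 : 𝓕⁻ (𝓕 (s : E d → ℂ)) = s := by
    have h1 : 𝓕⁻ (𝓕 s : SchwartzMap (E d) ℂ) = s := FourierTransform.fourierInv_fourier_eq s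
    have := congrArg (fun f : SchwartzMap (E d) ℂ => (f : E d → ℂ)) h1
    simpa only [SchwartzMap.fourierInv_coe, SchwartzMap.fourier_coe] using this
  have hi : Integrable (𝓕 (s : E d → ℂ)) := by
    rw [← SchwartzMap.fourier_coe]
    exact (𝓕 s).integrable
  have h1 := integral_fourierInv_mul hg hi
  rw [e1] at h1
  simp only [h, zero_mul, integral_zero] at h1
  rw [h1]
  congr 1
  ext x
  rw [mul_comm]
  rfl

/-- The Fourier transform of a functional is unique: testing with the translates of a Gaussian `γ` shows that the
inverse Fourier transform of `(g - g') 𝓕 γ` vanishes, and `𝓕 γ` has no zeros. -/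
theorem HasFourier.ae_eq {u : GSDual d} {g g' : E d → ℂ} (h : HasFourier u g) (h' : HasFourier u g') :
    g =ᵐ[volume] g' := by
  set γ : GS d := ⟨gaussian 1, gaussian_mem_GS one_pos⟩ with hγ
  have hne : ∀ ξ, 𝓕 (γ : E d → ℂ) ξ ≠ 0 := by
    intro ξ
    have := fourier_gaussian_innerProductSpace (b := 1) (by simp) ξ
    have e : (γ : E d → ℂ) = fun v : E d => Complex.exp (-1 * ‖v‖ ^ 2) := by
      ext v; simp [hγ, gaussian]
    rw [e, this]
    refine mul_ne_zero ?_ (Complex.exp_ne_zero _)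
    rw [Complex.cpow_ne_zero_iff]
    left
    simp
  have hi : ∀ ψ : GS d, Integrable fun ξ => (g ξ - g' ξ) * 𝓕⁻ (ψ : E d → ℂ) ξ := fun ψ => by
    simp only [sub_mul]
    exact (h.2 ψ).1.sub (h'.2 ψ).1
  have h0 : ∀ ψ : GS d, ∫ ξ, (g ξ - g' ξ) * 𝓕⁻ (ψ : E d → ℂ) ξ = 0 := fun ψ => by
    simp only [sub_mul]
    rw [integral_sub (h.2 ψ).1 (h'.2 ψ).1, ← (h.2 ψ).2, ← (h'.2 ψ).2, sub_self]
  have hG : Integrable fun ξ => (g ξ - g' ξ) * 𝓕 (γ : E d → ℂ) ξ := by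
    have := hi (GS.reflTranslate 0 γ)
    simpa [fourierInv_reflTranslate] using this
  have hz := ae_eq_zero_of_fourierInv_eq_zero hG fun x => by
    rw [Real.fourierInv_eq, ← h0 (GS.reflTranslate x γ)]
    congr 1
    ext ξ
    rw [fourierInv_reflTranslate, Circle.smul_def, smul_eq_mul, real_inner_comm]
    ring
  filter_upwards [hz] with ξ hξ
  have := (mul_eq_zero.1 hξ).resolve_right (hne ξ)
  exact sub_eq_zero.1 this

theorem HasFourier.congr {u v : GSDual d} {g g' : E d → ℂ} (h : HasFourier u g) (h' : HasFourier v g')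
    (e : g =ᵐ[volume] g') : u = v := by
  ext ψ
  change u ψ = v ψ
  rw [(h.2 ψ).2, (h'.2 ψ).2]
  refine integral_congr_ae ?_
  filter_upwards [e] with ξ hξ
  rw [hξ]

theorem HasFourier.flSeminorm_eq {M : DefiningSequence} {u : GSDual d} {g : E d → ℂ} (h : HasFourier u g)
    (q : ℝ≥0∞) (ω : ModerateWeight M d) (Γ : Set (E d)) :
    flSeminorm q ω Γ u = eLpNorm (fun ξ => g ξ * (ω ξ : ℂ)) q (volume.restrict Γ) := by
  refine le_antisymm (iInf₂_le g h) (le_iInf₂ fun g' hg' => le_of_eq (eLpNorm_congr_ae ?_))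
  filter_upwards [ae_restrict_of_ae (h.ae_eq hg')] with ξ hξ
  rw [hξ]

theorem exists_hasFourier_of_flSeminorm_lt_top {M : DefiningSequence} {u : GSDual d}
    {q : ℝ≥0∞} {ω : ModerateWeight M d} {Γ : Set (E d)} (h : flSeminorm q ω Γ u < ∞) :
    ∃ g, HasFourier u g ∧ eLpNorm (fun ξ => g ξ * (ω ξ : ℂ)) q (volume.restrict Γ) < ∞ := by
  unfold flSeminorm at h
  simp only [iInf_lt_iff] at h
  obtain ⟨g, hg, h⟩ := h
  exact ⟨g, hg, h⟩

end Uniqueness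

/-! ### Functionals with a Fourier transform of ultradistributional growth -/

section Tempered

variable {M : DefiningSequence} {d : ℕ}

theorem ModerateWeight.aestronglyMeasurable_ofReal (ω : ModerateWeight M d) :
    AEStronglyMeasurable (fun ξ => (ω ξ : ℂ)) volume :=
  (Complex.measurable_ofReal.comp_aemeasurable ω.aemeasurable).aestronglyMeasurable

/-- A moderate weight lies between multiples of `e^{-M(|ξ|)}` and `e^{M(|ξ|)}`. -/
theorem ModerateWeight.exists_le_wt (ω : ModerateWeight M d) :
    ∃ C > 0, ∀ ξ, ω ξ ≤ C * M.wt ‖ξ‖ ∧ 1 ≤ C * M.wt ‖ξ‖ * ω ξ := by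
  obtain ⟨C, hC⟩ := ω.moderate
  have h0 := ω.pos 0
  have hC0 : 0 < C := by
    have h1 := hC 0 0
    rw [add_zero] at h1
    have h2 : 0 < C * (M.expWeight (0 : E d) * ω 0) := h0.trans_le h1
    exact pos_of_mul_pos_left h2 (mul_pos (Real.exp_pos _) h0).le
  refine ⟨C * ω 0 + C / ω 0, by positivity, fun ξ => ⟨?_, ?_⟩⟩
  · have h1 := hC ξ 0
    rw [add_zero] at h1
    change _ ≤ C * (M.wt ‖ξ‖ * ω 0) at h1
    have := M.wt_pos ‖ξ‖
    have : 0 ≤ C / ω 0 * M.wt ‖ξ‖ := by positivity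
    linarith
  · have h1 := hC (-ξ) ξ
    rw [neg_add_cancel] at h1
    change _ ≤ C * (M.wt ‖-ξ‖ * ω ξ) at h1
    rw [norm_neg] at h1
    have := M.wt_pos ‖ξ‖
    have hξ := ω.pos ξ
    have h2 : 1 ≤ C / ω 0 * M.wt ‖ξ‖ * ω ξ := by
      rw [div_mul_eq_mul_div, div_mul_eq_mul_div, le_div_iff₀ h0, one_mul]
      linarith
    have : 0 ≤ C * ω 0 * M.wt ‖ξ‖ * ω ξ := by positivity
    linarith

/-- Functions of at most the growth `e^{M(k|ξ|)}`, in the `L¹` sense, for some `k`. -/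
def UltraTempered (M : DefiningSequence) (g : E d → ℂ) : Prop :=
  AEStronglyMeasurable g ∧ ∃ k ≥ 0, Integrable fun ξ => ‖g ξ‖ * (M.wt (k * ‖ξ‖))⁻¹

theorem integrable_mul_of_wt_le {g a : E d → ℂ} {k C : ℝ} (hg : AEStronglyMeasurable g)
    (hgk : Integrable fun ξ => ‖g ξ‖ * (M.wt (k * ‖ξ‖))⁻¹) (ha : AEStronglyMeasurable a)
    (hC : ∀ ξ, M.wt (k * ‖ξ‖) * ‖a ξ‖ ≤ C) :
    Integrable (fun ξ => g ξ * a ξ) ∧ ‖∫ ξ, g ξ * a ξ‖ ≤ C * ∫ ξ, ‖g ξ‖ * (M.wt (k * ‖ξ‖))⁻¹ := by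
  have key : ∀ ξ, ‖g ξ * a ξ‖ ≤ C * (‖g ξ‖ * (M.wt (k * ‖ξ‖))⁻¹) := by
    intro ξ
    have hw := M.wt_pos (k * ‖ξ‖)
    rw [norm_mul]
    calc ‖g ξ‖ * ‖a ξ‖ = (M.wt (k * ‖ξ‖) * ‖a ξ‖) * (‖g ξ‖ * (M.wt (k * ‖ξ‖))⁻¹) := by field_simp
      _ ≤ _ := by gcongr; exact hC ξ
  refine ⟨(hgk.const_mul C).mono' (hg.mul ha) (Eventually.of_forall key), ?_⟩
  rw [← integral_const_mul]
  exact norm_integral_le_of_norm_le (hgk.const_mul C) (Eventually.of_forall key)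

theorem UltraTempered.integrable_mul {g a : E d → ℂ} (hg : UltraTempered M g) (ha : Rapid M a) :
    Integrable fun ξ => g ξ * a ξ := by
  obtain ⟨hm, k, hk, hi⟩ := hg
  obtain ⟨C, hC⟩ := ha.2 k hk
  exact (integrable_mul_of_wt_le hm hi ha.1 hC).1

theorem norm_wt_mul_fourierInv_le {f : E d → ℂ} {k C : ℝ}
    (h : ∀ ξ, M.wt (k * ‖ξ‖) * ‖𝓕 f ξ‖ ≤ C) (ξ : E d) : M.wt (k * ‖ξ‖) * ‖𝓕⁻ f ξ‖ ≤ C := by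
  have := h (-ξ)
  rwa [norm_neg, ← Real.fourierInv_eq_fourier_neg] at this

theorem fourierInv_add {f g : E d → ℂ} (hf : Integrable f) (hg : Integrable g) :
    𝓕⁻ (f + g) = 𝓕⁻ f + 𝓕⁻ g := by
  ext ξ
  simp only [Real.fourierInv_eq, Pi.add_apply, smul_add]
  have h : ∀ f : E d → ℂ, Integrable f → Integrable fun v => Real.fourierChar (inner ℝ v ξ) • f v := by
    intro f hf
    have := (Real.fourierIntegral_convergent_iff (-ξ)).2 hf
    simpa using this
  exact integral_add (h f hf) (h g hg)

theorem fourierInv_const_smul (c : ℂ) (f : E d → ℂ) : 𝓕⁻ (c • f) = c • 𝓕⁻ f := by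
  ext ξ
  simp only [Real.fourierInv_eq, Pi.smul_apply, smul_comm _ c]
  exact integral_smul c _

/-- The functional whose Fourier transform is the given function `g`. -/
noncomputable def UltraTempered.toDual {g : E d → ℂ} (hg : UltraTempered M g) : GSDual d :=
  ⟨{ toFun := fun ψ => ∫ ξ, g ξ * 𝓕⁻ (ψ : E d → ℂ) ξ
     map_add' := fun ψ χ => by
       rw [← integral_add (hg.integrable_mul (GS.rapid_fourierInv ψ)) (hg.integrable_mul (GS.rapid_fourierInv χ))]
       rw [Submodule.coe_add, fourierInv_add (GS.integrable ψ) (GS.integrable χ)]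
       simp [mul_add]
     map_smul' := fun c ψ => by
       rw [RingHom.id_apply, smul_eq_mul, ← integral_const_mul, Submodule.coe_smul, fourierInv_const_smul]
       congr 1
       ext x
       simp only [Pi.smul_apply, smul_eq_mul]
       ring },
   by
     obtain ⟨hm, k, hk, hi⟩ := hg
     obtain ⟨h, hh, C, hC, H⟩ := GSBound.exists_wt_mul_fourier_le M d hk
     refine ⟨h, hh, C * ∫ ξ, ‖g ξ‖ * (M.wt (k * ‖ξ‖))⁻¹, fun f B hB => ?_⟩
     have h1 := norm_wt_mul_fourierInv_le (H f B f.2.1 hB)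
     have h2 := (integrable_mul_of_wt_le hm hi (GS.rapid_fourierInv (M := M) f).1 h1).2
     refine h2.trans_eq ?_
     ring⟩

theorem UltraTempered.hasFourier {g : E d → ℂ} (hg : UltraTempered M g) : HasFourier hg.toDual g :=
  ⟨hg.1, fun ψ => ⟨hg.integrable_mul (GS.rapid_fourierInv ψ), rfl⟩⟩

theorem memLp_of_le_inv_wt {f : E d → ℂ} {k C : ℝ} (hk : 0 < k) (hf : AEStronglyMeasurable f)
    (h : ∀ ξ, ‖f ξ‖ ≤ C * (M.wt (k * ‖ξ‖))⁻¹) {q : ℝ≥0∞} (hq : 1 ≤ q) : MemLp f q := by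
  have hw : MemLp (fun ξ : E d => (M.wt (k * ‖ξ‖))⁻¹) q := by
    have hm : AEStronglyMeasurable fun ξ : E d => (M.wt (k * ‖ξ‖))⁻¹ :=
      (M.measurable_wt_norm k).inv.aestronglyMeasurable
    have h1 : ∀ ξ : E d, ‖(M.wt (k * ‖ξ‖))⁻¹‖ ≤ 1 := fun ξ => by
      rw [norm_inv, Real.norm_of_nonneg (M.wt_pos _).le]
      exact inv_le_one_of_one_le₀ (M.one_le_wt _)
    rcases eq_or_ne q ∞ with rfl | hq'
    · exact memLp_top_of_bound hm 1 (Eventually.of_forall h1)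
    · rw [← integrable_norm_rpow_iff hm (by positivity) hq']
      refine (M.integrable_inv_wt (d := d) hk).mono' (hm.norm.aemeasurable.pow_const _).aestronglyMeasurable
        (Eventually.of_forall fun ξ => ?_)
      have hq1 : 1 ≤ q.toReal := by
        have := ENNReal.toReal_mono hq' hq
        simpa using this
      have h2 := Real.rpow_le_rpow_of_exponent_ge' (norm_nonneg _) (h1 ξ) zero_le_one hq1
      rw [Real.rpow_one] at h2
      rw [Real.norm_of_nonneg (by positivity)]
      refine h2.trans_eq ?_
      rw [norm_inv, Real.norm_of_nonneg (M.wt_pos _).le]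
  refine hw.of_le_mul (c := C) hf (Eventually.of_forall fun ξ => ?_)
  rw [norm_inv, Real.norm_of_nonneg (M.wt_pos _).le]
  exact h ξ

/-- Elements of a weighted `L^q` space have ultradistributional growth. -/
theorem UltraTempered.of_memLp {g : E d → ℂ} {q : ℝ≥0∞} (hq : 1 ≤ q) (ω : ModerateWeight M d)
    (hg : AEStronglyMeasurable g) (h : eLpNorm (fun ξ => g ξ * (ω ξ : ℂ)) q volume < ∞) :
    UltraTempered M g := by
  obtain ⟨C, hC, hω⟩ := ω.exists_le_wt
  obtain ⟨A, hA, K, hK, hAK⟩ := M.exists_wt_mul_wt_le zero_le_one zero_le_one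
  have hG : MemLp (fun ξ => g ξ * (ω ξ : ℂ)) q volume := ⟨hg.mul ω.aestronglyMeasurable_ofReal, h⟩
  -- Hölder: `g = (g ω) · (1/ω)`, and `1/ω` times a weight `e^{-M(K|ξ|)}` is at most a multiple of `e^{-M(|ξ|)}`
  have hconj : q.HolderConjugate q.conjExponent := ENNReal.HolderConjugate.conjExponent hq
  have hw : MemLp (fun ξ : E d => ((M.wt (1 * ‖ξ‖))⁻¹ : ℂ)) q.conjExponent := by
    refine memLp_of_le_inv_wt (M := M) (k := 1) (C := 1) one_pos
      (Complex.measurable_ofReal.comp (M.measurable_wt_norm 1)).inv.aestronglyMeasurable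
      (fun ξ => ?_) hconj.symm.one_le
    change ‖((M.wt (1 * ‖ξ‖) : ℝ) : ℂ)⁻¹‖ ≤ _
    rw [norm_inv, Complex.norm_real, Real.norm_of_nonneg (M.wt_pos _).le]
    exact (one_mul _).ge
  have hi := hG.integrable_mul hw
  refine ⟨hg, K, by linarith, ((hi.norm).const_mul (C * A)).mono'
    (hg.norm.mul (M.measurable_wt_norm K).inv.aestronglyMeasurable) (Eventually.of_forall fun ξ => ?_)⟩
  have h1 := M.wt_pos (1 * ‖ξ‖)
  have h2 := M.wt_pos (K * ‖ξ‖)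
  have h3 := ω.pos ξ
  rw [Real.norm_of_nonneg (by positivity)]
  simp only [Pi.mul_apply, norm_mul, norm_inv, Complex.norm_real, Real.norm_of_nonneg h1.le,
    Real.norm_of_nonneg h3.le]
  have h4 := (hω ξ).2
  rw [← one_mul ‖ξ‖] at h4
  have h5 := hAK ‖ξ‖ (norm_nonneg _)
  have h6 : (M.wt (K * ‖ξ‖))⁻¹ ≤ C * A * (ω ξ * (M.wt (1 * ‖ξ‖))⁻¹) := by
    rw [inv_le_iff_one_le_mul₀ h2]
    calc 1 ≤ C * M.wt (1 * ‖ξ‖) * ω ξ := h4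
      _ = (M.wt (1 * ‖ξ‖) * M.wt (1 * ‖ξ‖)) * (C * ω ξ * (M.wt (1 * ‖ξ‖))⁻¹) := by field_simp
      _ ≤ (A * M.wt (K * ‖ξ‖)) * (C * ω ξ * (M.wt (1 * ‖ξ‖))⁻¹) := by gcongr
      _ = _ := by ring
  calc _ ≤ ‖g ξ‖ * (C * A * (ω ξ * (M.wt (1 * ‖ξ‖))⁻¹)) := by gcongr
    _ = _ := by ring

theorem hasFourier_toDual (M : DefiningSequence) (f : GS d) : HasFourier (GS.toDual f) (𝓕 (f : E d → ℂ)) := by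
  have h1 := (GS.rapid_fourier (M := M) f)
  refine ⟨h1.1, fun ψ => ?_⟩
  have h2 := GS.rapid_fourierInv (M := M) ψ
  constructor
  · refine h1.integrable.mul_bdd (c := ∫ x, ‖(ψ : E d → ℂ) x‖) h2.1 (Eventually.of_forall fun ξ => ?_)
    exact norm_fourierInv_le _ ξ
  · rw [integral_fourier_mul (GS.integrable f) h2.integrable, GS.fourier_fourierInv M ψ]
    rfl

theorem GS.memLp_fourier_mul (f : GS d) {q : ℝ≥0∞} (hq : 1 ≤ q) (ω : ModerateWeight M d) :
    MemLp (fun ξ => 𝓕 (f : E d → ℂ) ξ * (ω ξ : ℂ)) q := by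
  obtain ⟨C, hC, hω⟩ := ω.exists_le_wt
  obtain ⟨A, hA, K, hK, hAK⟩ := M.exists_wt_mul_wt_le zero_le_one zero_le_one
  have h1 := (GS.rapid_fourier (M := M) f)
  obtain ⟨D, hD⟩ := h1.2 K (by linarith)
  refine memLp_of_le_inv_wt (M := M) (k := 1) (C := C * A * D) one_pos
    (h1.1.mul ω.aestronglyMeasurable_ofReal) (fun ξ => ?_) hq
  have hw := M.wt_pos (1 * ‖ξ‖)
  have h3 := ω.pos ξ
  have h4 := (hω ξ).1
  rw [← one_mul ‖ξ‖] at h4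
  change ‖𝓕 (f : E d → ℂ) ξ * (ω ξ : ℂ)‖ ≤ _
  rw [norm_mul, Complex.norm_real, Real.norm_of_nonneg h3.le, ← div_eq_mul_inv, le_div_iff₀ hw]
  calc ‖𝓕 (f : E d → ℂ) ξ‖ * ω ξ * M.wt (1 * ‖ξ‖)
      ≤ ‖𝓕 (f : E d → ℂ) ξ‖ * (C * M.wt (1 * ‖ξ‖)) * M.wt (1 * ‖ξ‖) := by gcongr
    _ = C * ‖𝓕 (f : E d → ℂ) ξ‖ * (M.wt (1 * ‖ξ‖) * M.wt (1 * ‖ξ‖)) := by ring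
    _ ≤ C * ‖𝓕 (f : E d → ℂ) ξ‖ * (A * M.wt (K * ‖ξ‖)) :=
        mul_le_mul_of_nonneg_left (hAK _ (norm_nonneg ξ)) (by positivity)
    _ = C * A * (M.wt (K * ‖ξ‖) * ‖𝓕 (f : E d → ℂ) ξ‖) := by ring
    _ ≤ _ := by gcongr; exact hD ξ

theorem GS.toDual_mem_FL (f : GS d) (q : ℝ≥0∞) [Fact (1 ≤ q)] (ω : ModerateWeight M d) :
    GS.toDual f ∈ FL q ω := by
  change flSeminorm q ω univ (GS.toDual f) < ∞
  rw [(hasFourier_toDual M f).flSeminorm_eq, Measure.restrict_univ]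
  exact (GS.memLp_fourier_mul f Fact.out ω).2

end Tempered

/-! ### Convolution with smooth functions -/

section ConvSmooth

variable {d : ℕ} {F : Type} [NormedAddCommGroup F] [NormedSpace ℂ F] [NormedSpace ℝ F]
  [IsScalarTower ℝ ℂ F]

theorem hasFDerivAt_integral_smul_sub {f : E d → ℂ} (hf : Integrable f) {G : E d → F}
    (hG : ContDiff ℝ 1 G) {B₀ B₁ : ℝ} (h0 : ∀ x, ‖G x‖ ≤ B₀) (h1 : ∀ x, ‖fderiv ℝ G x‖ ≤ B₁) (x : E d) :
    HasFDerivAt (fun x => ∫ t, f t • G (x - t)) (∫ t, f t • fderiv ℝ G (x - t)) x := by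
  have hGc : Continuous G := hG.continuous
  have hG'c : Continuous (fderiv ℝ G) := hG.continuous_fderiv (by norm_num)
  have hm : ∀ y, AEStronglyMeasurable (fun t => f t • G (y - t)) volume := fun y =>
    hf.1.smul (hGc.comp (continuous_const.sub continuous_id)).aestronglyMeasurable
  refine hasFDerivAt_integral_of_dominated_of_fderiv_le (𝕜 := ℝ) (s := univ)
    (bound := fun t => ‖f t‖ * B₁) (F' := fun y t => f t • fderiv ℝ G (y - t))
    univ_mem (Eventually.of_forall hm) ?_ ?_ ?_ (hf.norm.mul_const _) ?_
  · refine (hf.norm.mul_const B₀).mono' (hm x) (Eventually.of_forall fun t => ?_)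
    rw [norm_smul]
    gcongr
    exact h0 _
  · exact hf.1.smul (hG'c.comp (continuous_const.sub continuous_id)).aestronglyMeasurable
  · refine Eventually.of_forall fun t y _ => ?_
    rw [norm_smul]
    gcongr
    exact h1 _
  · refine Eventually.of_forall fun t y _ => ?_
    have h2 : HasFDerivAt (fun y => G (y - t)) (fderiv ℝ G (y - t)) y := by
      have := (hG.differentiable (by norm_num) (y - t)).hasFDerivAt.comp y ((hasFDerivAt_id y).sub_const t)
      simpa using! this
    exact h2.const_smul (f t)

end ConvSmooth

section ConvGS

variable {d : ℕ}

/-- Derivatives of a convolution fall on the smooth factor. -/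
theorem contDiff_integral_smul_sub (n : ℕ) : ∀ {F : Type} [NormedAddCommGroup F] [NormedSpace ℂ F]
    [NormedSpace ℝ F] [IsScalarTower ℝ ℂ F] {f : E d → ℂ} (_ : Integrable f) {G : E d → F}
    (_ : ContDiff ℝ (⊤ : ℕ∞) G) (_ : ∀ n : ℕ, ∃ B, ∀ x, ‖iteratedFDeriv ℝ n G x‖ ≤ B),
    ContDiff ℝ n (fun x => ∫ t, f t • G (x - t)) ∧
      ∀ x, ‖iteratedFDeriv ℝ n (fun x => ∫ t, f t • G (x - t)) x‖
        ≤ ∫ t, ‖f t‖ * ‖iteratedFDeriv ℝ n G (x - t)‖ := by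
  have hd : ∀ {F : Type} [NormedAddCommGroup F] [NormedSpace ℂ F]
    [NormedSpace ℝ F] [IsScalarTower ℝ ℂ F] {f : E d → ℂ} (_ : Integrable f) {G : E d → F}
    (_ : ContDiff ℝ (⊤ : ℕ∞) G) (_ : ∀ n : ℕ, ∃ B, ∀ x, ‖iteratedFDeriv ℝ n G x‖ ≤ B) (x : E d),
    HasFDerivAt (fun x => ∫ t, f t • G (x - t)) (∫ t, f t • fderiv ℝ G (x - t)) x := by
    intro F _ _ _ _ f hf G hG hB x
    obtain ⟨B₀, h0⟩ := hB 0
    obtain ⟨B₁, h1⟩ := hB 1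
    refine hasFDerivAt_integral_smul_sub hf (hG.of_le (by exact_mod_cast le_top)) (B₀ := B₀) (B₁ := B₁)
      (fun x => by simpa using h0 x) (fun x => ?_) x
    have := norm_iteratedFDeriv_fderiv (𝕜 := ℝ) (f := G) (x := x) (n := 0)
    rw [norm_iteratedFDeriv_zero] at this
    rw [this]
    exact h1 x
  induction n with
  | zero =>
    intro F _ _ _ _ f hf G hG hB
    refine ⟨?_, fun x => ?_⟩
    · rw [Nat.cast_zero, contDiff_zero]
      exact continuous_iff_continuousAt.2 fun x => (hd hf hG hB x).continuousAt
    · simp only [norm_iteratedFDeriv_zero]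
      refine (norm_integral_le_integral_norm _).trans_eq ?_
      simp only [norm_smul]
  | succ n ih =>
    intro F _ _ _ _ f hf G hG hB
    have hfd : fderiv ℝ (fun x => ∫ t, f t • G (x - t)) = fun x => ∫ t, f t • fderiv ℝ G (x - t) := by
      ext1 x
      exact (hd hf hG hB x).fderiv
    obtain ⟨h1, h2⟩ := ih hf (G := fderiv ℝ G) (hG.fderiv_right (by exact_mod_cast le_top)) fun m => by
      obtain ⟨B, h⟩ := hB (m + 1)
      refine ⟨B, fun x => ?_⟩
      rw [norm_iteratedFDeriv_fderiv]
      exact h x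
    refine ⟨?_, fun x => ?_⟩
    · rw [show ((n + 1 : ℕ) : WithTop ℕ∞) = (n : WithTop ℕ∞) + 1 by push_cast; rfl,
        contDiff_succ_iff_fderiv]
      refine ⟨fun x => (hd hf hG hB x).differentiableAt, by simp, ?_⟩
      rw [hfd]
      exact h1
    · rw [← norm_iteratedFDeriv_fderiv, hfd]
      refine (h2 x).trans_eq ?_
      simp only [norm_iteratedFDeriv_fderiv]

theorem contDiff_conv {f g : E d → ℂ} (hf : Integrable f) (hg : ContDiff ℝ (⊤ : ℕ∞) g)
    (hB : ∀ n : ℕ, ∃ B, ∀ x, ‖iteratedFDeriv ℝ n g x‖ ≤ B) : ContDiff ℝ (⊤ : ℕ∞) (conv f g) :=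
  contDiff_infty.2 fun n => (contDiff_integral_smul_sub n hf hg hB).1

theorem norm_iteratedFDeriv_conv_le {f g : E d → ℂ} (hf : Integrable f) (hg : ContDiff ℝ (⊤ : ℕ∞) g)
    (hB : ∀ n : ℕ, ∃ B, ∀ x, ‖iteratedFDeriv ℝ n g x‖ ≤ B) (n : ℕ) (x : E d) :
    ‖iteratedFDeriv ℝ n (conv f g) x‖ ≤ ∫ t, ‖f t‖ * ‖iteratedFDeriv ℝ n g (x - t)‖ :=
  (contDiff_integral_smul_sub n hf hg hB).2 x

/-- Moments of a function in `𝓢^{(1)}`. The constant does not depend on `k`: the additional `d + 1` powers of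
`|x|` needed for integrability cost `(k + d + 1)! ≤ 2^{k+d+1} k! (d + 1)!`. -/
theorem GSBound.exists_integral_pow_le {h : ℝ} (hh : 0 < h) : ∃ C > 0, ∀ (f : E d → ℂ) (B : ℝ),
    Continuous f → GSBound f h B → ∀ k : ℕ,
      Integrable (fun x => ‖x‖ ^ k * ‖f x‖) ∧
        ∫ x, ‖x‖ ^ k * ‖f x‖ ≤ C * B * ((2 * h) ^ k * k.factorial) := by
  have hint : Integrable fun x : E d => (1 + ‖x‖) ^ (-((d + 1 : ℕ) : ℝ)) :=
    integrable_one_add_norm (by simp)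
  set D : ℝ := 2 ^ (d + 1) * (1 + (2 * h) ^ (d + 1) * (d + 1).factorial) with hD
  have hI : 0 ≤ ∫ x : E d, (1 + ‖x‖) ^ (-((d + 1 : ℕ) : ℝ)) :=
    integral_nonneg fun x => by positivity
  refine ⟨D * (∫ x : E d, (1 + ‖x‖) ^ (-((d + 1 : ℕ) : ℝ))) + 1, by positivity,
    fun f B hf hB k => ?_⟩
  have hB0 := hB.nonneg
  have key : ∀ x, ‖‖x‖ ^ k * ‖f x‖‖
      ≤ (D * B * ((2 * h) ^ k * k.factorial)) * (1 + ‖x‖) ^ (-((d + 1 : ℕ) : ℝ)) := by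
    intro x
    rw [Real.norm_of_nonneg (by positivity), Real.rpow_neg (by positivity), Real.rpow_natCast,
      ← div_eq_mul_inv, le_div_iff₀ (by positivity)]
    have h1 : (1 + ‖x‖) ^ (d + 1) ≤ 2 ^ (d + 1) * (1 + ‖x‖ ^ (d + 1)) := by
      refine (add_pow_le zero_le_one (norm_nonneg _) _).trans ?_
      rw [one_pow]
      gcongr
      · norm_num
      · omega
    have h2 := hB k 0 x
    have h3 := hB (k + (d + 1)) 0 x
    simp only [norm_iteratedFDeriv_zero, add_zero, Nat.factorial_zero, Nat.cast_one, mul_one] at h2 h3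
    have hfac : ((k + (d + 1)).factorial : ℝ) ≤ 2 ^ (k + (d + 1)) * k.factorial * (d + 1).factorial := by
      have e := Nat.add_choose_mul_factorial_mul_factorial k (d + 1)
      have e2 := Nat.choose_le_two_pow (k + (d + 1)) (d + 1)
      rw [← e]
      push_cast
      gcongr
      exact_mod_cast e2
    have h4 : h ^ k ≤ (2 * h) ^ k := by gcongr; linarith
    calc ‖x‖ ^ k * ‖f x‖ * (1 + ‖x‖) ^ (d + 1)
        ≤ ‖x‖ ^ k * ‖f x‖ * (2 ^ (d + 1) * (1 + ‖x‖ ^ (d + 1))) := by gcongr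
      _ = 2 ^ (d + 1) * (‖x‖ ^ k * ‖f x‖ + ‖x‖ ^ (k + (d + 1)) * ‖f x‖) := by rw [pow_add]; ring
      _ ≤ 2 ^ (d + 1) * (B * ((2 * h) ^ k * k.factorial)
          + B * (h ^ (k + (d + 1)) * (2 ^ (k + (d + 1)) * k.factorial * (d + 1).factorial))) := by
          exact mul_le_mul_of_nonneg_left (add_le_add (h2.trans (by gcongr)) (h3.trans (by gcongr)))
            (by positivity)
      _ = _ := by rw [hD, mul_pow, mul_pow, pow_add h, pow_add 2]; ring
  have hm : AEStronglyMeasurable (fun x => ‖x‖ ^ k * ‖f x‖) volume :=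
    ((continuous_norm.pow k).mul hf.norm).aestronglyMeasurable
  have hint2 := hint.const_mul (D * B * ((2 * h) ^ k * k.factorial))
  refine ⟨hint2.mono' hm (Eventually.of_forall key), ?_⟩
  refine (integral_mono_of_nonneg (Eventually.of_forall fun x => by positivity) hint2
    (Eventually.of_forall fun x => (le_abs_self _).trans (key x))).trans ?_
  rw [integral_const_mul]
  have : 0 ≤ B * ((2 * h) ^ k * k.factorial) := by positivity
  nlinarith

theorem GS.exists_norm_iteratedFDeriv_le (f : GS d) (n : ℕ) :
    ∃ B, ∀ x, ‖iteratedFDeriv ℝ n (f : E d → ℂ) x‖ ≤ B := by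
  obtain ⟨B, hB⟩ := f.2.2 1 one_pos
  exact ⟨_, fun x => by simpa using hB 0 n x⟩

theorem conv_mem_GS (f g : GS d) : conv (f : E d → ℂ) g ∈ GS d := by
  refine ⟨contDiff_conv (GS.integrable f) g.2.1 (GS.exists_norm_iteratedFDeriv_le g), fun h hh => ?_⟩
  -- expanding `|x| ^ k ≤ 2 ^ k (|t| ^ k + |x - t| ^ k)` and the moment bounds together cost `4 ^ k`
  set s := h / 4 with hs
  have hs0 : 0 < s := by positivity
  obtain ⟨C, hC, HC⟩ := GSBound.exists_integral_pow_le (d := d) hs0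
  obtain ⟨Bf, hBf⟩ := f.2.2 s hs0
  obtain ⟨Bg, hBg⟩ := g.2.2 s hs0
  have hf0 := hBf.nonneg
  have hg0 := hBg.nonneg
  have HI := HC f Bf f.2.1.continuous hBf
  refine ⟨2 * (C * Bf * Bg), fun k n x => ?_⟩
  have h1 := norm_iteratedFDeriv_conv_le (GS.integrable f) g.2.1 (GS.exists_norm_iteratedFDeriv_le g) n x
  have hi0 : Integrable fun t => ‖(f : E d → ℂ) t‖ := (GS.integrable f).norm
  have I0 : ∫ t, ‖(f : E d → ℂ) t‖ ≤ C * Bf := by simpa using (HI 0).2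
  have hp : ∀ t, ‖x‖ ^ k * (‖(f : E d → ℂ) t‖ * ‖iteratedFDeriv ℝ n (g : E d → ℂ) (x - t)‖)
      ≤ 2 ^ k * (Bg * (s ^ n * n.factorial)) * (‖t‖ ^ k * ‖(f : E d → ℂ) t‖)
        + 2 ^ k * (Bg * (s ^ (k + n) * k.factorial * n.factorial)) * ‖(f : E d → ℂ) t‖ := by
    intro t
    have e0 : ‖x‖ ≤ ‖t‖ + ‖x - t‖ := by
      calc ‖x‖ = ‖t + (x - t)‖ := by simp
        _ ≤ _ := norm_add_le _ _
    have e1 : ‖x‖ ^ k ≤ 2 ^ k * (‖t‖ ^ k + ‖x - t‖ ^ k) := by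
      refine (pow_le_pow_left₀ (norm_nonneg _) e0 k).trans ?_
      refine (add_pow_le (norm_nonneg _) (norm_nonneg _) k).trans ?_
      gcongr
      · norm_num
      · exact Nat.sub_le _ _
    have e2 := hBg 0 n (x - t)
    have e3 := hBg k n (x - t)
    simp only [pow_zero, one_mul, zero_add, Nat.factorial_zero, Nat.cast_one, mul_one] at e2
    calc _ ≤ 2 ^ k * (‖t‖ ^ k + ‖x - t‖ ^ k) *
          (‖(f : E d → ℂ) t‖ * ‖iteratedFDeriv ℝ n (g : E d → ℂ) (x - t)‖) := by gcongr
      _ = 2 ^ k * ‖iteratedFDeriv ℝ n (g : E d → ℂ) (x - t)‖ * (‖t‖ ^ k * ‖(f : E d → ℂ) t‖)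
          + 2 ^ k * (‖x - t‖ ^ k * ‖iteratedFDeriv ℝ n (g : E d → ℂ) (x - t)‖) * ‖(f : E d → ℂ) t‖ := by
          ring
      _ ≤ _ := by gcongr
  calc ‖x‖ ^ k * ‖iteratedFDeriv ℝ n (conv (f : E d → ℂ) g) x‖
      ≤ ‖x‖ ^ k * ∫ t, ‖(f : E d → ℂ) t‖ * ‖iteratedFDeriv ℝ n (g : E d → ℂ) (x - t)‖ := by gcongr
    _ = ∫ t, ‖x‖ ^ k * (‖(f : E d → ℂ) t‖ * ‖iteratedFDeriv ℝ n (g : E d → ℂ) (x - t)‖) :=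
        (integral_const_mul _ _).symm
    _ ≤ ∫ t, (2 ^ k * (Bg * (s ^ n * n.factorial)) * (‖t‖ ^ k * ‖(f : E d → ℂ) t‖)
        + 2 ^ k * (Bg * (s ^ (k + n) * k.factorial * n.factorial)) * ‖(f : E d → ℂ) t‖) :=
        integral_mono_of_nonneg (Eventually.of_forall fun t => by positivity)
          (((HI k).1.const_mul _).add (hi0.const_mul _)) (Eventually.of_forall hp)
    _ = 2 ^ k * (Bg * (s ^ n * n.factorial)) * (∫ t, ‖t‖ ^ k * ‖(f : E d → ℂ) t‖)
        + 2 ^ k * (Bg * (s ^ (k + n) * k.factorial * n.factorial)) * ∫ t, ‖(f : E d → ℂ) t‖ := by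
        rw [integral_add ((HI k).1.const_mul _) (hi0.const_mul _), integral_const_mul, integral_const_mul]
    _ ≤ 2 ^ k * (Bg * (s ^ n * n.factorial)) * (C * Bf * ((2 * s) ^ k * k.factorial))
        + 2 ^ k * (Bg * (s ^ (k + n) * k.factorial * n.factorial)) * (C * Bf) := by
        gcongr
        exact (HI k).2
    _ = (C * Bf * Bg) * (4 ^ k * s ^ (k + n) * (k.factorial * n.factorial))
        + (C * Bf * Bg) * (2 ^ k * s ^ (k + n) * (k.factorial * n.factorial)) := by
        rw [mul_pow, pow_add, show (4 : ℝ) = 2 * 2 by norm_num, mul_pow]; ring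
    _ ≤ (C * Bf * Bg) * (h ^ (k + n) * (k.factorial * n.factorial))
        + (C * Bf * Bg) * (h ^ (k + n) * (k.factorial * n.factorial)) := by
        have e4 : ∀ c : ℝ, 0 ≤ c → c ≤ 4 → c ^ k * s ^ (k + n) ≤ h ^ (k + n) := by
          intro c hc0 hc
          have : h = 4 * s := by rw [hs]; ring
          rw [this, mul_pow]
          gcongr
          calc c ^ k ≤ 4 ^ k := by gcongr
            _ ≤ 4 ^ (k + n) := by gcongr <;> norm_num
        gcongr
        · exact e4 4 (by norm_num) (by norm_num)
        · exact e4 2 (by norm_num) (by norm_num)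
    _ = _ := by ring

theorem fourier_conv {f g : E d → ℂ} (hf : Integrable f) (hg : Integrable g) (ξ : E d) :
    𝓕 (conv f g) ξ = 𝓕 f ξ * 𝓕 g ξ :=
  Real.fourier_mul_convolution_eq hf hg ξ

end ConvGS

/-! ### Density of `𝓢^{(1)}` in the Fourier–Lebesgue spaces -/

section Density

variable {M : DefiningSequence} {d : ℕ}

theorem fourierInv_char_smul (b : E d → ℂ) (ξ t : E d) :
    𝓕⁻ (fun x => Real.fourierChar (-inner ℝ x ξ) • b x) t = 𝓕 b (ξ - t) := by
  rw [Real.fourierInv_eq, Real.fourier_eq]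
  congr 1
  ext x
  rw [smul_smul, ← AddChar.map_add_eq_mul, inner_sub_right]
  congr 2
  ring

theorem integrable_char_smul {b : E d → ℂ} (hb : Integrable b) (ξ : E d) :
    Integrable fun x => Real.fourierChar (-inner ℝ x ξ) • b x :=
  (Real.fourierIntegral_convergent_iff ξ).2 hb

/-- The Fourier transform turns multiplication into convolution. -/
theorem fourier_fourierInv_mul {a b : E d → ℂ} (ha : Integrable a) (hb : Integrable b) (ξ : E d) :
    𝓕 (fun x => 𝓕⁻ a x * b x) ξ = conv a (𝓕 b) ξ := by
  have h := integral_fourierInv_mul ha (integrable_char_smul hb ξ)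
  simp only [fourierInv_char_smul] at h
  rw [conv, ← h, Real.fourier_eq]
  congr 1
  ext x
  simp only [Circle.smul_def, smul_eq_mul]
  ring

theorem fourier_gaussian_inv (c : ℝ) (hc : 0 < c) (η : E d) : 𝓕 (gaussian (d := d) c⁻¹) η
    = (Real.pi * c : ℂ) ^ (Module.finrank ℝ (E d) / 2 : ℂ) * Complex.exp (-Real.pi ^ 2 * c * ‖η‖ ^ 2) := by
  have h := fourier_gaussian_innerProductSpace (V := E d) (b := ((c⁻¹ : ℝ) : ℂ)) (by
    rw [Complex.ofReal_re]; positivity) η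
  have e : gaussian (d := d) c⁻¹ = fun v : E d => Complex.exp (-((c⁻¹ : ℝ) : ℂ) * ‖v‖ ^ 2) := rfl
  rw [e, h]
  have hc' : (c : ℂ) ≠ 0 := by exact_mod_cast hc.ne'
  congr 2
  · push_cast; field_simp
  · push_cast; field_simp

theorem norm_fourier_gaussian_inv (c : ℝ) (hc : 0 < c) (η : E d) : ‖𝓕 (gaussian (d := d) c⁻¹) η‖
    = (Real.pi * c) ^ (Module.finrank ℝ (E d) / 2 : ℝ) * Real.exp (-(Real.pi ^ 2 * c) * ‖η‖ ^ 2) := by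
  have hpi := Real.pi_pos
  rw [fourier_gaussian_inv c hc, norm_mul, Complex.norm_exp]
  have e1 : (Real.pi * c : ℂ) ^ (Module.finrank ℝ (E d) / 2 : ℂ)
      = (((Real.pi * c) ^ (Module.finrank ℝ (E d) / 2 : ℝ) : ℝ) : ℂ) := by
    rw [Complex.ofReal_cpow (by positivity)]
    push_cast
    rfl
  have e2 : (-(Real.pi : ℂ) ^ 2 * c * ‖η‖ ^ 2) = ((-(Real.pi ^ 2 * c) * ‖η‖ ^ 2 : ℝ) : ℂ) := by
    push_cast; ring
  rw [e1, e2, Complex.norm_real, Complex.ofReal_re, Real.norm_of_nonneg (by positivity)]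

/-- Exponential moments of the heat kernels `𝓕 γ_{1/c}` are uniformly bounded for `c ≥ 1`. -/
theorem integral_exp_mul_norm_fourier_gaussian_le {c : ℝ} (hc : 1 ≤ c) (a : ℝ) :
    Integrable (fun η : E d => Real.exp (a * ‖η‖) * ‖𝓕 (gaussian (d := d) c⁻¹) η‖) ∧
      ∫ η : E d, Real.exp (a * ‖η‖) * ‖𝓕 (gaussian (d := d) c⁻¹) η‖
        ≤ Real.exp (a ^ 2 / (2 * Real.pi ^ 2)) * 2 ^ (Module.finrank ℝ (E d) / 2 : ℝ) := by
  have hpi := Real.pi_pos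
  have hc0 : 0 < c := by linarith
  have hb : 0 < Real.pi ^ 2 * c / 2 := by positivity
  set P : ℝ := (Real.pi * c) ^ (Module.finrank ℝ (E d) / 2 : ℝ) with hP
  have hint : Integrable fun η : E d => Real.exp (-(Real.pi ^ 2 * c / 2) * ‖η‖ ^ 2) := by
    have := GS.integrable (⟨gaussian (d := d) (Real.pi ^ 2 * c / 2), gaussian_mem_GS hb⟩ : GS d)
    simpa only [norm_gaussian] using this.norm
  have key : ∀ η : E d, Real.exp (a * ‖η‖) * ‖𝓕 (gaussian (d := d) c⁻¹) η‖
      ≤ (Real.exp (a ^ 2 / (2 * Real.pi ^ 2)) * P) * Real.exp (-(Real.pi ^ 2 * c / 2) * ‖η‖ ^ 2) := by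
    intro η
    rw [norm_fourier_gaussian_inv c hc0, ← hP]
    have h1 : a * ‖η‖ ≤ a ^ 2 / (2 * Real.pi ^ 2) + Real.pi ^ 2 * c / 2 * ‖η‖ ^ 2 := by
      have h2 : a * ‖η‖ ≤ a ^ 2 / (2 * Real.pi ^ 2) + Real.pi ^ 2 / 2 * ‖η‖ ^ 2 := by
        have := sq_nonneg (a / Real.pi - Real.pi * ‖η‖)
        have e : (a / Real.pi - Real.pi * ‖η‖) ^ 2
            = 2 * (a ^ 2 / (2 * Real.pi ^ 2) + Real.pi ^ 2 / 2 * ‖η‖ ^ 2 - a * ‖η‖) := by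
          field_simp; ring
        linarith
      have h3 : Real.pi ^ 2 / 2 * ‖η‖ ^ 2 ≤ Real.pi ^ 2 * c / 2 * ‖η‖ ^ 2 := by
        gcongr
        nlinarith [sq_nonneg Real.pi]
      linarith
    calc Real.exp (a * ‖η‖) * (P * Real.exp (-(Real.pi ^ 2 * c) * ‖η‖ ^ 2))
        = P * Real.exp (a * ‖η‖ + -(Real.pi ^ 2 * c) * ‖η‖ ^ 2) := by rw [Real.exp_add]; ring
      _ ≤ P * Real.exp (a ^ 2 / (2 * Real.pi ^ 2) + -(Real.pi ^ 2 * c / 2) * ‖η‖ ^ 2) := by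
          have : 0 ≤ P := by positivity
          exact mul_le_mul_of_nonneg_left (Real.exp_le_exp.2 (by linarith)) this
      _ = _ := by rw [Real.exp_add]; ring
  have hm : Continuous fun η : E d => Real.exp (a * ‖η‖) * ‖𝓕 (gaussian (d := d) c⁻¹) η‖ := by
    simp only [norm_fourier_gaussian_inv c hc0]
    fun_prop
  refine ⟨(hint.const_mul (Real.exp (a ^ 2 / (2 * Real.pi ^ 2)) * P)).mono' hm.aestronglyMeasurable (Eventually.of_forall fun η => ?_), ?_⟩
  · rw [Real.norm_of_nonneg (by positivity)]
    exact key η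
  · refine (integral_mono_of_nonneg (Eventually.of_forall fun η => by positivity) (hint.const_mul _)
      (Eventually.of_forall key)).trans_eq ?_
    rw [integral_const_mul, GaussianFourier.integral_rexp_neg_mul_sq_norm hb, mul_assoc, hP,
      ← Real.mul_rpow (by positivity) (by positivity)]
    congr 2
    field_simp

theorem rapidL1_of_hasCompactSupport (M : DefiningSequence) {g : E d → ℂ} (hg : Continuous g)
    (hc : HasCompactSupport g) : RapidL1 M g := by
  refine ⟨hg.aestronglyMeasurable, fun k hk => ?_⟩
  obtain ⟨R, hR⟩ := hc.isCompact.isBounded.exists_norm_le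
  refine ((hg.integrable_of_hasCompactSupport hc).norm.const_mul (M.wt (k * R))).mono'
    ((M.measurable_wt_norm k).aestronglyMeasurable.mul hg.norm.aestronglyMeasurable)
    (Eventually.of_forall fun ξ => ?_)
  have := M.wt_pos (k * ‖ξ‖)
  rw [Real.norm_of_nonneg (by positivity)]
  by_cases h : ξ ∈ tsupport g
  · have := hR ξ h
    gcongr
    exact M.wt_mono (by positivity) (by gcongr)
  · rw [image_eq_zero_of_notMem_tsupport h]
    simp

/-- Band-limited approximate identities: `𝓕⁻ g · γ_{1/c}` belongs to `𝓢^{(1)}`. -/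
theorem fourierInv_mul_gaussian_mem_GS {g : E d → ℂ} (hg : Continuous g) (hc : HasCompactSupport g)
    {b : ℝ} (hb : 0 < b) : (fun x => 𝓕⁻ g x * gaussian b x) ∈ GS d := by
  have hg' : Continuous fun ξ => g (-ξ) := hg.comp continuous_neg
  have hc' : HasCompactSupport fun ξ => g (-ξ) := hc.comp_homeomorph (Homeomorph.neg (E d))
  have hi : ∀ n : ℕ, Integrable fun ξ => ‖ξ‖ ^ n * ‖g (-ξ)‖ := fun n =>
    ((continuous_norm.pow n).mul hg'.norm).integrable_of_hasCompactSupport hc'.norm.mul_left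
  obtain ⟨R, hR⟩ := hc'.isCompact.isBounded.exists_norm_le
  rw [Real.fourierInv_eq_fourier_comp_neg]
  refine GS.mul_mem (C := ∫ ξ, ‖g (-ξ)‖) (R := 2 * Real.pi * max R 0) (by positivity)
    (Real.contDiff_fourier fun n _ => hi n) (fun n x => ?_) (⟨_, gaussian_mem_GS hb⟩ : GS d)
  refine (norm_iteratedFDeriv_fourier_le hg'.aestronglyMeasurable hi n x).trans ?_
  rw [mul_pow (2 * Real.pi), mul_comm (∫ ξ, ‖g (-ξ)‖), mul_assoc, ← integral_const_mul (max R 0 ^ n)]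
  refine mul_le_mul_of_nonneg_left ?_ (by positivity : (0 : ℝ) ≤ (2 * Real.pi) ^ n)
  refine integral_mono (hi n) ((hg'.integrable_of_hasCompactSupport hc').norm.const_mul _) fun ξ => ?_
  by_cases h : ξ ∈ tsupport fun ξ => g (-ξ)
  · have := (hR ξ h).trans (le_max_left R 0)
    dsimp only
    gcongr
  · have h0 : g (-ξ) = 0 := image_eq_zero_of_notMem_tsupport (f := fun ξ => g (-ξ)) h
    simp [h0]

/-- Dominated convergence in `L^q`. -/
theorem tendsto_eLpNorm_zero_of_dominated {α : Type*} [MeasurableSpace α] {μ : Measure α} {q : ℝ≥0∞}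
    (hq0 : q ≠ 0) (hq : q ≠ ∞) {f : ℕ → α → ℂ} {b : α → ℝ} (hf : ∀ n, AEStronglyMeasurable (f n) μ)
    (hb : MemLp b q μ) (h : ∀ n, ∀ᵐ x ∂μ, ‖f n x‖ ≤ ‖b x‖)
    (hlim : ∀ᵐ x ∂μ, Tendsto (fun n => f n x) atTop (𝓝 0)) :
    Tendsto (fun n => eLpNorm (f n) q μ) atTop (𝓝 0) := by
  have hq1 : 0 < q.toReal := ENNReal.toReal_pos hq0 hq
  simp only [eLpNorm_eq_lintegral_rpow_enorm_toReal hq0 hq]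
  have h1 : Tendsto (fun n => ∫⁻ x, ‖f n x‖ₑ ^ q.toReal ∂μ) atTop (𝓝 (∫⁻ _, 0 ∂μ)) := by
    refine tendsto_lintegral_of_dominated_convergence' (fun x => ‖b x‖ₑ ^ q.toReal)
      (fun n => (hf n).enorm.pow_const _) (fun n => ?_)
      (lintegral_rpow_enorm_lt_top_of_eLpNorm_lt_top hq0 hq hb.2).ne ?_
    · filter_upwards [h n] with x hx
      gcongr
      exact enorm_le_iff_norm_le.2 hx
    · filter_upwards [hlim] with x hx
      have := (hx.enorm).ennrpow_const q.toReal
      simpa [ENNReal.zero_rpow_of_pos hq1] using this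
  rw [lintegral_zero] at h1
  have := h1.ennrpow_const (1 / q.toReal)
  rwa [ENNReal.zero_rpow_of_pos (by positivity)] at this

/-- `C_c` functions are approximated in `L^q_{(ω)}` by Fourier transforms of elements of `𝓢^{(1)}`, namely by
their convolutions with heat kernels. -/
theorem exists_GS_eLpNorm_fourier_sub_le {g : E d → ℂ} (hg : Continuous g) (hc : HasCompactSupport g)
    (ω : ModerateWeight M d) {q : ℝ≥0∞} (hq1 : 1 ≤ q) (hq : q ≠ ∞) {ε : ℝ≥0∞} (hε : ε ≠ 0) :
    ∃ f : GS d, eLpNorm (fun ξ => (𝓕 (f : E d → ℂ) ξ - g ξ) * (ω ξ : ℂ)) q ≤ ε := by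
  set f : ℕ → GS d := fun n => ⟨_, fourierInv_mul_gaussian_mem_GS hg hc (b := ((n + 1 : ℕ) : ℝ)⁻¹)
    (by positivity)⟩ with hf
  have hgi : Integrable g := hg.integrable_of_hasCompactSupport hc
  have hF : ∀ n ξ, 𝓕 (f n : E d → ℂ) ξ = ∫ w, g w * 𝓕 (gaussian (d := d) ((n + 1 : ℕ) : ℝ)⁻¹) (ξ - w) :=
    fun n ξ => fourier_fourierInv_mul hgi
      (GS.integrable ⟨_, gaussian_mem_GS (d := d) (b := ((n + 1 : ℕ) : ℝ)⁻¹) (by positivity)⟩) ξ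
  have hlim : ∀ ξ, Tendsto (fun n => 𝓕 (f n : E d → ℂ) ξ) atTop (𝓝 (g ξ)) := by
    intro ξ
    have h1 := (Real.tendsto_integral_gaussian_smul' hgi (hg.continuousAt (x := ξ))).comp
      (tendsto_natCast_atTop_atTop.comp (tendsto_add_atTop_nat 1))
    refine h1.congr fun n => ?_
    rw [hF]
    simp only [Function.comp_apply]
    congr 1
    ext w
    rw [fourier_gaussian_inv _ (by positivity), smul_eq_mul, mul_comm]
  obtain ⟨A, hA, K, hK, hAK⟩ := M.exists_wt_mul_wt_le zero_le_one zero_le_one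
  obtain ⟨D, hD, hDK⟩ := M.exists_wt_le_exp (ε := 1) one_pos
  obtain ⟨C, hC, hω⟩ := ω.exists_le_wt
  obtain ⟨B, hB⟩ := (hc.norm.mul_left (f := fun ξ => Real.exp (K * ‖ξ‖))).exists_bound_of_continuous
    (by fun_prop)
  have hB' : ∀ ξ, Real.exp (K * ‖ξ‖) * ‖g ξ‖ ≤ B := fun ξ => (le_abs_self _).trans (hB ξ)
  have hB0 : 0 ≤ B := (norm_nonneg _).trans (hB 0)
  set I : ℝ := Real.exp (K ^ 2 / (2 * Real.pi ^ 2)) * 2 ^ (Module.finrank ℝ (E d) / 2 : ℝ) with hI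
  have hI0 : 0 ≤ I := by positivity
  -- exponential decay of the convolutions, uniformly in `n`; exponentials dominate the weight
  have hbd : ∀ n ξ, Real.exp (K * ‖ξ‖) * ‖𝓕 (f n : E d → ℂ) ξ‖ ≤ B * I := by
    intro n ξ
    set G := 𝓕 (gaussian (d := d) ((n + 1 : ℕ) : ℝ)⁻¹) with hG
    obtain ⟨hi, hle⟩ := integral_exp_mul_norm_fourier_gaussian_le (d := d) (c := ((n + 1 : ℕ) : ℝ))
      (by push_cast; linarith [n.cast_nonneg (α := ℝ)]) K
    have hi' := hi.comp_sub_left ξ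
    rw [← integral_sub_left_eq_self _ volume ξ] at hle
    calc Real.exp (K * ‖ξ‖) * ‖𝓕 (f n : E d → ℂ) ξ‖
        ≤ Real.exp (K * ‖ξ‖) * ∫ w, ‖g w * G (ξ - w)‖ := by
          rw [hF]
          gcongr
          exact norm_integral_le_integral_norm _
      _ = ∫ w, Real.exp (K * ‖ξ‖) * ‖g w * G (ξ - w)‖ := (integral_const_mul _ _).symm
      _ ≤ ∫ w, B * (Real.exp (K * ‖ξ - w‖) * ‖G (ξ - w)‖) := by
          refine integral_mono_of_nonneg (Eventually.of_forall fun w => by positivity)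
            (hi'.const_mul B) (Eventually.of_forall fun w => ?_)
          dsimp only
          rw [norm_mul]
          have h1 : Real.exp (K * ‖ξ‖) ≤ Real.exp (K * ‖w‖) * Real.exp (K * ‖ξ - w‖) := by
            rw [← Real.exp_add, ← mul_add]
            have : ‖ξ‖ ≤ ‖w‖ + ‖ξ - w‖ := by
              calc ‖ξ‖ = ‖w + (ξ - w)‖ := by simp
                _ ≤ _ := norm_add_le _ _
            gcongr
          calc _ ≤ Real.exp (K * ‖w‖) * Real.exp (K * ‖ξ - w‖) * (‖g w‖ * ‖G (ξ - w)‖) := by gcongr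
            _ = (Real.exp (K * ‖w‖) * ‖g w‖) * (Real.exp (K * ‖ξ - w‖) * ‖G (ξ - w)‖) := by ring
            _ ≤ _ := by gcongr; exact hB' w
      _ ≤ B * I := by
          rw [integral_const_mul]
          gcongr
  have hm : ∀ n, AEStronglyMeasurable (fun ξ => (𝓕 (f n : E d → ℂ) ξ - g ξ) * (ω ξ : ℂ)) volume :=
    fun n => ((GS.rapid_fourier (M := M) (f n)).1.sub hg.aestronglyMeasurable).mul
      ω.aestronglyMeasurable_ofReal
  set b : E d → ℝ := fun ξ => (B * I + B) * (C * (A * D)) * (M.wt (1 * ‖ξ‖))⁻¹ with hb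
  have hbL : MemLp b q := by
    have h0 : MemLp (fun ξ : E d => (((M.wt (1 * ‖ξ‖))⁻¹ : ℝ) : ℂ)) q :=
      memLp_of_le_inv_wt (M := M) (k := 1) (C := 1) one_pos
        (Complex.measurable_ofReal.comp (M.measurable_wt_norm 1).inv).aestronglyMeasurable
        (fun ξ => by
          change ‖(((M.wt (1 * ‖ξ‖))⁻¹ : ℝ) : ℂ)‖ ≤ _
          rw [Complex.norm_real, Real.norm_of_nonneg (inv_nonneg.2 (M.wt_pos _).le)]
          exact (one_mul _).ge) hq1
    exact (h0.re).const_mul _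
  have hle : ∀ n, ∀ᵐ ξ, ‖(𝓕 (f n : E d → ℂ) ξ - g ξ) * (ω ξ : ℂ)‖ ≤ ‖b ξ‖ := by
    refine fun n => Eventually.of_forall fun ξ => ?_
    have hw := M.wt_pos (1 * ‖ξ‖)
    have hw' := M.wt_pos (‖ξ‖)
    have hb0 : 0 ≤ b ξ := by positivity
    rw [norm_mul, Complex.norm_real, Real.norm_of_nonneg (ω.pos ξ).le, Real.norm_of_nonneg hb0]
    simp only [hb]
    rw [← div_eq_mul_inv, le_div_iff₀ hw]
    have h1 : ‖𝓕 (f n : E d → ℂ) ξ - g ξ‖ * Real.exp (K * ‖ξ‖) ≤ B * I + B := by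
      calc _ ≤ (‖𝓕 (f n : E d → ℂ) ξ‖ + ‖g ξ‖) * Real.exp (K * ‖ξ‖) := by
            gcongr; exact norm_sub_le _ _
        _ ≤ _ := by linarith [hbd n ξ, hB' ξ]
    have h2 : M.wt (1 * ‖ξ‖) * M.wt (1 * ‖ξ‖) ≤ A * (D * Real.exp (K * ‖ξ‖)) := by
      refine (hAK _ (norm_nonneg ξ)).trans ?_
      have := hDK (K * ‖ξ‖) (by positivity)
      rw [one_mul] at this
      gcongr
    calc ‖𝓕 (f n : E d → ℂ) ξ - g ξ‖ * ω ξ * M.wt (1 * ‖ξ‖)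
        ≤ ‖𝓕 (f n : E d → ℂ) ξ - g ξ‖ * (C * M.wt (1 * ‖ξ‖)) * M.wt (1 * ‖ξ‖) := by
          gcongr
          have := (hω ξ).1
          rwa [one_mul]
      _ = ‖𝓕 (f n : E d → ℂ) ξ - g ξ‖ * C * (M.wt (1 * ‖ξ‖) * M.wt (1 * ‖ξ‖)) := by ring
      _ ≤ ‖𝓕 (f n : E d → ℂ) ξ - g ξ‖ * C * (A * (D * Real.exp (K * ‖ξ‖))) := by gcongr
      _ = (‖𝓕 (f n : E d → ℂ) ξ - g ξ‖ * Real.exp (K * ‖ξ‖)) * (C * (A * D)) := by ring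
      _ ≤ _ := by gcongr
  have := tendsto_eLpNorm_zero_of_dominated (by positivity) hq hm hbL hle (Eventually.of_forall fun ξ => by
    have := ((hlim ξ).sub_const (g ξ)).mul_const (ω ξ : ℂ)
    simpa using this)
  obtain ⟨n, hn⟩ := (this.eventually (ge_mem_nhds (pos_iff_ne_zero.2 hε))).exists
  exact ⟨f n, hn⟩

end Density

section DensityFL

variable {M : DefiningSequence} {d : ℕ}

/-- `C_c` is dense in the weighted space `L^q_{(ω)}`, `q < ∞`. -/
theorem exists_hasCompactSupport_eLpNorm_weight_sub_le (ω : ModerateWeight M d) {q : ℝ≥0∞} (hq1 : 1 ≤ q)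
    (hq : q ≠ ∞) {g : E d → ℂ} (hg : AEStronglyMeasurable g)
    (hL : eLpNorm (fun ξ => g ξ * (ω ξ : ℂ)) q < ∞) {ε : ℝ≥0∞} (hε : ε ≠ 0) :
    ∃ g₀ : E d → ℂ, Continuous g₀ ∧ HasCompactSupport g₀ ∧
      eLpNorm (fun ξ => (g ξ - g₀ ξ) * (ω ξ : ℂ)) q ≤ ε := by
  have hq0 : q ≠ 0 := (one_pos.trans_le hq1).ne'
  set W : E d → ℝ≥0∞ := fun ξ => ‖(ω ξ : ℂ)‖ₑ ^ q.toReal with hW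
  have hWm : AEMeasurable W := ω.aestronglyMeasurable_ofReal.enorm.pow_const _
  -- `L^q_{(ω)}` is the `L^q` space of a Radon measure, for which the density of `C_c` is known
  set μ : Measure (E d) := volume.withDensity W with hμ
  have key : ∀ f : E d → ℂ, AEStronglyMeasurable f → eLpNorm f q μ
      = eLpNorm (fun ξ => f ξ * (ω ξ : ℂ)) q := by
    intro f hf
    rw [eLpNorm_eq_lintegral_rpow_enorm_toReal hq0 hq, eLpNorm_eq_lintegral_rpow_enorm_toReal hq0 hq,
      hμ, lintegral_withDensity_eq_lintegral_mul₀ hWm (hf.enorm.pow_const _)]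
    congr 2
    ext ξ
    simp only [Pi.mul_apply, hW, enorm_mul]
    rw [ENNReal.mul_rpow_of_nonneg _ _ ENNReal.toReal_nonneg, mul_comm]
  have : IsFiniteMeasureOnCompacts μ := by
    refine ⟨fun K hK => ?_⟩
    obtain ⟨C, hC, hω⟩ := ω.exists_le_wt
    obtain ⟨R, hR⟩ := hK.isBounded.exists_norm_le
    rw [hμ, withDensity_apply _ hK.measurableSet]
    calc ∫⁻ ξ in K, W ξ ≤ ∫⁻ ξ in K, ENNReal.ofReal (C * M.wt R) ^ q.toReal := by
          refine setLIntegral_mono measurable_const fun ξ hξ => ?_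
          simp only [hW]
          gcongr
          rw [← ofReal_norm, Complex.norm_real, Real.norm_of_nonneg (ω.pos ξ).le]
          refine ENNReal.ofReal_le_ofReal ((hω ξ).1.trans ?_)
          gcongr
          exact M.wt_mono (norm_nonneg _) (hR ξ hξ)
      _ < ∞ := by
          rw [setLIntegral_const]
          exact ENNReal.mul_lt_top (ENNReal.rpow_lt_top_of_nonneg (by positivity) ENNReal.ofReal_ne_top)
            hK.measure_lt_top
  have hgμ : MemLp g q μ := ⟨hg.mono_ac (withDensity_absolutelyContinuous _ _), by rwa [key g hg]⟩
  obtain ⟨g₀, hc, hle, hcont, -⟩ := hgμ.exists_hasCompactSupport_eLpNorm_sub_le hq hε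
  refine ⟨g₀, hcont, hc, ?_⟩
  rw [key _ (hg.sub hcont.aestronglyMeasurable)] at hle
  exact hle

theorem FL.exists_hasFourier {q : ℝ≥0∞} [Fact (1 ≤ q)] {ω : ModerateWeight M d} (u : FL q ω) :
    ∃ g, HasFourier (u : GSDual d) g ∧ eLpNorm (fun ξ => g ξ * (ω ξ : ℂ)) q < ∞ := by
  obtain ⟨g, hg, h⟩ := exists_hasFourier_of_flSeminorm_lt_top u.2
  exact ⟨g, hg, by rwa [Measure.restrict_univ] at h⟩

theorem FL.norm_eq {q : ℝ≥0∞} [Fact (1 ≤ q)] {ω : ModerateWeight M d} {u : FL q ω} {g : E d → ℂ}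
    (h : HasFourier (u : GSDual d) g) : ‖u‖ = (eLpNorm (fun ξ => g ξ * (ω ξ : ℂ)) q).toReal := by
  change (flSeminorm q ω univ (u : GSDual d)).toReal = _
  rw [h.flSeminorm_eq, Measure.restrict_univ]

variable (M) in
/-- The embedding `𝓢^{(1)} → 𝓕L^q_{(ω)}`. -/
noncomputable def GS.toFL (q : ℝ≥0∞) [Fact (1 ≤ q)] (ω : ModerateWeight M d) (f : GS d) : FL q ω :=
  ⟨GS.toDual f, GS.toDual_mem_FL f q ω⟩

theorem GS.denseRange_toFL (q : ℝ≥0∞) [Fact (1 ≤ q)] (ω : ModerateWeight M d) (hq : q < ∞) :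
    DenseRange (GS.toFL M q ω) := by
  refine Metric.denseRange_iff.2 fun u ε hε => ?_
  obtain ⟨g, hg, h⟩ := FL.exists_hasFourier u
  have hε' : ENNReal.ofReal (ε / 3) ≠ 0 := by simpa using hε
  obtain ⟨g₀, hc, hcs, h1⟩ := exists_hasCompactSupport_eLpNorm_weight_sub_le ω Fact.out hq.ne hg.1 h hε'
  obtain ⟨f, h2⟩ := exists_GS_eLpNorm_fourier_sub_le hc hcs ω (q := q) Fact.out hq.ne hε'
  refine ⟨f, ?_⟩
  have hF := hasFourier_toDual M f
  have hs : HasFourier ((u - GS.toFL M q ω f : FL q ω) : GSDual d) (g - 𝓕 (f : E d → ℂ)) := by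
    have := hg.add (hF.smul (-1))
    rw [neg_one_smul ℂ (GS.toDual f), neg_one_smul ℂ (𝓕 (f : E d → ℂ)), ← sub_eq_add_neg,
      ← sub_eq_add_neg] at this
    exact this
  rw [dist_eq_norm, FL.norm_eq hs]
  have hle : eLpNorm (fun ξ => (g - 𝓕 (f : E d → ℂ)) ξ * (ω ξ : ℂ)) q
      ≤ ENNReal.ofReal (ε / 3) + ENNReal.ofReal (ε / 3) := by
    have e : (fun ξ => (g - 𝓕 (f : E d → ℂ)) ξ * (ω ξ : ℂ)) = (fun ξ => (g ξ - g₀ ξ) * (ω ξ : ℂ))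
        - fun ξ => (𝓕 (f : E d → ℂ) ξ - g₀ ξ) * (ω ξ : ℂ) := by
      ext ξ
      simp only [Pi.sub_apply]
      ring
    rw [e]
    exact (eLpNorm_sub_le ((hg.1.sub hc.aestronglyMeasurable).mul ω.aestronglyMeasurable_ofReal)
      ((hF.1.sub hc.aestronglyMeasurable).mul ω.aestronglyMeasurable_ofReal) Fact.out).trans
      (add_le_add h1 h2)
  rw [← ENNReal.ofReal_add (by positivity) (by positivity)] at hle
  calc _ ≤ (ENNReal.ofReal (ε / 3 + ε / 3)).toReal := ENNReal.toReal_mono ENNReal.ofReal_ne_top hle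
    _ = ε / 3 + ε / 3 := ENNReal.toReal_ofReal (by positivity)
    _ < ε := by linarith

instance (q : ℝ≥0∞) [Fact (1 ≤ q)] (ω : ModerateWeight M d) : NormedSpace ℂ (FL q ω) :=
  ⟨fun c u => ((FL.core q ω).norm_smul c u).le⟩

/-- The norm separates points, so that continuous maps into `𝓕L^q_{(ω)}` that agree on a dense set are equal. -/
instance (q : ℝ≥0∞) [Fact (1 ≤ q)] (ω : ModerateWeight M d) : T0Space (FL q ω) := by
  refine (t0Space_iff_inseparable _).2 fun u v huv => ?_
  rw [Metric.inseparable_iff, dist_eq_norm] at huv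
  obtain ⟨g, hg⟩ := FL.exists_hasFourier (u - v)
  rw [FL.norm_eq hg.1, ENNReal.toReal_eq_zero_iff] at huv
  have hm : AEStronglyMeasurable (fun ξ => g ξ * (ω ξ : ℂ)) volume :=
    hg.1.1.mul ω.aestronglyMeasurable_ofReal
  have h0 := (eLpNorm_eq_zero_iff hm (one_pos.trans_le (Fact.out : 1 ≤ q)).ne').1
    (huv.resolve_right hg.2.ne)
  have h1 : g =ᵐ[volume] 0 := by
    filter_upwards [h0] with ξ hξ
    have := (ω.pos ξ).ne'
    simpa [this] using hξ
  have := hg.1.congr HasFourier.zero h1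
  exact sub_eq_zero.1 (Subtype.ext this)

/-- Hölder's inequality for weighted spaces. -/
theorem eLpNorm_mul_weight_le {q q₁ q₂ : ℝ≥0∞} {ω ω₁ ω₂ : ModerateWeight M d} {C : ℝ}
    (hC : ∀ ξ, ω ξ ≤ C * (ω₁ ξ * ω₂ ξ)) (hq : 1 / q₁ + 1 / q₂ = 1 / q)
    {μ : Measure (E d)} (hμ : μ ≤ volume)
    {g₁ g₂ : E d → ℂ} (h₁ : AEStronglyMeasurable g₁) (h₂ : AEStronglyMeasurable g₂) :
    eLpNorm (fun ξ => g₁ ξ * g₂ ξ * (ω ξ : ℂ)) q μ ≤ ENNReal.ofReal C *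
      (eLpNorm (fun ξ => g₁ ξ * (ω₁ ξ : ℂ)) q₁ μ * eLpNorm (fun ξ => g₂ ξ * (ω₂ ξ : ℂ)) q₂ μ) := by
  have hH : ENNReal.HolderTriple q₁ q₂ q := ⟨by simpa only [one_div] using hq⟩
  have h1 : eLpNorm (fun ξ => g₁ ξ * g₂ ξ * (ω ξ : ℂ)) q μ
      ≤ ENNReal.ofReal C * eLpNorm ((fun ξ => g₁ ξ * (ω₁ ξ : ℂ)) • fun ξ => g₂ ξ * (ω₂ ξ : ℂ)) q μ := by
    refine eLpNorm_le_mul_eLpNorm_of_ae_le_mul (Eventually.of_forall fun ξ => ?_) q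
    simp only [norm_mul, Pi.smul_apply', smul_eq_mul, Complex.norm_real, Real.norm_of_nonneg (ω.pos ξ).le,
      Real.norm_of_nonneg (ω₁.pos ξ).le, Real.norm_of_nonneg (ω₂.pos ξ).le]
    calc _ ≤ ‖g₁ ξ‖ * ‖g₂ ξ‖ * (C * (ω₁ ξ * ω₂ ξ)) := by gcongr; exact hC ξ
      _ = _ := by ring
  refine h1.trans ?_
  gcongr
  exact eLpNorm_smul_le_mul_eLpNorm ((h₂.mul ω₂.aestronglyMeasurable_ofReal).mono_measure hμ)
    ((h₁.mul ω₁.aestronglyMeasurable_ofReal).mono_measure hμ)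

end DensityFL

/-! ### The convolution map on Fourier–Lebesgue spaces -/

section Mul

variable {M : DefiningSequence} {d : ℕ} {q q₁ q₂ : ℝ≥0∞} [Fact (1 ≤ q)] [Fact (1 ≤ q₁)] [Fact (1 ≤ q₂)]
  {ω ω₁ ω₂ : ModerateWeight M d}

/-- A product of Fourier transforms is, by Hölder's inequality, the Fourier transform of an element of `𝓕L^q_{(ω)}`,
which does not depend on the representatives. -/
theorem FL.exists_mul {C : ℝ} (hC : ∀ ξ, ω ξ ≤ C * (ω₁ ξ * ω₂ ξ)) (hq : 1 / q₁ + 1 / q₂ = 1 / q)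
    (u : FL q₁ ω₁) (v : FL q₂ ω₂) : ∃ w : FL q ω, ∀ g₁ g₂, HasFourier (u : GSDual d) g₁ →
      HasFourier (v : GSDual d) g₂ → HasFourier (w : GSDual d) (fun ξ => g₁ ξ * g₂ ξ) := by
  obtain ⟨g₁, h₁, l₁⟩ := FL.exists_hasFourier u
  obtain ⟨g₂, h₂, l₂⟩ := FL.exists_hasFourier v
  have hle := eLpNorm_mul_weight_le hC hq le_rfl h₁.1 h₂.1
  have hlt := hle.trans_lt (ENNReal.mul_lt_top ENNReal.ofReal_lt_top (ENNReal.mul_lt_top l₁ l₂))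
  have ht := UltraTempered.of_memLp (Fact.out : 1 ≤ q) ω (h₁.1.mul h₂.1) hlt
  have hF := ht.hasFourier
  refine ⟨⟨ht.toDual, ?_⟩, fun g₁' g₂' h₁' h₂' => ?_⟩
  · change flSeminorm q ω univ ht.toDual < ∞
    rw [hF.flSeminorm_eq, Measure.restrict_univ]
    exact hlt
  · have e : g₁ * g₂ =ᵐ[volume] fun ξ => g₁' ξ * g₂' ξ := by
      filter_upwards [h₁.ae_eq h₁', h₂.ae_eq h₂'] with ξ e1 e2
      simp [e1, e2]
    refine ⟨h₁'.1.mul h₂'.1, fun ψ => ?_⟩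
    have e' : (fun ξ => (g₁ * g₂) ξ * 𝓕⁻ (ψ : E d → ℂ) ξ)
        =ᵐ[volume] fun ξ => g₁' ξ * g₂' ξ * 𝓕⁻ (ψ : E d → ℂ) ξ := by
      filter_upwards [e] with ξ hξ
      rw [hξ]
    exact ⟨(hF.2 ψ).1.congr e', (hF.2 ψ).2.trans (integral_congr_ae e')⟩

/-- The convolution of Fourier–Lebesgue functionals: its Fourier transform is the product of the Fourier
transforms. -/
noncomputable def FL.mul {C : ℝ} (hC : ∀ ξ, ω ξ ≤ C * (ω₁ ξ * ω₂ ξ)) (hq : 1 / q₁ + 1 / q₂ = 1 / q)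
    (u : FL q₁ ω₁) (v : FL q₂ ω₂) : FL q ω := (FL.exists_mul hC hq u v).choose

theorem FL.hasFourier_mul {C : ℝ} (hC : ∀ ξ, ω ξ ≤ C * (ω₁ ξ * ω₂ ξ)) (hq : 1 / q₁ + 1 / q₂ = 1 / q)
    {u : FL q₁ ω₁} {v : FL q₂ ω₂} {g₁ g₂ : E d → ℂ} (h₁ : HasFourier (u : GSDual d) g₁)
    (h₂ : HasFourier (v : GSDual d) g₂) :
    HasFourier (FL.mul hC hq u v : GSDual d) (fun ξ => g₁ ξ * g₂ ξ) :=
  (FL.exists_mul hC hq u v).choose_spec g₁ g₂ h₁ h₂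

theorem FL.ext_of_hasFourier {u v : FL q ω} {g g' : E d → ℂ} (h : HasFourier (u : GSDual d) g)
    (h' : HasFourier (v : GSDual d) g') (e : ∀ ξ, g ξ = g' ξ) : u = v :=
  Subtype.ext (h.congr h' (Eventually.of_forall e))

theorem FL.norm_mul_le {C : ℝ} (hC : ∀ ξ, ω ξ ≤ C * (ω₁ ξ * ω₂ ξ)) (hq : 1 / q₁ + 1 / q₂ = 1 / q)
    (u : FL q₁ ω₁) (v : FL q₂ ω₂) : ‖FL.mul hC hq u v‖ ≤ |C| * ‖u‖ * ‖v‖ := by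
  obtain ⟨g₁, h₁, l₁⟩ := FL.exists_hasFourier u
  obtain ⟨g₂, h₂, l₂⟩ := FL.exists_hasFourier v
  rw [FL.norm_eq (FL.hasFourier_mul hC hq h₁ h₂), FL.norm_eq h₁, FL.norm_eq h₂]
  refine (ENNReal.toReal_mono (ENNReal.mul_lt_top ENNReal.ofReal_lt_top (ENNReal.mul_lt_top l₁ l₂)).ne
    (eLpNorm_mul_weight_le hC hq le_rfl h₁.1 h₂.1)).trans ?_
  rw [ENNReal.toReal_mul, ENNReal.toReal_mul, mul_assoc]
  gcongr
  rw [ENNReal.toReal_ofReal']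
  exact max_le (le_abs_self _) (abs_nonneg _)

/-- The bilinear map of `FL.mul`. -/
noncomputable def FL.mulₗ {C : ℝ} (hC : ∀ ξ, ω ξ ≤ C * (ω₁ ξ * ω₂ ξ)) (hq : 1 / q₁ + 1 / q₂ = 1 / q) :
    FL q₁ ω₁ →ₗ[ℂ] FL q₂ ω₂ →ₗ[ℂ] FL q ω :=
  LinearMap.mk₂ ℂ (FL.mul hC hq)
    (fun u u' v => by
      obtain ⟨g, h, -⟩ := FL.exists_hasFourier u
      obtain ⟨g', h', -⟩ := FL.exists_hasFourier u'
      obtain ⟨k, hk, -⟩ := FL.exists_hasFourier v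
      refine FL.ext_of_hasFourier (FL.hasFourier_mul hC hq (h.add h') hk)
        ((FL.hasFourier_mul hC hq h hk).add (FL.hasFourier_mul hC hq h' hk)) fun ξ => ?_
      simp [add_mul])
    (fun c u v => by
      obtain ⟨g, h, -⟩ := FL.exists_hasFourier u
      obtain ⟨k, hk, -⟩ := FL.exists_hasFourier v
      refine FL.ext_of_hasFourier (FL.hasFourier_mul hC hq (h.smul c) hk)
        ((FL.hasFourier_mul hC hq h hk).smul c) fun ξ => ?_
      simp [mul_assoc])
    (fun u v v' => by
      obtain ⟨g, h, -⟩ := FL.exists_hasFourier u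
      obtain ⟨k, hk, -⟩ := FL.exists_hasFourier v
      obtain ⟨k', hk', -⟩ := FL.exists_hasFourier v'
      refine FL.ext_of_hasFourier (FL.hasFourier_mul hC hq h (hk.add hk'))
        ((FL.hasFourier_mul hC hq h hk).add (FL.hasFourier_mul hC hq h hk')) fun ξ => ?_
      simp [mul_add])
    (fun c u v => by
      obtain ⟨g, h, -⟩ := FL.exists_hasFourier u
      obtain ⟨k, hk, -⟩ := FL.exists_hasFourier v
      refine FL.ext_of_hasFourier (FL.hasFourier_mul hC hq h (hk.smul c))
        ((FL.hasFourier_mul hC hq h hk).smul c) fun ξ => ?_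
      simp only [Pi.smul_apply, smul_eq_mul]
      ring)

theorem FL.continuous_mulₗ {C : ℝ} (hC : ∀ ξ, ω ξ ≤ C * (ω₁ ξ * ω₂ ξ)) (hq : 1 / q₁ + 1 / q₂ = 1 / q) :
    Continuous fun p : FL q₁ ω₁ × FL q₂ ω₂ => FL.mulₗ hC hq p.1 p.2 :=
  ((FL.mulₗ hC hq).mkContinuous₂ |C| (FL.norm_mul_le hC hq)).continuous₂

/-- A functional whose Fourier transform is `𝓕 f · g`, where `g` is the Fourier transform of `u`, is `f * u`. -/
theorem HasFourier.apply_eq_integral_convDual {u w : GSDual d} {g : E d → ℂ} {f : GS d}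
    (hu : HasFourier u g) (hw : HasFourier w fun ξ => 𝓕 (f : E d → ℂ) ξ * g ξ) (ψ : GS d) :
    w ψ = ∫ x, GS.convDual f u x * (ψ : E d → ℂ) x := by
  have hi : Integrable fun ξ => 𝓕 (f : E d → ℂ) ξ * g ξ := by
    have := (hu.2 (GS.reflTranslate 0 f)).1
    simpa [fourierInv_reflTranslate, mul_comm] using this
  have e : ∀ x, GS.convDual f u x = 𝓕⁻ (fun ξ => 𝓕 (f : E d → ℂ) ξ * g ξ) x := by
    intro x
    rw [GS.convDual, (hu.2 _).2, Real.fourierInv_eq]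
    congr 1
    ext ξ
    rw [fourierInv_reflTranslate, Circle.smul_def, smul_eq_mul, real_inner_comm]
    ring
  simp only [e]
  rw [integral_fourierInv_mul hi (GS.integrable ψ)]
  exact (hw.2 ψ).2

theorem FL.extendsConvLeft_mulₗ {C : ℝ} (hC : ∀ ξ, ω ξ ≤ C * (ω₁ ξ * ω₂ ξ))
    (hq : 1 / q₁ + 1 / q₂ = 1 / q) :
    ExtendsConvLeft fun p : FL q₁ ω₁ × FL q₂ ω₂ => FL.mulₗ hC hq p.1 p.2 := by
  refine fun f u => ⟨GS.toDual_mem_FL f q₁ ω₁, fun ψ => ?_⟩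
  obtain ⟨g, hg, -⟩ := FL.exists_hasFourier u
  exact hg.apply_eq_integral_convDual
    (FL.hasFourier_mul hC hq (u := GS.toFL M q₁ ω₁ f) (hasFourier_toDual M f) hg) ψ

theorem FL.extendsConvRight_mulₗ {C : ℝ} (hC : ∀ ξ, ω ξ ≤ C * (ω₁ ξ * ω₂ ξ))
    (hq : 1 / q₁ + 1 / q₂ = 1 / q) :
    ExtendsConvRight fun p : FL q₁ ω₁ × FL q₂ ω₂ => FL.mulₗ hC hq p.1 p.2 := by
  refine fun u f => ⟨GS.toDual_mem_FL f q₂ ω₂, fun ψ => ?_⟩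
  obtain ⟨g, hg, -⟩ := FL.exists_hasFourier u
  have h := FL.hasFourier_mul hC hq (v := GS.toFL M q₂ ω₂ f) hg (hasFourier_toDual M f)
  simp only [mul_comm (g _)] at h
  exact hg.apply_eq_integral_convDual h ψ

theorem FL.extendsConv_mulₗ {C : ℝ} (hC : ∀ ξ, ω ξ ≤ C * (ω₁ ξ * ω₂ ξ))
    (hq : 1 / q₁ + 1 / q₂ = 1 / q) :
    ExtendsConv fun p : FL q₁ ω₁ × FL q₂ ω₂ => FL.mulₗ hC hq p.1 p.2 := by
  refine fun f₁ f₂ => ⟨GS.toDual_mem_FL f₁ q₁ ω₁, GS.toDual_mem_FL f₂ q₂ ω₂, conv_mem_GS f₁ f₂, ?_⟩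
  refine HasFourier.congr (FL.hasFourier_mul hC hq (u := GS.toFL M q₁ ω₁ f₁) (v := GS.toFL M q₂ ω₂ f₂)
    (hasFourier_toDual M f₁) (hasFourier_toDual M f₂)) (hasFourier_toDual M _)
    (Eventually.of_forall fun ξ => ?_)
  exact (fourier_conv (GS.integrable f₁) (GS.integrable f₂) ξ).symm

theorem ExtendsConvLeft.eq {T T' : FL q₁ ω₁ × FL q₂ ω₂ → FL q ω} (hT : Continuous T) (hT' : Continuous T')
    (h : ExtendsConvLeft T) (h' : ExtendsConvLeft T') (hq₁ : q₁ < ∞) : T' = T := by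
  refine ((GS.denseRange_toFL q₁ ω₁ hq₁).prodMap denseRange_id).equalizer hT' hT (funext fun p => ?_)
  obtain ⟨_, e⟩ := h p.1 p.2
  obtain ⟨_, e'⟩ := h' p.1 p.2
  refine Subtype.ext (Subtype.ext (LinearMap.ext fun ψ => ?_))
  exact (e' ψ).trans (e ψ).symm

theorem ExtendsConvRight.eq {T T' : FL q₁ ω₁ × FL q₂ ω₂ → FL q ω} (hT : Continuous T) (hT' : Continuous T')
    (h : ExtendsConvRight T) (h' : ExtendsConvRight T') (hq₂ : q₂ < ∞) : T' = T := by
  refine (denseRange_id.prodMap (GS.denseRange_toFL q₂ ω₂ hq₂)).equalizer hT' hT (funext fun p => ?_)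
  obtain ⟨_, e⟩ := h p.1 p.2
  obtain ⟨_, e'⟩ := h' p.1 p.2
  refine Subtype.ext (Subtype.ext (LinearMap.ext fun ψ => ?_))
  exact (e' ψ).trans (e ψ).symm

theorem ExtendsConv.eq {T T' : FL q₁ ω₁ × FL q₂ ω₂ → FL q ω} (hT : Continuous T) (hT' : Continuous T')
    (h : ExtendsConv T) (h' : ExtendsConv T') (hq₁ : q₁ < ∞) (hq₂ : q₂ < ∞) : T' = T := by
  refine ((GS.denseRange_toFL q₁ ω₁ hq₁).prodMap (GS.denseRange_toFL q₂ ω₂ hq₂)).equalizer hT' hT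
    (funext fun p => ?_)
  obtain ⟨_, _, _, e⟩ := h p.1 p.2
  obtain ⟨_, _, _, e'⟩ := h' p.1 p.2
  exact Subtype.ext (e'.trans e.symm)

end Mul

/-! ### Compactly supported ultradifferentiable functions of one variable -/

/-- The mean value of `g` over `[x, x + a]`. -/
noncomputable def average (a : ℝ) (g : ℝ → ℝ) (x : ℝ) : ℝ := a⁻¹ * ∫ y in x..x + a, g y

section Average

variable {a : ℝ} {g g' : ℝ → ℝ}

theorem intervalIntegrable_comp_add_mul (hg : Continuous g) (x : ℝ) :
    IntervalIntegrable (fun t => g (x + a * t)) volume 0 1 :=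
  (hg.comp (by fun_prop : Continuous fun t => x + a * t)).intervalIntegrable 0 1

theorem average_eq (ha : 0 < a) (g : ℝ → ℝ) (x : ℝ) : average a g x = ∫ t in (0 : ℝ)..1, g (x + a * t) := by
  have := intervalIntegral.integral_comp_add_mul g (a := 0) (b := 1) ha.ne' x
  rw [this, average, smul_eq_mul]
  simp

theorem abs_average_sub_le (ha : 0 < a) (hg : Continuous g) (hg' : Continuous g') {C : ℝ}
    (h : ∀ x, |g x - g' x| ≤ C) (x : ℝ) : |average a g x - average a g' x| ≤ C := by
  rw [average_eq ha, average_eq ha, ← intervalIntegral.integral_sub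
    (intervalIntegrable_comp_add_mul hg x) (intervalIntegrable_comp_add_mul hg' x)]
  have := intervalIntegral.norm_integral_le_of_norm_le_const (a := 0) (b := 1)
    (f := fun t => g (x + a * t) - g' (x + a * t)) (C := C) fun t _ => h _
  simpa using this

theorem abs_average_sub_self_le (ha : 0 < a) (hg : LipschitzWith 1 g) (x : ℝ) :
    |average a g x - g x| ≤ a := by
  have h0 : g x = ∫ t in (0 : ℝ)..1, g x := by simp
  rw [average_eq ha, h0, ← intervalIntegral.integral_sub
    (intervalIntegrable_comp_add_mul hg.continuous x) intervalIntegrable_const]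
  have := intervalIntegral.norm_integral_le_of_norm_le_const (a := 0) (b := 1)
    (f := fun t => g (x + a * t) - g x) (C := a) fun t ht => by
      rw [uIoc_of_le zero_le_one] at ht
      have := hg.dist_le_mul (x + a * t) x
      rw [Real.dist_eq, Real.dist_eq, add_sub_cancel_left,
        abs_of_nonneg (mul_nonneg ha.le ht.1.le), NNReal.coe_one, one_mul] at this
      exact this.trans (mul_le_of_le_one_right ha.le ht.2)
  simpa using this

theorem lipschitzWith_average (ha : 0 < a) (hg : LipschitzWith 1 g) : LipschitzWith 1 (average a g) := by
  refine LipschitzWith.of_dist_le_mul fun x y => ?_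
  rw [Real.dist_eq, average_eq ha, average_eq ha, ← intervalIntegral.integral_sub
    (intervalIntegrable_comp_add_mul hg.continuous x) (intervalIntegrable_comp_add_mul hg.continuous y)]
  have := intervalIntegral.norm_integral_le_of_norm_le_const (a := 0) (b := 1)
    (f := fun t => g (x + a * t) - g (y + a * t)) (C := dist x y) fun t _ => by
      have := hg.dist_le_mul (x + a * t) (y + a * t)
      rwa [dist_add_right, NNReal.coe_one, one_mul, Real.dist_eq] at this
  simpa using this

theorem average_mem_Icc (ha : 0 < a) (hg : Continuous g) {C : ℝ} (h : ∀ x, g x ∈ Icc 0 C) (x : ℝ) :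
    average a g x ∈ Icc 0 C := by
  rw [average_eq ha]
  constructor
  · exact intervalIntegral.integral_nonneg zero_le_one fun t _ => (h _).1
  · have := intervalIntegral.integral_mono_on (μ := volume) zero_le_one
      (intervalIntegrable_comp_add_mul (a := a) hg x)
      (intervalIntegrable_const (c := C)) fun t _ => (h _).2
    simpa using this

theorem average_eq_zero (ha : 0 < a) {R : ℝ} (h : ∀ x, R ≤ |x| → g x = 0) {x : ℝ} (hx : a + R ≤ |x|) :
    average a g x = 0 := by
  rw [average_eq ha, intervalIntegral.integral_congr (g := fun _ => 0), intervalIntegral.integral_zero]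
  intro t ht
  rw [uIcc_of_le zero_le_one] at ht
  refine h _ ?_
  have h1 : |x| ≤ |x + a * t| + |a * t| := by
    calc |x| = |(x + a * t) - a * t| := by simp
      _ ≤ _ := abs_sub _ _
  rw [abs_of_nonneg (by have := ht.1; positivity : 0 ≤ a * t)] at h1
  have := mul_le_mul_of_nonneg_left ht.2 ha.le
  linarith

theorem hasDerivAt_average (hg : Continuous g) (x : ℝ) :
    HasDerivAt (average a g) (a⁻¹ * (g (x + a) - g x)) x := by
  have h1 : ∀ y, HasDerivAt (fun u => ∫ t in (0 : ℝ)..u, g t) (g y) y := fun y =>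
    intervalIntegral.integral_hasDerivAt_right (hg.intervalIntegrable _ _)
      hg.stronglyMeasurable.stronglyMeasurableAtFilter hg.continuousAt
  have h2 : average a g = fun x => a⁻¹ * ((∫ t in (0 : ℝ)..x + a, g t) - ∫ t in (0 : ℝ)..x, g t) := by
    ext y
    rw [average, intervalIntegral.integral_interval_sub_left (hg.intervalIntegrable _ _)
      (hg.intervalIntegrable _ _)]
  rw [h2]
  exact (((h1 (x + a)).comp_add_const x a).sub (h1 x)).const_mul _

end Average

section Iterate

variable (a : ℕ → ℝ) (δ : ℝ)

/-- The result of averaging the hat function `max 0 (δ - |x|)` successively over intervals of the lengths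
`a_{n+m-1}, …, a_n`. -/
noncomputable def iterAverage : ℕ → ℕ → ℝ → ℝ
  | _, 0 => fun x => max 0 (δ - |x|)
  | n, m + 1 => average (a n) (iterAverage (n + 1) m)

variable {a} {δ}

theorem lipschitzWith_iterAverage (ha : ∀ n, 0 < a n) (m n : ℕ) : LipschitzWith 1 (iterAverage a δ n m) := by
  induction m generalizing n with
  | zero =>
    refine LipschitzWith.of_dist_le_mul fun x y => ?_
    rw [NNReal.coe_one, one_mul, Real.dist_eq, Real.dist_eq]
    simp only [iterAverage, max_comm (0 : ℝ)]
    refine (abs_max_sub_max_le_abs _ _ 0).trans ?_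
    rw [sub_sub_sub_cancel_left, abs_sub_comm]
    exact abs_abs_sub_abs_le x y
  | succ m ih => exact lipschitzWith_average (ha n) (ih (n + 1))

theorem iterAverage_mem_Icc (ha : ∀ n, 0 < a n) (hδ : 0 < δ) (m n : ℕ) (x : ℝ) :
    iterAverage a δ n m x ∈ Icc 0 δ := by
  induction m generalizing n x with
  | zero => exact ⟨le_max_left _ _, max_le hδ.le (by linarith [abs_nonneg x])⟩
  | succ m ih =>
    exact average_mem_Icc (ha n) (lipschitzWith_iterAverage ha m (n + 1)).continuous (ih (n + 1)) x

theorem iterAverage_eq_zero (ha : ∀ n, 0 < a n) (m n : ℕ) {x : ℝ}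
    (hx : (∑ i ∈ Finset.range m, a (n + i)) + δ ≤ |x|) : iterAverage a δ n m x = 0 := by
  induction m generalizing n x with
  | zero =>
    refine max_eq_left ?_
    simp only [Finset.range_zero, Finset.sum_empty, zero_add] at hx
    linarith
  | succ m ih =>
    refine average_eq_zero (ha n) (R := (∑ i ∈ Finset.range m, a (n + 1 + i)) + δ) (fun y hy => ih (n + 1) hy) ?_
    rw [Finset.sum_range_succ'] at hx
    simp only [add_zero] at hx
    have e : ∀ i, n + 1 + i = n + (i + 1) := fun i => by omega
    simp only [e]
    linarith

theorem abs_iterAverage_succ_sub_le (ha : ∀ n, 0 < a n) (m n : ℕ) (x : ℝ) :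
    |iterAverage a δ n (m + 1) x - iterAverage a δ n m x| ≤ a (n + m) := by
  induction m generalizing n x with
  | zero => exact abs_average_sub_self_le (ha n) (lipschitzWith_iterAverage ha 0 (n + 1)) x
  | succ m ih =>
    have := abs_average_sub_le (ha n) (lipschitzWith_iterAverage ha (m + 1) (n + 1)).continuous
      (lipschitzWith_iterAverage ha m (n + 1)).continuous (ih (n + 1)) x
    rw [show n + (m + 1) = n + 1 + m by omega]
    exact this

/-- The limit of the successive averages. -/
noncomputable def limAverage (a : ℕ → ℝ) (δ : ℝ) (n : ℕ) (x : ℝ) : ℝ := limUnder atTop fun m => iterAverage a δ n m x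

theorem tendsto_iterAverage (ha : ∀ n, 0 < a n) (hs : Summable a) (n : ℕ) (x : ℝ) :
    Tendsto (fun m => iterAverage a δ n m x) atTop (𝓝 (limAverage a δ n x)) := by
  have hs' : Summable fun m => a (n + m) := hs.comp_injective (add_right_injective n)
  refine (cauchySeq_of_dist_le_of_summable _ (fun m => ?_) hs').tendsto_limUnder
  rw [dist_comm, Real.dist_eq]
  exact abs_iterAverage_succ_sub_le ha m n x

theorem abs_iterAverage_zero_sub_limAverage_le (ha : ∀ n, 0 < a n) (hs : Summable a) (x : ℝ) :
    |iterAverage a δ 0 0 x - limAverage a δ 0 x| ≤ ∑' i, a i := by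
  have hs' : Summable fun m => a (0 + m) := hs.comp_injective (add_right_injective 0)
  have := dist_le_tsum_of_dist_le_of_tendsto₀ (f := fun m => iterAverage a δ 0 m x) _ (fun m => by
    rw [dist_comm, Real.dist_eq]
    exact abs_iterAverage_succ_sub_le ha m 0 x) hs' (tendsto_iterAverage ha hs 0 x)
  simpa [Real.dist_eq] using this

theorem continuous_limAverage (ha : ∀ n, 0 < a n) (hs : Summable a) (n : ℕ) : Continuous (limAverage a δ n) := by
  have : LipschitzWith 1 (limAverage a δ n) := by
    refine LipschitzWith.of_dist_le_mul fun x y => ?_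
    refine le_of_tendsto ((tendsto_iterAverage ha hs n x).dist (tendsto_iterAverage ha hs n y))
      (Eventually.of_forall fun m => ?_)
    exact (lipschitzWith_iterAverage ha m n).dist_le_mul x y
  exact this.continuous

theorem limAverage_mem_Icc (ha : ∀ n, 0 < a n) (hs : Summable a) (hδ : 0 < δ) (n : ℕ) (x : ℝ) :
    limAverage a δ n x ∈ Icc 0 δ :=
  isClosed_Icc.mem_of_tendsto (tendsto_iterAverage ha hs n x)
    (Eventually.of_forall fun m => iterAverage_mem_Icc ha hδ m n x)

theorem limAverage_eq_average (ha : ∀ n, 0 < a n) (hs : Summable a) (hδ : 0 < δ) (n : ℕ) :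
    limAverage a δ n = average (a n) (limAverage a δ (n + 1)) := by
  ext x
  refine tendsto_nhds_unique ((tendsto_add_atTop_iff_nat 1).2 (tendsto_iterAverage ha hs n x)) ?_
  simp only [iterAverage, average_eq (ha n)]
  refine intervalIntegral.tendsto_integral_filter_of_dominated_convergence (fun _ => δ)
    (Eventually.of_forall fun m => ?_) (Eventually.of_forall fun m => Eventually.of_forall fun t _ => ?_)
    intervalIntegrable_const (Eventually.of_forall fun t _ => tendsto_iterAverage ha hs _ _)
  · exact ((lipschitzWith_iterAverage ha m (n + 1)).continuous.comp (by fun_prop)).aestronglyMeasurable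
  · have := iterAverage_mem_Icc ha hδ m (n + 1) (x + a n * t)
    rw [Real.norm_of_nonneg this.1]
    exact this.2

theorem deriv_limAverage (ha : ∀ n, 0 < a n) (hs : Summable a) (hδ : 0 < δ) (n : ℕ) (x : ℝ) :
    HasDerivAt (limAverage a δ n)
      ((a n)⁻¹ * (limAverage a δ (n + 1) (x + a n) - limAverage a δ (n + 1) x)) x := by
  have := hasDerivAt_average (a := a n) (continuous_limAverage (δ := δ) ha hs (n + 1)) x
  rwa [← limAverage_eq_average ha hs hδ] at this

/-- `limAverage a δ n` is an average over length `a n` of `limAverage a δ (n + 1)`, so that each derivative costs a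
factor `2 / a_i`, and the sup norm stays below `δ`. -/
theorem contDiff_limAverage (ha : ∀ n, 0 < a n) (hs : Summable a) (hδ : 0 < δ) (N n : ℕ) :
    ContDiff ℝ N (limAverage a δ n) ∧
      ∀ x, |iteratedDeriv N (limAverage a δ n) x| ≤ δ * ∏ i ∈ Finset.range N, 2 / a (n + i) := by
  induction N generalizing n with
  | zero =>
    refine ⟨contDiff_zero.2 (continuous_limAverage ha hs n), fun x => ?_⟩
    have := limAverage_mem_Icc ha hs hδ n x
    simpa [abs_of_nonneg this.1] using this.2
  | succ N ih =>
    have hd : deriv (limAverage a δ n)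
        = fun x => (a n)⁻¹ * (limAverage a δ (n + 1) (x + a n) - limAverage a δ (n + 1) x) :=
      funext fun x => (deriv_limAverage ha hs hδ n x).deriv
    obtain ⟨h1, h2⟩ := ih (n + 1)
    have h3 : ContDiff ℝ N fun x => limAverage a δ (n + 1) (x + a n) := h1.comp (by fun_prop)
    refine ⟨?_, fun x => ?_⟩
    · rw [show ((N + 1 : ℕ) : WithTop ℕ∞) = (N : WithTop ℕ∞) + 1 by push_cast; rfl,
        contDiff_succ_iff_deriv]
      refine ⟨fun x => (deriv_limAverage ha hs hδ n x).differentiableAt, by simp, ?_⟩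
      rw [hd]
      exact contDiff_const.mul (h3.sub h1)
    · rw [iteratedDeriv_succ', hd, iteratedDeriv_const_mul_field,
        iteratedDeriv_fun_sub h3.contDiffAt h1.contDiffAt, iteratedDeriv_comp_add_const]
      have han := ha n
      rw [abs_mul, abs_of_pos (inv_pos.2 han), Finset.prod_range_succ']
      have e : ∏ i ∈ Finset.range N, 2 / a (n + (i + 1)) = ∏ i ∈ Finset.range N, 2 / a (n + 1 + i) :=
        Finset.prod_congr rfl fun i _ => by rw [show n + (i + 1) = n + 1 + i by omega]
      rw [e, add_zero]
      have h4 := (abs_sub _ _).trans (add_le_add (h2 (x + a n)) (h2 x))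
      calc _ ≤ (a n)⁻¹ * _ := mul_le_mul_of_nonneg_left h4 (by positivity)
        _ = _ := by ring

end Iterate

/-- A convergent series remains convergent after multiplication by some factors that tend to infinity. The factors
are `T_n^{-1/2}` with the tails `T_n = ∑_{i ≥ n} r_i`, since `r_n T_n^{-1/2} ≤ 2 (T_n^{1/2} - T_{n+1}^{1/2})`
telescopes. -/
theorem exists_tendsto_atTop_summable_mul {r : ℕ → ℝ} (hr : ∀ n, 0 < r n) (hs : Summable r) :
    ∃ c : ℕ → ℝ, (∀ n, 0 < c n) ∧ Tendsto c atTop atTop ∧ Summable fun n => c n * r n := by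
  set T : ℕ → ℝ := fun n => ∑' i, r (i + n) with hT
  have hsn : ∀ n, Summable fun i => r (i + n) := fun n => (summable_nat_add_iff n).2 hs
  have hT0 : ∀ n, 0 < T n := fun n => (hsn n).tsum_pos (fun i => (hr _).le) 0 (hr _)
  have hTs : ∀ n, T n = r n + T (n + 1) := fun n => by
    have := (hsn n).tsum_eq_zero_add
    change ∑' i, r (i + n) = r n + ∑' i, r (i + (n + 1))
    rw [this, zero_add]
    simp only [add_right_comm _ 1 n, add_assoc]
  have hTl : Tendsto T atTop (𝓝 0) := tendsto_sum_nat_add r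
  refine ⟨fun n => (√(T n))⁻¹, fun n => inv_pos.2 (Real.sqrt_pos.2 (hT0 n)), ?_, ?_⟩
  · refine Tendsto.inv_tendsto_nhdsGT_zero (tendsto_nhdsWithin_iff.2 ⟨?_, Eventually.of_forall fun n =>
      Real.sqrt_pos.2 (hT0 n)⟩)
    have := (Real.continuous_sqrt.tendsto 0).comp hTl
    rwa [Real.sqrt_zero] at this
  · have key : ∀ n, (√(T n))⁻¹ * r n ≤ 2 * (√(T n) - √(T (n + 1))) := fun n => by
      have h1 := Real.sqrt_pos.2 (hT0 n)
      have h2 := Real.sqrt_pos.2 (hT0 (n + 1))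
      have h3 := Real.sq_sqrt (hT0 n).le
      have h4 := Real.sq_sqrt (hT0 (n + 1)).le
      have h5 : r n = √(T n) ^ 2 - √(T (n + 1)) ^ 2 := by rw [h3, h4, hTs n]; ring
      have h6 : √(T (n + 1)) ≤ √(T n) := Real.sqrt_le_sqrt (by rw [hTs n]; linarith [hr n])
      rw [h5, inv_mul_le_iff₀ h1]
      nlinarith
    refine summable_of_sum_range_le (c := 2 * √(T 0)) (fun n => ?_) fun n => ?_
    · have := Real.sqrt_pos.2 (hT0 n)
      have := hr n
      positivity
    · refine (Finset.sum_le_sum fun i _ => key i).trans ?_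
      rw [← Finset.mul_sum, Finset.sum_range_sub']
      have := Real.sqrt_nonneg (T n)
      linarith

theorem exists_prod_le_pow {b : ℕ → ℝ} (hb : ∀ n, 0 < b n) (h0 : Tendsto b atTop (𝓝 0)) {h : ℝ} (hh : 0 < h) :
    ∃ B, ∀ N, ∏ i ∈ Finset.range N, b i ≤ B * h ^ N := by
  obtain ⟨n₀, hn₀⟩ := eventually_atTop.1 (h0.eventually (ge_mem_nhds hh))
  set P : ℕ → ℝ := fun N => ∏ i ∈ Finset.range N, b i / h with hP
  have hP0 : ∀ N, 0 < P N := fun N => Finset.prod_pos fun i _ => div_pos (hb i) hh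
  have hanti : ∀ N, n₀ ≤ N → P (N + 1) ≤ P N := fun N hN => by
    simp only [hP, Finset.prod_range_succ]
    exact mul_le_of_le_one_right (hP0 N).le ((div_le_one hh).2 (hn₀ N hN))
  have hle : ∀ N, P N ≤ ∑ j ∈ Finset.range (n₀ + 1), P j := by
    intro N
    rcases le_or_gt N n₀ with hN | hN
    · exact Finset.single_le_sum (f := P) (fun j _ => (hP0 j).le) (Finset.mem_range.2 (by omega))
    · have : P N ≤ P n₀ := by
        induction N, hN.le using Nat.le_induction with
        | base => exact le_rfl
        | succ N hN' ih =>
          rcases hN'.eq_or_lt with rfl | h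
          · exact hanti _ le_rfl
          · exact (hanti N hN').trans (ih h)
      exact this.trans (Finset.single_le_sum (f := P) (fun j _ => (hP0 j).le) (Finset.mem_range.2 (by omega)))
  refine ⟨∑ j ∈ Finset.range (n₀ + 1), P j, fun N => ?_⟩
  have := hle N
  simp only [hP] at this ⊢
  rw [Finset.prod_div_distrib, Finset.prod_const, Finset.card_range, div_le_iff₀ (by positivity)] at this
  exact this

/-- The Denjoy–Carleman theorem: non-quasianalyticity yields compactly supported functions. -/
theorem DefiningSequence.exists_bump (M : DefiningSequence) {δ : ℝ} (hδ : 0 < δ) :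
    ∃ F : ℝ → ℝ, ContDiff ℝ (⊤ : ℕ∞) F ∧ (∀ x, 0 ≤ F x) ∧ 0 < F 0 ∧ (∀ x, 2 * δ ≤ |x| → F x = 0) ∧
      ∀ h > 0, ∃ B, ∀ (N : ℕ) (x : ℝ), |iteratedDeriv N F x| ≤ B * (h ^ N * M.seq N) := by
  set r : ℕ → ℝ := fun n => M.seq n / M.seq (n + 1) with hr
  have hr0 : ∀ n, 0 < r n := fun n => div_pos (M.pos _) (M.pos _)
  obtain ⟨c, hc0, hc, hcs⟩ := exists_tendsto_atTop_summable_mul hr0 M.nonQuasianalytic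
  set S : ℝ := ∑' n, c n * r n with hS
  have hS0 : 0 < S := hcs.tsum_pos (fun n => (mul_pos (hc0 n) (hr0 n)).le) 0 (mul_pos (hc0 0) (hr0 0))
  -- the averages are over lengths `a n = s c_n M_n / M_{n+1}` of total length `δ / 2`, so that the hat function of
  -- height `δ` is not destroyed; the factors `c_n → ∞` yield the bounds for every `h > 0`
  set s : ℝ := δ / (2 * S) with hs
  have hs0 : 0 < s := by positivity
  set a : ℕ → ℝ := fun n => s * (c n * r n) with ha
  have ha0 : ∀ n, 0 < a n := fun n => mul_pos hs0 (mul_pos (hc0 n) (hr0 n))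
  have has : Summable a := hcs.mul_left s
  have hasum : ∑' n, a n = δ / 2 := by
    rw [ha, tsum_mul_left, ← hS, hs]
    field_simp
  have hCD := contDiff_limAverage (δ := δ) ha0 has hδ
  refine ⟨limAverage a δ 0, contDiff_infty.2 fun N => (hCD N 0).1,
    fun x => (limAverage_mem_Icc ha0 has hδ 0 x).1, ?_, fun x hx => ?_, fun h hh => ?_⟩
  · have h1 := abs_iterAverage_zero_sub_limAverage_le (δ := δ) ha0 has 0
    rw [hasum] at h1
    have h2 : iterAverage a δ 0 0 0 = δ := by simp [iterAverage, hδ.le]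
    rw [h2] at h1
    have := (abs_le.1 h1).2
    linarith
  · refine tendsto_nhds_unique (tendsto_iterAverage ha0 has 0 x) ?_
    refine tendsto_const_nhds.congr fun m => (iterAverage_eq_zero ha0 m 0 ?_).symm
    have := has.sum_le_tsum (Finset.range m) fun i _ => (ha0 i).le
    simp only [zero_add]
    linarith
  · obtain ⟨B, hB⟩ := exists_prod_le_pow (b := fun n => 2 / s / c n)
      (fun n => div_pos (by positivity) (hc0 n)) (hc.const_div_atTop _) hh
    refine ⟨δ * B, fun N x => ((hCD N 0).2 x).trans ?_⟩
    have e : ∀ N, ∏ i ∈ Finset.range N, 2 / a (0 + i) = (∏ i ∈ Finset.range N, 2 / s / c i) * M.seq N := by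
      intro N
      induction N with
      | zero => simp [M.zero]
      | succ N ih =>
        rw [Finset.prod_range_succ, Finset.prod_range_succ, ih, zero_add]
        simp only [ha, hr]
        have := (M.pos N).ne'
        have := (M.pos (N + 1)).ne'
        have := (hc0 N).ne'
        field_simp
    rw [e, mul_assoc]
    have := (M.pos N).le
    have h1 := mul_le_mul_of_nonneg_right (hB N) this
    calc _ ≤ δ * (B * h ^ N * M.seq N) := by gcongr
      _ = _ := by ring

/-! ### Cut-off functions -/

section UltraDifferentiable

variable {M : DefiningSequence} {d : ℕ}

/-- Functions that are ultradifferentiable of class `(M_p)`, with uniform bounds on `ℝ^d`. -/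
def UD (M : DefiningSequence) (f : E d → ℂ) : Prop :=
  ContDiff ℝ (⊤ : ℕ∞) f ∧ ∀ h > 0, ∃ B, UDBound M f h B

theorem UD.mul {f g : E d → ℂ} (hf : UD M f) (hg : UD M g) : UD M fun x => f x * g x := by
  refine ⟨hf.1.mul hg.1, fun h hh => ?_⟩
  obtain ⟨B, hB⟩ := hf.2 (h / 2) (by positivity)
  obtain ⟨B', hB'⟩ := hg.2 (h / 2) (by positivity)
  have := hB.mul (by positivity) hf.1 hg.1 hB'
  rw [mul_div_cancel₀ _ (two_ne_zero)] at this
  exact ⟨_, this⟩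

theorem UD.const (c : ℂ) : UD M fun _ : E d => c := by
  refine ⟨contDiff_const, fun h hh => ⟨‖c‖, fun n x => ?_⟩⟩
  rcases n.eq_zero_or_pos with rfl | hn
  · simp [M.zero]
  · rw [iteratedFDeriv_const_of_ne hn.ne']
    have := M.pos n
    simp only [Pi.zero_apply, norm_zero]
    positivity

theorem UD.prod {ι : Type*} (s : Finset ι) {f : ι → E d → ℂ} (hf : ∀ i, UD M (f i)) :
    UD M fun x => ∏ i ∈ s, f i x := by
  classical
  induction s using Finset.induction_on with
  | empty => simpa using UD.const 1
  | insert i s hi ih =>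
    simp only [Finset.prod_insert hi]
    exact (hf i).mul ih

theorem TestFun.ud (φ : TestFun M d) : UD M (φ : E d → ℂ) := ⟨φ.2.1, φ.2.2.2⟩

theorem RapidL1.ud_fourier {a : E d → ℂ} (ha : RapidL1 M a) : UD M (𝓕 a) :=
  ⟨ha.contDiff_fourier, fun _ hh => ⟨_, ha.udBound_fourier hh⟩⟩

/-- The product of a test function and an ultradifferentiable function. -/
def TestFun.mulUD (φ : TestFun M d) {g : E d → ℂ} (hg : UD M g) : TestFun M d :=
  ⟨fun x => (φ : E d → ℂ) x * g x, ((TestFun.ud φ).mul hg).1, φ.2.2.1.mul_right, ((TestFun.ud φ).mul hg).2⟩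

@[simp] theorem TestFun.mulUD_apply (φ : TestFun M d) {g : E d → ℂ} (hg : UD M g) (x : E d) :
    (TestFun.mulUD φ hg : E d → ℂ) x = (φ : E d → ℂ) x * g x := rfl

theorem TestFun.tsupport_mulUD_subset (φ : TestFun M d) {g : E d → ℂ} (hg : UD M g) :
    tsupport (TestFun.mulUD φ hg : E d → ℂ) ⊆ tsupport (φ : E d → ℂ) := tsupport_mul_subset_left

theorem UD.comp_apply {F : ℝ → ℝ} (hF : ContDiff ℝ (⊤ : ℕ∞) F)
    (hB : ∀ h > 0, ∃ B, ∀ (N : ℕ) (x : ℝ), |iteratedDeriv N F x| ≤ B * (h ^ N * M.seq N)) (i : Fin d) :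
    UD M fun x : E d => (F (x i) : ℂ) := by
  set p : E d →L[ℝ] ℝ := EuclideanSpace.proj i with hp
  have hp1 : ‖p‖ ≤ 1 := by
    refine p.opNorm_le_bound zero_le_one fun x => ?_
    rw [one_mul]
    exact PiLp.norm_apply_le x i
  have hFp : ContDiff ℝ (⊤ : ℕ∞) (F ∘ p) := hF.comp p.contDiff
  refine ⟨Complex.ofRealCLM.contDiff.comp hFp, fun h hh => ?_⟩
  obtain ⟨B, H⟩ := hB h hh
  refine ⟨B, fun n x => ?_⟩
  have e1 := Complex.ofRealLI.norm_iteratedFDeriv_comp_left (f := F ∘ p) (x := x) (n := (⊤ : ℕ∞))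
    hFp.contDiffAt (i := n) (by exact_mod_cast le_top)
  have e2 : (fun x : E d => (F (x i) : ℂ)) = Complex.ofRealLI ∘ (F ∘ p) := rfl
  rw [e2, e1, p.iteratedFDeriv_comp_right hF x (i := n) (by exact_mod_cast le_top)]
  refine (ContinuousMultilinearMap.norm_compContinuousLinearMap_le _ _).trans ?_
  rw [norm_iteratedFDeriv_eq_norm_iteratedDeriv]
  refine (mul_le_of_le_one_right (norm_nonneg _) ?_).trans (H n _)
  exact Finset.prod_le_one (fun _ _ => norm_nonneg _) fun _ _ => hp1

/-- A non-negative test function supported in a small ball, as a product of functions of one variable. -/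
theorem exists_bump_ball (M : DefiningSequence) (d : ℕ) {ε : ℝ} (hε : 0 < ε) :
    ∃ φ : E d → ℝ, (fun x => (φ x : ℂ)) ∈ TestFun M d ∧ (∀ x, 0 ≤ φ x) ∧ 0 < φ 0 ∧
      ∀ x, ε ≤ ‖x‖ → φ x = 0 := by
  set η : ℝ := ε / (d + 1) with hη
  have hη0 : 0 < η := by positivity
  obtain ⟨F, hF, h0, hF0, hFs, hB⟩ := M.exists_bump (half_pos hη0)
  have hs : ∀ x : E d, ε ≤ ‖x‖ → ∏ i, F (x i) = 0 := by
    intro x hx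
    by_contra hne
    have h1 : ∀ i, |x i| < η := fun i => by
      by_contra! h
      exact hne (Finset.prod_eq_zero (Finset.mem_univ i) (hFs _ (by linarith)))
    refine absurd hx (not_le.2 ?_)
    rw [EuclideanSpace.norm_eq, Real.sqrt_lt' hε]
    calc ∑ i, ‖x i‖ ^ 2 ≤ ∑ _i : Fin d, η ^ 2 := by
          gcongr with i
          exact (h1 i).le
      _ = d * η ^ 2 := by simp
      _ < ε ^ 2 := by
          rw [hη, div_pow, ← mul_div_assoc, div_lt_iff₀ (by positivity)]
          have : (d : ℝ) < (d + 1) ^ 2 := by nlinarith [d.cast_nonneg (α := ℝ)]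
          have := pow_pos hε 2
          nlinarith
  have hud : UD M fun x : E d => ((∏ i, F (x i) : ℝ) : ℂ) := by
    have := UD.prod (M := M) Finset.univ (f := fun i (x : E d) => (F (x i) : ℂ))
      fun i => UD.comp_apply hF hB i
    simpa only [Complex.ofReal_prod] using this
  refine ⟨fun x => ∏ i, F (x i), ⟨hud.1, ?_, hud.2⟩, fun x => Finset.prod_nonneg fun i _ => h0 _,
    Finset.prod_pos fun i _ => by simpa using hF0, hs⟩
  refine HasCompactSupport.of_support_subset_isCompact (isCompact_closedBall (0 : E d) ε) fun x hx => ?_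
  rw [mem_closedBall_zero_iff]
  by_contra! h
  exact hx (by simp only [hs x h.le, Complex.ofReal_zero])

theorem UD.conv {f g : E d → ℂ} (hf : Integrable f) (hg : UD M g) : UD M (conv f g) := by
  have hb : ∀ n : ℕ, ∃ B, ∀ x, ‖iteratedFDeriv ℝ n g x‖ ≤ B := fun n => by
    obtain ⟨B, hB⟩ := hg.2 1 one_pos
    exact ⟨_, hB n⟩
  refine ⟨contDiff_conv hf hg.1 hb, fun h hh => ?_⟩
  obtain ⟨B, hB⟩ := hg.2 h hh
  refine ⟨(∫ t, ‖f t‖) * B, fun n x => (norm_iteratedFDeriv_conv_le hf hg.1 hb n x).trans ?_⟩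
  rw [mul_assoc, ← integral_mul_const]
  refine integral_mono_of_nonneg (Eventually.of_forall fun t => by positivity) (hf.norm.mul_const _)
    (Eventually.of_forall fun t => ?_)
  dsimp only
  gcongr
  exact hB n _

/-- Cut-off functions: mollify the indicator function of a neighbourhood of `K`. -/
theorem exists_cutoff (M : DefiningSequence) {d : ℕ} {K U : Set (E d)} (hK : IsCompact K) (hU : IsOpen U)
    (hKU : K ⊆ U) : ∃ χ : TestFun M d, tsupport (χ : E d → ℂ) ⊆ U ∧
      (∀ᶠ x in 𝓝ˢ K, (χ : E d → ℂ) x = 1) ∧ ∀ x, ‖(χ : E d → ℂ) x‖ ≤ 1 := by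
  obtain ⟨δ, hδ, hδU⟩ := hK.exists_cthickening_subset_open hU hKU
  set ε := δ / 3 with hε
  have hε0 : 0 < ε := by positivity
  obtain ⟨φ, hφ, hφ0, hφ1, hφs⟩ := exists_bump_ball M d hε0
  have hφc : Continuous φ := by
    have := Complex.continuous_re.comp hφ.1.continuous
    simpa [Function.comp_def] using this
  have hφi : Integrable φ := by
    have := (TestFun.integrable ⟨_, hφ⟩ : Integrable fun x => (φ x : ℂ)).re
    simpa using this
  have hI : 0 < ∫ x, φ x := by
    refine (integral_pos_iff_support_of_nonneg hφ0 hφi).2 ?_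
    exact (hφc.isOpen_support).measure_pos volume ⟨0, hφ1.ne'⟩
  set I := ∫ x, φ x with hIdef
  -- the mollifier has radius `ε`: the convolution is `1` on the `ε`-neighbourhood of `K`, and vanishes outside the
  -- `3 ε`-neighbourhood
  set L := Metric.cthickening (2 * ε) K with hL
  have hLc : IsCompact L := hK.cthickening
  set f : E d → ℂ := L.indicator fun _ => 1 with hf
  have hfi : Integrable f :=
    (integrable_indicator_iff hLc.measurableSet).2 (integrableOn_const hLc.measure_lt_top.ne)
  set g : E d → ℂ := fun x => ((I⁻¹ : ℝ) : ℂ) * (φ x : ℂ) with hg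
  have hgud : UD M g := (UD.const _).mul (TestFun.ud ⟨_, hφ⟩)
  have hgi : Integrable g := hφi.ofReal.const_mul _
  have hgI : ∫ x, g x = 1 := by
    rw [hg, integral_const_mul, integral_complex_ofReal, ← hIdef, ← Complex.ofReal_mul,
      inv_mul_cancel₀ hI.ne', Complex.ofReal_one]
  have hgn : ∫ x, ‖g x‖ = 1 := by
    have : ∀ x, ‖g x‖ = I⁻¹ * φ x := fun x => by
      rw [hg, norm_mul, Complex.norm_real, Complex.norm_real, Real.norm_of_nonneg (hφ0 x),
        Real.norm_of_nonneg (by positivity)]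
    simp only [this]
    rw [integral_const_mul, inv_mul_cancel₀ hI.ne']
  have hg0 : ∀ x, ε ≤ ‖x‖ → g x = 0 := fun x hx => by simp [hg, hφs x hx]
  have hud := UD.conv hfi hgud
  have hsupp : Function.support (conv f g) ⊆ Metric.cthickening δ K := by
    intro x hx
    have : ∃ t, f t * g (x - t) ≠ 0 := by
      by_contra! h
      exact hx (by simp [conv, h])
    obtain ⟨t, ht⟩ := this
    have h1 : t ∈ L := by
      by_contra h
      exact ht (by simp [hf, h])
    have h2 : ‖x - t‖ < ε := by
      by_contra! h
      exact ht (by simp [hg0 _ h])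
    rw [hL, hK.cthickening_eq_biUnion_closedBall (by positivity)] at h1
    obtain ⟨k, hk, hkt⟩ := mem_iUnion₂.1 h1
    refine Metric.mem_cthickening_of_dist_le x k δ K hk ?_
    rw [Metric.mem_closedBall] at hkt
    calc dist x k ≤ dist x t + dist t k := dist_triangle _ _ _
      _ ≤ ε + 2 * ε := by
          rw [dist_eq_norm x t]
          linarith
      _ = δ := by rw [hε]; ring
  have htsupp : tsupport (conv f g) ⊆ Metric.cthickening δ K :=
    closure_minimal hsupp Metric.isClosed_cthickening
  refine ⟨⟨conv f g, hud.1, HasCompactSupport.of_support_subset_isCompact hK.cthickening hsupp, hud.2⟩,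
    htsupp.trans hδU, ?_, fun x => ?_⟩
  · have hn : Metric.thickening ε K ∈ 𝓝ˢ K :=
      Metric.isOpen_thickening.mem_nhdsSet.2 (Metric.self_subset_thickening hε0 K)
    filter_upwards [hn] with x hx
    obtain ⟨k, hk, hxk⟩ := Metric.mem_thickening_iff.1 hx
    have e : ∀ t, f t * g (x - t) = g (x - t) := by
      intro t
      rcases le_or_gt ε ‖x - t‖ with h | h
      · rw [hg0 _ h, mul_zero]
      · have : t ∈ L := by
          refine Metric.mem_cthickening_of_dist_le t k _ K hk ?_
          calc dist t k ≤ dist t x + dist x k := dist_triangle _ _ _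
            _ ≤ 2 * ε := by
              rw [dist_comm t x, dist_eq_norm x t]
              linarith
        rw [hf, indicator_of_mem this, one_mul]
    simp only [conv, e]
    rw [integral_sub_left_eq_self g volume x, hgI]
  · simp only [conv]
    rw [← hgn, ← integral_sub_left_eq_self (fun t => ‖g t‖) volume x]
    refine norm_integral_le_of_norm_le (hgi.norm.comp_sub_left x) (Eventually.of_forall fun t => ?_)
    rw [norm_mul]
    refine mul_le_of_le_one_left (norm_nonneg _) ?_
    rw [hf]
    by_cases h : t ∈ L <;> simp [h]

end UltraDifferentiable

/-! ### Supports of ultradistributions -/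

section Support

variable {M : DefiningSequence} {d : ℕ}

theorem UDist.map_add (f : UDist M d) (φ ψ : TestFun M d) : f (φ + ψ) = f φ + f ψ := _root_.map_add f.1 φ ψ

theorem UDist.map_sub (f : UDist M d) (φ ψ : TestFun M d) : f (φ - ψ) = f φ - f ψ := _root_.map_sub f.1 φ ψ

theorem UDist.map_smul (f : UDist M d) (c : ℂ) (φ : TestFun M d) : f (c • φ) = c * f φ :=
  _root_.map_smul f.1 c φ

theorem UDist.map_zero (f : UDist M d) : f (0 : TestFun M d) = 0 := _root_.map_zero f.1

/-- The test function `(1 - χ) φ`. -/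
def TestFun.remove (χ φ : TestFun M d) : TestFun M d := φ - TestFun.mulUD φ (TestFun.ud χ)

theorem TestFun.remove_apply (χ φ : TestFun M d) (x : E d) :
    (TestFun.remove χ φ : E d → ℂ) x = (φ : E d → ℂ) x - (φ : E d → ℂ) x * (χ : E d → ℂ) x := rfl

theorem TestFun.mulUD_add_remove (χ φ : TestFun M d) :
    TestFun.mulUD φ (TestFun.ud χ) + TestFun.remove χ φ = φ := add_sub_cancel _ _

theorem TestFun.tsupport_remove_subset (χ φ : TestFun M d) {K : Set (E d)}
    (h : ∀ᶠ x in 𝓝ˢ K, (χ : E d → ℂ) x = 1) :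
    tsupport (TestFun.remove χ φ : E d → ℂ) ⊆ tsupport (φ : E d → ℂ) \ K := by
  intro x hx
  refine ⟨?_, fun hxK => ?_⟩
  · refine closure_mono (fun y hy => ?_) hx
    intro h0
    exact hy (by rw [TestFun.remove_apply, h0, zero_mul, sub_zero])
  · have h1 : ∀ᶠ y in 𝓝 x, (χ : E d → ℂ) y = 1 := eventually_nhdsSet_iff_forall.1 h x hxK
    refine notMem_tsupport_iff_eventuallyEq.2 ?_ hx
    filter_upwards [h1] with y hy
    rw [TestFun.remove_apply, hy, mul_one, sub_self, Pi.zero_apply]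

/-- Two-piece partitions of unity. -/
theorem TestFun.exists_split (φ : TestFun M d) {U V : Set (E d)} (hU : IsOpen U) (hV : IsOpen V)
    (h : tsupport (φ : E d → ℂ) ⊆ U ∪ V) : ∃ χ : TestFun M d, tsupport (χ : E d → ℂ) ⊆ U ∧
      tsupport (TestFun.remove χ φ : E d → ℂ) ⊆ V := by
  have hK : IsCompact (tsupport (φ : E d → ℂ) \ V) := φ.2.2.1.isCompact.diff hV
  obtain ⟨χ, h1, h2, -⟩ := exists_cutoff M hK hU fun x hx => (h hx.1).resolve_right hx.2
  refine ⟨χ, h1, fun x hx => ?_⟩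
  have := TestFun.tsupport_remove_subset χ φ h2 hx
  by_contra hxV
  exact this.2 ⟨this.1, hxV⟩

theorem UDist.isClosed_supp (f : UDist M d) : IsClosed (UDist.supp f) := by
  rw [← isOpen_compl_iff, isOpen_iff_mem_nhds]
  intro x hx
  simp only [UDist.supp, mem_compl_iff, mem_ofPred_eq, not_forall] at hx
  obtain ⟨U, hU, hxU, h⟩ := hx
  filter_upwards [hU.mem_nhds hxU] with y hy hy'
  exact h (hy' U hU hy)

/-- An ultradistribution vanishes off its support. By a partition of unity, the sets with a
neighbourhood on which it vanishes are stable under finite unions, and the support of `φ` is compact. -/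
theorem UDist.apply_eq_zero (f : UDist M d) {φ : TestFun M d}
    (h : Disjoint (tsupport (φ : E d → ℂ)) (UDist.supp f)) : f φ = 0 := by
  suffices H : ∃ U, IsOpen U ∧ tsupport (φ : E d → ℂ) ⊆ U ∧
      ∀ ψ : TestFun M d, tsupport (ψ : E d → ℂ) ⊆ U → f ψ = 0 by
    obtain ⟨U, -, hφ, H⟩ := H
    exact H φ hφ
  refine IsCompact.induction_on (p := fun S => ∃ U, IsOpen U ∧ S ⊆ U ∧
    ∀ ψ : TestFun M d, tsupport (ψ : E d → ℂ) ⊆ U → f ψ = 0) φ.2.2.1.isCompact ?_ ?_ ?_ ?_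
  · refine ⟨∅, isOpen_empty, subset_rfl, fun ψ hψ => ?_⟩
    have : ψ = 0 := by
      ext x
      by_contra hx
      exact hψ (subset_tsupport _ hx)
    rw [this]
    exact UDist.map_zero f
  · rintro S T hST ⟨U, hU, hTU, H⟩
    exact ⟨U, hU, hST.trans hTU, H⟩
  · rintro S T ⟨U, hU, hSU, H⟩ ⟨V, hV, hTV, H'⟩
    refine ⟨U ∪ V, hU.union hV, union_subset_union hSU hTV, fun ψ hψ => ?_⟩
    obtain ⟨χ, h1, h2⟩ := TestFun.exists_split ψ hU hV hψ
    have h3 := H (TestFun.mulUD ψ (TestFun.ud χ)) (tsupport_mul_subset_right.trans h1)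
    have h4 := H' _ h2
    rw [← TestFun.mulUD_add_remove χ ψ]
    exact (UDist.map_add f _ _).trans (by rw [h3, h4, add_zero])
  · intro x hx
    have hx' : x ∉ UDist.supp f := fun hx' => h.ne_of_mem hx hx' rfl
    simp only [UDist.supp, mem_ofPred_eq, not_forall] at hx'
    obtain ⟨U, hU, hxU, h'⟩ := hx'
    refine ⟨U, mem_nhdsWithin_of_mem_nhds (hU.mem_nhds hxU), U, hU, subset_rfl, fun ψ hψ => ?_⟩
    by_contra hne
    exact h' ⟨ψ, hψ, hne⟩

/-- Only the values of a test function near the support matter. -/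
theorem UDist.apply_congr (f : UDist M d) {φ φ' : TestFun M d}
    (h : ∀ x ∈ UDist.supp f, (φ : E d → ℂ) =ᶠ[𝓝 x] (φ' : E d → ℂ)) : f φ = f φ' := by
  rw [← sub_eq_zero, ← UDist.map_sub]
  refine UDist.apply_eq_zero f (disjoint_left.2 fun x hx hxs => ?_)
  refine notMem_tsupport_iff_eventuallyEq.2 ?_ hx
  filter_upwards [h x hxs] with y hy
  change (φ : E d → ℂ) y - (φ' : E d → ℂ) y = 0
  rw [hy, sub_self]

end Support

/-! ### Fourier transforms of localized ultradistributions -/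

section Riesz

variable {M : DefiningSequence} {d : ℕ}

theorem Rapid.exists_le_inv (ha : Rapid M (a : E d → ℂ)) {k : ℝ} (hk : 0 ≤ k) :
    ∃ C ≥ 0, ∀ ξ η, ‖a (ξ - η)‖ ≤ C * (M.wt (2 * k * ‖η‖) * (M.wt (k * ‖ξ‖))⁻¹) ∧
      ‖a (η - ξ)‖ ≤ C * (M.wt (2 * k * ‖η‖) * (M.wt (k * ‖ξ‖))⁻¹) := by
  obtain ⟨C, hC⟩ := ha.2 (2 * k) (by positivity)
  have hC0 : 0 ≤ C := (mul_nonneg (M.wt_pos _).le (norm_nonneg _)).trans (hC 0)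
  have key : ∀ ξ η ζ : E d, ‖ζ‖ = ‖ξ - η‖ → ‖a ζ‖ ≤ C * (M.wt (2 * k * ‖η‖) * (M.wt (k * ‖ξ‖))⁻¹) := by
    intro ξ η ζ hζ
    have h1 : M.wt (k * ‖ξ‖) ≤ M.wt (2 * k * ‖ζ‖) * M.wt (2 * k * ‖η‖) := by
      have h2 : k * ‖ξ‖ ≤ k * ‖ζ‖ + k * ‖η‖ := by
        rw [← mul_add, hζ]
        gcongr
        calc ‖ξ‖ = ‖(ξ - η) + η‖ := by simp
          _ ≤ _ := norm_add_le _ _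
      refine (M.wt_mono (by positivity) h2).trans ?_
      have := M.wt_add_le (ρ := k * ‖ζ‖) (σ := k * ‖η‖) (by positivity) (by positivity)
      rwa [← mul_assoc, ← mul_assoc] at this
    have hw := M.wt_pos (k * ‖ξ‖)
    rw [← mul_assoc, ← div_eq_mul_inv, le_div_iff₀ hw]
    calc ‖a ζ‖ * M.wt (k * ‖ξ‖) ≤ ‖a ζ‖ * (M.wt (2 * k * ‖ζ‖) * M.wt (2 * k * ‖η‖)) := by gcongr
      _ = (M.wt (2 * k * ‖ζ‖) * ‖a ζ‖) * M.wt (2 * k * ‖η‖) := by ring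
      _ ≤ _ := by
        have := M.wt_pos (2 * k * ‖η‖)
        gcongr
        exact hC ζ
  exact ⟨C, hC0, fun ξ η => ⟨key ξ η _ rfl, key ξ η _ (norm_sub_rev _ _)⟩⟩

theorem aestronglyMeasurable_mul_sub_prod {F a : E d → ℂ} (hF : AEStronglyMeasurable F)
    (ha : AEStronglyMeasurable a) :
    AEStronglyMeasurable (fun z : E d × E d => F z.2 * a (z.1 - z.2)) (volume.prod volume) :=
  hF.comp_snd.mul (ha.comp_quasiMeasurePreserving (quasiMeasurePreserving_sub volume volume))

theorem aestronglyMeasurable_conv {F a : E d → ℂ} (hF : AEStronglyMeasurable F)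
    (ha : AEStronglyMeasurable a) : AEStronglyMeasurable (conv F a) :=
  (aestronglyMeasurable_mul_sub_prod hF ha).integral_prod_right'

/-- Convolution with a rapidly decreasing function turns growth in the `L¹` sense into pointwise bounds. -/
theorem UltraTempered.exists_norm_conv_le {F a : E d → ℂ} (hF : UltraTempered M F) (ha : Rapid M a) :
    ∃ k ≥ 0, ∃ C ≥ 0, ∀ η, ‖conv F a η‖ ≤ C * M.wt (k * ‖η‖) := by
  obtain ⟨hm, k, hk, hi⟩ := hF
  obtain ⟨C, hC0, hC⟩ := ha.exists_le_inv hk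
  have hI : 0 ≤ ∫ ξ, ‖F ξ‖ * (M.wt (k * ‖ξ‖))⁻¹ := integral_nonneg fun ξ => by
    have := M.wt_pos (k * ‖ξ‖); positivity
  refine ⟨2 * k, by positivity, C * ∫ ξ, ‖F ξ‖ * (M.wt (k * ‖ξ‖))⁻¹, by positivity, fun η => ?_⟩
  have key : ∀ ξ, ‖F ξ * a (η - ξ)‖ ≤ C * M.wt (2 * k * ‖η‖) * (‖F ξ‖ * (M.wt (k * ‖ξ‖))⁻¹) := by
    intro ξ
    rw [norm_mul]
    calc _ ≤ ‖F ξ‖ * (C * (M.wt (2 * k * ‖η‖) * (M.wt (k * ‖ξ‖))⁻¹)) := by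
          gcongr; exact (hC ξ η).2
      _ = _ := by ring
  refine (norm_integral_le_of_norm_le (hi.const_mul _) (Eventually.of_forall key)).trans_eq ?_
  rw [integral_const_mul]
  ring

theorem Rapid.conv {p a : E d → ℂ} (hp : Rapid M p) (ha : RapidL1 M a) : Rapid M (conv p a) := by
  refine ⟨aestronglyMeasurable_conv hp.1 ha.1, fun k hk => ?_⟩
  obtain ⟨C, hC0, hC⟩ := hp.exists_le_inv hk
  refine ⟨C * ∫ η, M.wt (2 * k * ‖η‖) * ‖a η‖, fun ξ => ?_⟩
  have hw := M.wt_pos (k * ‖ξ‖)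
  rw [mul_comm, ← le_div_iff₀ hw, div_eq_mul_inv, UltraWF.conv,
    ← integral_sub_left_eq_self (fun t => p t * a (ξ - t)) volume ξ]
  simp only [sub_sub_cancel]
  have key : ∀ η, ‖p (ξ - η) * a η‖ ≤ C * (M.wt (k * ‖ξ‖))⁻¹ * (M.wt (2 * k * ‖η‖) * ‖a η‖) := by
    intro η
    rw [norm_mul]
    calc _ ≤ C * (M.wt (2 * k * ‖η‖) * (M.wt (k * ‖ξ‖))⁻¹) * ‖a η‖ := by
          gcongr; exact (hC ξ η).1
      _ = _ := by ring
  refine (norm_integral_le_of_norm_le ((ha.2 (2 * k) (by positivity)).const_mul _)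
    (Eventually.of_forall key)).trans_eq ?_
  rw [integral_const_mul]
  ring

/-- Fubini for the pairing of `F` with a convolution. -/
theorem UltraTempered.integral_mul_conv {F p a : E d → ℂ} (hF : UltraTempered M F) (hp : Rapid M p)
    (ha : RapidL1 M a) :
    ∫ ξ, F ξ * UltraWF.conv p a ξ = ∫ η, UltraWF.conv F (fun ζ => p (-ζ)) η * a η := by
  obtain ⟨hm, k, hk, hi⟩ := hF
  obtain ⟨C, hC0, hC⟩ := hp.exists_le_inv hk
  have e1 : ∀ ξ, F ξ * UltraWF.conv p a ξ = ∫ η, F ξ * (p (ξ - η) * a η) := fun ξ => by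
    rw [integral_const_mul, UltraWF.conv, ← integral_sub_left_eq_self (fun t => p t * a (ξ - t)) volume ξ]
    simp only [sub_sub_cancel]
  have e2 : ∀ η, UltraWF.conv F (fun ζ => p (-ζ)) η * a η = ∫ ξ, F ξ * (p (ξ - η) * a η) := fun η => by
    rw [UltraWF.conv, ← integral_mul_const]
    simp only [neg_sub, mul_assoc]
  simp only [e1, e2]
  refine integral_integral_swap ?_
  have hmeas : AEStronglyMeasurable (Function.uncurry fun ξ η : E d => F ξ * (p (ξ - η) * a η))
      (volume.prod volume) :=
    hm.comp_fst.mul ((hp.1.comp_quasiMeasurePreserving (quasiMeasurePreserving_sub volume volume)).mul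
      ha.1.comp_snd)
  refine ((hi.mul_prod (ha.2 (2 * k) (by positivity))).const_mul C).mono' hmeas
    (Eventually.of_forall fun z => ?_)
  simp only [Function.uncurry, norm_mul]
  calc _ ≤ ‖F z.1‖ * (C * (M.wt (2 * k * ‖z.2‖) * (M.wt (k * ‖z.1‖))⁻¹) * ‖a z.2‖) := by
        gcongr; exact (hC z.1 z.2).1
    _ = _ := by ring

end Riesz

section Riesz

variable {M : DefiningSequence} {d : ℕ}

theorem fourier_add {f g : E d → ℂ} (hf : Integrable f) (hg : Integrable g) :
    𝓕 (f + g) = 𝓕 f + 𝓕 g := by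
  ext ξ
  simp only [Real.fourier_eq, Pi.add_apply, smul_add]
  exact integral_add (integrable_char_smul hf ξ) (integrable_char_smul hg ξ)

theorem fourier_const_smul (c : ℂ) (f : E d → ℂ) : 𝓕 (c • f) = c • 𝓕 f := by
  ext ξ
  simp only [Real.fourier_eq, Pi.smul_apply, smul_comm _ c]
  exact integral_smul c _

theorem fourier_congr_ae {f g : E d → ℂ} (h : f =ᵐ[volume] g) : 𝓕 f = 𝓕 g := by
  ext ξ
  simp only [Real.fourier_eq]
  refine integral_congr_ae ?_
  filter_upwards [h] with x hx
  rw [hx]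

theorem RapidL1.add {a b : E d → ℂ} (ha : RapidL1 M a) (hb : RapidL1 M b) : RapidL1 M (a + b) := by
  refine ⟨ha.1.add hb.1, fun k hk => ((ha.2 k hk).add (hb.2 k hk)).mono'
    ((M.measurable_wt_norm k).aestronglyMeasurable.mul (ha.1.add hb.1).norm)
    (Eventually.of_forall fun ξ => ?_)⟩
  have := M.wt_pos (k * ‖ξ‖)
  rw [Real.norm_of_nonneg (by positivity), Pi.add_apply, Pi.add_apply, ← mul_add]
  gcongr
  exact norm_add_le _ _

theorem RapidL1.const_smul {a : E d → ℂ} (ha : RapidL1 M a) (c : ℂ) : RapidL1 M (c • a) := by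
  refine ⟨ha.1.const_smul c, fun k hk => ?_⟩
  have := (ha.2 k hk).const_mul ‖c‖
  refine this.congr (Eventually.of_forall fun ξ => ?_)
  simp only [Pi.smul_apply, norm_smul]
  ring

theorem RapidL1.congr {a b : E d → ℂ} (ha : RapidL1 M a) (h : a =ᵐ[volume] b) : RapidL1 M b := by
  refine ⟨ha.1.congr h, fun k hk => (ha.2 k hk).congr ?_⟩
  filter_upwards [h] with ξ hξ
  rw [hξ]

/-- Continuity of an ultradistribution, on test functions that are given by their Fourier transform. -/
theorem UDist.exists_norm_apply_fourier_le (f : UDist M d) (χ : TestFun M d) : ∃ k ≥ 0, ∃ C ≥ 0,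
    ∀ (a : E d → ℂ) (ha : RapidL1 M a),
      ‖f (TestFun.mulUD χ ha.ud_fourier)‖ ≤ C * ∫ ξ, M.wt (k * ‖ξ‖) * ‖a ξ‖ := by
  obtain ⟨h, hh, C, H⟩ := f.2 _ χ.2.2.1
  obtain ⟨B, hB⟩ := χ.2.2.2 (h / 2) (by positivity)
  have hpi := Real.pi_pos
  refine ⟨2 * Real.pi / (h / 2), by positivity, |C * B|, abs_nonneg _, fun a ha => ?_⟩
  have h1 := hB.mul (by positivity) χ.2.1 ha.contDiff_fourier (ha.udBound_fourier (half_pos hh))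
  rw [mul_div_cancel₀ _ (two_ne_zero)] at h1
  refine (H _ (TestFun.tsupport_mulUD_subset χ ha.ud_fourier) _ h1).trans ?_
  rw [← mul_assoc]
  refine mul_le_mul_of_nonneg_right (le_abs_self _) (integral_nonneg fun ξ => ?_)
  have := M.wt_pos (2 * Real.pi / (h / 2) * ‖ξ‖)
  positivity

theorem TestFun.mulUD_congr (χ : TestFun M d) {g g' : E d → ℂ} (hg : UD M g) (hg' : UD M g') (h : g = g') :
    TestFun.mulUD χ hg = TestFun.mulUD χ hg' := by
  subst h
  rfl

theorem TestFun.mulUD_fourier_add (χ : TestFun M d) {a b : E d → ℂ} (ha : RapidL1 M a) (hb : RapidL1 M b)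
    (hab : RapidL1 M (a + b)) : TestFun.mulUD χ hab.ud_fourier
      = TestFun.mulUD χ ha.ud_fourier + TestFun.mulUD χ hb.ud_fourier := by
  ext x
  simp only [TestFun.mulUD_apply, Submodule.coe_add, Pi.add_apply, fourier_add ha.integrable hb.integrable,
    mul_add]

theorem TestFun.mulUD_fourier_smul (χ : TestFun M d) {a : E d → ℂ} (ha : RapidL1 M a) (c : ℂ)
    (hca : RapidL1 M (c • a)) : TestFun.mulUD χ hca.ud_fourier = c • TestFun.mulUD χ ha.ud_fourier := by
  ext x
  simp only [TestFun.mulUD_apply, Submodule.coe_smul, Pi.smul_apply, fourier_const_smul, smul_eq_mul]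
  ring

theorem memLp_inv_wt (M : DefiningSequence) {k : ℝ} (hk : 0 < k) {q : ℝ≥0∞} (hq : 1 ≤ q) :
    MemLp (fun ξ : E d => (((M.wt (k * ‖ξ‖))⁻¹ : ℝ) : ℂ)) q := by
  refine memLp_of_le_inv_wt (M := M) (k := k) (C := 1) hk
    (Complex.measurable_ofReal.comp (M.measurable_wt_norm k).inv).aestronglyMeasurable (fun ξ => ?_) hq
  change ‖(((M.wt (k * ‖ξ‖))⁻¹ : ℝ) : ℂ)‖ ≤ _
  rw [Complex.norm_real, Real.norm_of_nonneg (inv_nonneg.2 (M.wt_pos _).le)]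
  exact (one_mul _).ge

variable (M d) in
/-- The functions `b` in `L²` for which `b e^{-M(K|ξ|)}` is rapidly decreasing in the `L¹` sense. -/
def rapidL2 (K : ℝ) : Submodule ℂ (Lp ℂ 2 (volume : Measure (E d))) where
  carrier := {b | RapidL1 M fun ξ => (((M.wt (K * ‖ξ‖))⁻¹ : ℝ) : ℂ) * b ξ}
  zero_mem' := by
    refine RapidL1.congr (a := 0) ⟨aestronglyMeasurable_const, fun k hk => by simp⟩ ?_
    filter_upwards [Lp.coeFn_zero ℂ 2 (volume : Measure (E d))] with ξ hξ
    rw [hξ]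
    simp
  add_mem' := fun {b b'} hb hb' => by
    refine RapidL1.congr (hb.add hb') ?_
    filter_upwards [Lp.coeFn_add b b'] with ξ hξ
    rw [hξ]
    simp [mul_add]
  smul_mem' := fun c b hb => by
    refine RapidL1.congr (hb.const_smul c) ?_
    filter_upwards [Lp.coeFn_smul c b] with ξ hξ
    rw [hξ]
    simp only [Pi.smul_apply, smul_eq_mul]
    ring

/-- For large `K` the functional `b ↦ ⟨f, χ 𝓕 (b e^{-M(K|ξ|)})⟩` is bounded in the `L²` norm, by the Cauchy–Schwarz
inequality. -/
theorem UDist.exists_norm_apply_rapidL2_le (f : UDist M d) (χ : TestFun M d) : ∃ K ≥ 1, ∃ C,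
    ∀ b : rapidL2 M d K, ‖f (TestFun.mulUD χ (RapidL1.ud_fourier b.2))‖ ≤ C * ‖b‖ := by
  obtain ⟨k, hk, C, hC, H⟩ := UDist.exists_norm_apply_fourier_le f χ
  obtain ⟨A, hA, K, hK, hAK⟩ := M.exists_wt_mul_wt_le hk zero_le_one
  have hw1 := memLp_inv_wt (d := d) M one_pos (q := 2) (by norm_num)
  set D : ℝ := (eLpNorm (fun ξ : E d => (((M.wt (1 * ‖ξ‖))⁻¹ : ℝ) : ℂ)) 2 volume).toReal with hD
  refine ⟨K, hK, C * A * D, fun b => ?_⟩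
  refine (H _ b.2).trans ?_
  rw [mul_assoc C, mul_assoc C]
  refine mul_le_mul_of_nonneg_left ?_ hC
  have hb := Lp.memLp (b : Lp ℂ 2 (volume : Measure (E d)))
  have hH : eLpNorm ((fun ξ : E d => (((M.wt (1 * ‖ξ‖))⁻¹ : ℝ) : ℂ)) •
      ((b : Lp ℂ 2 (volume : Measure (E d))) : E d → ℂ)) 1 volume ≤ _ :=
    eLpNorm_smul_le_mul_eLpNorm (p := 2) (q := 2) hb.1 hw1.1
  have hint : MemLp ((fun ξ : E d => (((M.wt (1 * ‖ξ‖))⁻¹ : ℝ) : ℂ)) •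
      ((b : Lp ℂ 2 (volume : Measure (E d))) : E d → ℂ)) 1 volume :=
    ⟨hw1.1.smul hb.1, hH.trans_lt (ENNReal.mul_lt_top hw1.2 hb.2)⟩
  have h1 := ENNReal.toReal_mono (ENNReal.mul_lt_top hw1.2 hb.2).ne hH
  rw [ENNReal.toReal_mul, eLpNorm_one_eq_lintegral_enorm,
    ← integral_norm_eq_lintegral_enorm hint.1] at h1
  have h2 : ∫ ξ, M.wt (k * ‖ξ‖) * ‖(((M.wt (K * ‖ξ‖))⁻¹ : ℝ) : ℂ) *
      (b : Lp ℂ 2 (volume : Measure (E d))) ξ‖ ≤ A * ∫ ξ, ‖((fun ξ : E d => (((M.wt (1 * ‖ξ‖))⁻¹ : ℝ) : ℂ)) •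
        ((b : Lp ℂ 2 (volume : Measure (E d))) : E d → ℂ)) ξ‖ := by
    rw [← integral_const_mul]
    refine integral_mono_of_nonneg (Eventually.of_forall fun ξ => ?_)
      ((memLp_one_iff_integrable.1 hint).norm.const_mul A) (Eventually.of_forall fun ξ => ?_)
    · have := M.wt_pos (k * ‖ξ‖)
      simp only [Pi.zero_apply]
      positivity
    · have h3 := M.wt_pos (K * ‖ξ‖)
      have h4 := M.wt_pos (1 * ‖ξ‖)
      have h5 := hAK ‖ξ‖ (norm_nonneg _)
      simp only [Pi.smul_apply', smul_eq_mul, norm_mul, Complex.norm_real, norm_inv,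
        Real.norm_of_nonneg h3.le, Real.norm_of_nonneg h4.le]
      rw [← mul_assoc, ← mul_assoc]
      refine mul_le_mul_of_nonneg_right ?_ (norm_nonneg _)
      rw [← div_eq_mul_inv, ← div_eq_mul_inv, div_le_div_iff₀ h3 h4]
      exact h5
  refine h2.trans ?_
  rw [mul_assoc]
  exact mul_le_mul_of_nonneg_left h1 (by linarith)

/-- A localized ultradistribution as a functional on a subspace of `L²`: `b ↦ ⟨f, χ 𝓕 (b e^{-M(K|ξ|)})⟩`. -/
noncomputable def UDist.rapidL2Functional (f : UDist M d) (χ : TestFun M d) (K : ℝ) :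
    rapidL2 M d K →ₗ[ℂ] ℂ :=
    { toFun := fun b => f (TestFun.mulUD χ (RapidL1.ud_fourier b.2))
      map_add' := fun b b' => by
        have h1 := RapidL1.add b.2 b'.2
        have h2 : TestFun.mulUD χ (RapidL1.ud_fourier (b + b').2) = TestFun.mulUD χ h1.ud_fourier := by
          refine TestFun.mulUD_congr _ _ _ (fourier_congr_ae ?_)
          filter_upwards [Lp.coeFn_add (b : Lp ℂ 2 (volume : Measure (E d))) b'] with ξ hξ
          rw [Submodule.coe_add, hξ]
          simp [mul_add]
        change f _ = f _ + f _
        rw [h2, TestFun.mulUD_fourier_add χ b.2 b'.2 h1]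
        exact UDist.map_add f _ _
      map_smul' := fun c b => by
        have h1 := RapidL1.const_smul b.2 c
        have h2 : TestFun.mulUD χ (RapidL1.ud_fourier (c • b).2) = TestFun.mulUD χ h1.ud_fourier := by
          refine TestFun.mulUD_congr _ _ _ (fourier_congr_ae ?_)
          filter_upwards [Lp.coeFn_smul c (b : Lp ℂ 2 (volume : Measure (E d)))] with ξ hξ
          rw [Submodule.coe_smul, hξ]
          simp only [Pi.smul_apply, smul_eq_mul]
          ring
        change f _ = c * f _
        rw [h2, TestFun.mulUD_fourier_smul χ b.2 c h1]
        exact UDist.map_smul f _ _ }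

/-- The Riesz representation of a localized ultradistribution. If `y ∈ L²` represents a norm-preserving extension
of `rapidL2Functional`, the density is `F = conj y · e^{M(K|ξ|)}`. -/
theorem UDist.exists_ultraTempered (f : UDist M d) (χ : TestFun M d) : ∃ F, UltraTempered M F ∧
    ∀ (a : E d → ℂ) (ha : Rapid M a), f (TestFun.mulUD χ ha.rapidL1.ud_fourier) = ∫ ξ, F ξ * a ξ := by
  obtain ⟨K, hK, C, hbound⟩ := UDist.exists_norm_apply_rapidL2_le f χ
  have hw1 := memLp_inv_wt (d := d) M one_pos (q := 2) (by norm_num)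
  obtain ⟨g, hg, -⟩ := exists_extension_norm_eq (rapidL2 M d K)
    ((UDist.rapidL2Functional f χ K).mkContinuous C hbound)
  set y := (InnerProductSpace.toDual ℂ (Lp ℂ 2 (volume : Measure (E d)))).symm g with hy
  have hyL := Lp.memLp y
  have hwm : Measurable fun ξ : E d => ((M.wt (K * ‖ξ‖) : ℝ) : ℂ) :=
    Complex.measurable_ofReal.comp (M.measurable_wt_norm K)
  obtain ⟨A', hA', K', hK', hAK'⟩ := M.exists_wt_mul_wt_le (k := K) (by linarith) zero_le_one
  refine ⟨fun ξ => (starRingEnd ℂ) (y ξ) * (M.wt (K * ‖ξ‖) : ℂ), ⟨?_, K', by linarith, ?_⟩, fun a ha => ?_⟩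
  · exact (Complex.continuous_conj.comp_aestronglyMeasurable hyL.1).mul hwm.aestronglyMeasurable
  · have h1 := (hyL.integrable_mul hw1).norm.const_mul A'
    refine h1.mono' ?_ (Eventually.of_forall fun ξ => ?_)
    · exact ((Complex.continuous_conj.comp_aestronglyMeasurable hyL.1).mul hwm.aestronglyMeasurable).norm.mul
        (M.measurable_wt_norm K').inv.aestronglyMeasurable
    · have h2 := M.wt_pos (K * ‖ξ‖)
      have h3 := M.wt_pos (K' * ‖ξ‖)
      have h4 := M.wt_pos (1 * ‖ξ‖)
      have h5 := hAK' ‖ξ‖ (norm_nonneg _)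
      rw [Real.norm_of_nonneg (by positivity)]
      simp only [Pi.mul_apply, norm_mul, Complex.norm_real, norm_inv, RCLike.norm_conj,
        Real.norm_of_nonneg h2.le, Real.norm_of_nonneg h4.le]
      rw [mul_assoc, mul_left_comm A']
      refine mul_le_mul_of_nonneg_left ?_ (norm_nonneg _)
      rw [← div_eq_mul_inv, ← div_eq_mul_inv, div_le_div_iff₀ h3 h4]
      exact h5
  · obtain ⟨B₂, hB₂⟩ := ha.2 K' (by linarith)
    have hbL : MemLp (fun ξ => ((M.wt (K * ‖ξ‖) : ℝ) : ℂ) * a ξ) 2 volume := by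
      refine memLp_of_le_inv_wt (M := M) (k := 1) (C := A' * B₂) one_pos
        (hwm.aestronglyMeasurable.mul ha.1) (fun ξ => ?_) (by norm_num)
      have h2 := M.wt_pos (K * ‖ξ‖)
      have h4 := M.wt_pos (1 * ‖ξ‖)
      rw [← div_eq_mul_inv, le_div_iff₀ h4, Pi.mul_apply, norm_mul, Complex.norm_real,
        Real.norm_of_nonneg h2.le]
      calc _ = (M.wt (K * ‖ξ‖) * M.wt (1 * ‖ξ‖)) * ‖a ξ‖ := by ring
        _ ≤ (A' * M.wt (K' * ‖ξ‖)) * ‖a ξ‖ :=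
          mul_le_mul_of_nonneg_right (hAK' _ (norm_nonneg ξ)) (norm_nonneg _)
        _ = A' * (M.wt (K' * ‖ξ‖) * ‖a ξ‖) := by ring
        _ ≤ _ := by gcongr; exact hB₂ ξ
    have hae : (fun ξ => (((M.wt (K * ‖ξ‖))⁻¹ : ℝ) : ℂ) * hbL.toLp _ ξ) =ᵐ[volume] a := by
      filter_upwards [hbL.coeFn_toLp] with ξ hξ
      have h2 := (M.wt_pos (K * ‖ξ‖)).ne'
      rw [hξ, ← mul_assoc, ← Complex.ofReal_mul, inv_mul_cancel₀ h2, Complex.ofReal_one, one_mul]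
    have hmem : hbL.toLp _ ∈ rapidL2 M d K := ha.rapidL1.congr hae.symm
    have h1 := hg ⟨_, hmem⟩
    have h2 : g (hbL.toLp _) = ∫ ξ, (starRingEnd ℂ) (y ξ) * (M.wt (K * ‖ξ‖) : ℂ) * a ξ := by
      rw [← InnerProductSpace.toDual_symm_apply, L2.inner_def]
      refine integral_congr_ae ?_
      filter_upwards [hbL.coeFn_toLp] with ξ hξ
      rw [hξ, RCLike.inner_apply]
      ring
    rw [← h2, h1]
    change f _ = f _
    congr 1
    exact TestFun.mulUD_congr _ _ _ (fourier_congr_ae hae.symm)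

/-- Functions that are bounded by a multiple of `e^{M(k|ξ|)}` for some `k`. -/
def UltraGrowth (M : DefiningSequence) (F : E d → ℂ) : Prop :=
  AEStronglyMeasurable F ∧ ∃ k ≥ 0, ∃ C ≥ 0, ∀ ξ, ‖F ξ‖ ≤ C * M.wt (k * ‖ξ‖)

theorem UltraGrowth.ultraTempered {F : E d → ℂ} (hF : UltraGrowth M F) : UltraTempered M F := by
  obtain ⟨hm, k, hk, C, hC, H⟩ := hF
  obtain ⟨A, hA, K, hK, hAK⟩ := M.exists_wt_mul_wt_le hk zero_le_one
  refine ⟨hm, K, by linarith, ((M.integrable_inv_wt (d := d) one_pos).const_mul (C * A)).mono'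
    (hm.norm.mul (M.measurable_wt_norm K).inv.aestronglyMeasurable) (Eventually.of_forall fun ξ => ?_)⟩
  have h3 := M.wt_pos (K * ‖ξ‖)
  have h4 := M.wt_pos (1 * ‖ξ‖)
  have h5 := hAK ‖ξ‖ (norm_nonneg _)
  rw [Real.norm_of_nonneg (by positivity), ← div_eq_mul_inv, ← div_eq_mul_inv, div_le_div_iff₀ h3 h4]
  calc ‖F ξ‖ * M.wt (1 * ‖ξ‖) ≤ (C * M.wt (k * ‖ξ‖)) * M.wt (1 * ‖ξ‖) := by gcongr; exact H ξ
    _ = C * (M.wt (k * ‖ξ‖) * M.wt (1 * ‖ξ‖)) := by ring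
    _ ≤ C * (A * M.wt (K * ‖ξ‖)) := by gcongr
    _ = _ := by ring

/-- `F` is the Fourier transform of `χ f`. -/
def IsFourierOf (f : UDist M d) (χ : TestFun M d) (F : E d → ℂ) : Prop :=
  ∀ (a : E d → ℂ) (ha : Rapid M a), f (TestFun.mulUD χ ha.rapidL1.ud_fourier) = ∫ ξ, F ξ * a ξ

/-- Multiplication by `φ` corresponds to convolution by `𝓕 φ` on the Fourier side. -/
theorem IsFourierOf.mul {f : UDist M d} {χ : TestFun M d} {F : E d → ℂ} (hF : UltraTempered M F)
    (h : IsFourierOf f χ F) (φ : TestFun M d) :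
    UltraGrowth M (conv F (𝓕 (φ : E d → ℂ))) ∧
      ∀ (a : E d → ℂ) (ha : RapidL1 M a), f (TestFun.mulUD (TestFun.mulUD χ (TestFun.ud φ)) ha.ud_fourier)
        = ∫ ξ, conv F (𝓕 (φ : E d → ℂ)) ξ * a ξ := by
  have hφ := TestFun.rapid_fourier φ
  have hφ' := TestFun.rapid_fourierInv φ
  refine ⟨⟨aestronglyMeasurable_conv hF.1 hφ.1, hF.exists_norm_conv_le hφ⟩, fun a ha => ?_⟩
  have e : (𝓕 (φ : E d → ℂ)) = fun ζ => 𝓕⁻ (φ : E d → ℂ) (-ζ) := by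
    ext ζ
    rw [Real.fourierInv_eq_fourier_neg, neg_neg]
  rw [e, ← hF.integral_mul_conv hφ' ha, ← h _ (hφ'.conv ha)]
  congr 1
  ext x
  simp only [TestFun.mulUD_apply]
  rw [fourier_conv hφ'.integrable ha.integrable, TestFun.fourier_fourierInv φ, mul_assoc]

/-- The Fourier transform of `χ f` is a function with pointwise bounds: if `χ' = 1` near the support of `χ`, it is
the convolution of the density for `χ' f` with `𝓕 χ`. -/
theorem UDist.exists_isFourierOf (f : UDist M d) (χ : TestFun M d) : ∃ F, UltraGrowth M F ∧
    ∀ (a : E d → ℂ) (ha : RapidL1 M a), f (TestFun.mulUD χ ha.ud_fourier) = ∫ ξ, F ξ * a ξ := by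
  obtain ⟨χ', -, h1, -⟩ := exists_cutoff M χ.2.2.1.isCompact isOpen_univ (subset_univ _)
  obtain ⟨F, hF, h⟩ := UDist.exists_ultraTempered f χ'
  obtain ⟨h2, h3⟩ := IsFourierOf.mul hF h χ
  refine ⟨_, h2, fun a ha => ?_⟩
  rw [← h3 a ha]
  congr 1
  ext x
  simp only [TestFun.mulUD_apply]
  by_cases hx : x ∈ tsupport (χ : E d → ℂ)
  · rw [(eventually_nhdsSet_iff_forall.1 h1 x hx).self_of_nhds, one_mul]
  · rw [image_eq_zero_of_notMem_tsupport hx, mul_zero]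

end Riesz

/-! ### Division by test functions -/

section Division

variable {M : DefiningSequence} {d : ℕ}

theorem fourier_char_smul (b : E d → ℂ) (ξ t : E d) :
    𝓕 (fun x => Real.fourierChar (inner ℝ x ξ) • b x) t = 𝓕⁻ b (ξ - t) := by
  rw [Real.fourierInv_eq, Real.fourier_eq]
  congr 1
  ext x
  rw [smul_smul, ← AddChar.map_add_eq_mul, inner_sub_right]
  congr 2
  ring

theorem fourierInv_fourier_mul {a b : E d → ℂ} (ha : Integrable a) (hb : Integrable b) (ξ : E d) :
    𝓕⁻ (fun x => 𝓕 a x * b x) ξ = conv a (𝓕⁻ b) ξ := by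
  have hc : Integrable fun x => Real.fourierChar (inner ℝ x ξ) • b x := by
    have := (Real.fourierIntegral_convergent_iff (-ξ)).2 hb
    simpa using this
  have h := integral_fourier_mul ha hc
  simp only [fourier_char_smul] at h
  rw [conv, ← h, Real.fourierInv_eq]
  congr 1
  ext x
  simp only [Circle.smul_def, smul_eq_mul]
  ring

theorem Submultiplicative.exists_wt_le (h : Submultiplicative (M.expWeight (d := d))) : ∃ C ≥ 1, ∀ k ≥ 0,
    ∀ ξ η : E d, M.wt (k * ‖ξ‖) ≤ C * (M.wt (k * ‖η‖) * M.wt (k * ‖ξ - η‖)) := by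
  obtain ⟨C, hC⟩ := h
  refine ⟨max C 1, le_max_right _ _, fun k hk ξ η => ?_⟩
  have h1 := hC (k • η) (k • (ξ - η))
  rw [← smul_add, add_sub_cancel] at h1
  change M.wt ‖k • ξ‖ ≤ C * (M.wt ‖k • η‖ * M.wt ‖k • (ξ - η)‖) at h1
  simp only [norm_smul, Real.norm_of_nonneg hk] at h1
  refine h1.trans (mul_le_mul_of_nonneg_right (le_max_left _ _) ?_)
  exact mul_nonneg (M.wt_pos _).le (M.wt_pos _).le

/-- Convolution in the Beurling algebra of a submultiplicative weight. -/
theorem wt_mul_norm_conv_le {C k : ℝ} (hC : 0 ≤ C)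
    (hs : ∀ ξ η : E d, M.wt (k * ‖ξ‖) ≤ C * (M.wt (k * ‖η‖) * M.wt (k * ‖ξ - η‖)))
    {a b : E d → ℂ} (ha : Integrable fun ξ => M.wt (k * ‖ξ‖) * ‖a ξ‖) {B : ℝ}
    (hb : ∀ ξ, M.wt (k * ‖ξ‖) * ‖b ξ‖ ≤ B) (ξ : E d) :
    M.wt (k * ‖ξ‖) * ‖conv a b ξ‖ ≤ C * (∫ ξ, M.wt (k * ‖ξ‖) * ‖a ξ‖) * B := by
  have hw := M.wt_pos (k * ‖ξ‖)
  rw [mul_comm, ← le_div_iff₀ hw]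
  have key : ∀ t, ‖a t * b (ξ - t)‖ ≤ C * B / M.wt (k * ‖ξ‖) * (M.wt (k * ‖t‖) * ‖a t‖) := by
    intro t
    have h1 := M.wt_pos (k * ‖t‖)
    rw [norm_mul, div_mul_eq_mul_div, le_div_iff₀ hw]
    calc ‖a t‖ * ‖b (ξ - t)‖ * M.wt (k * ‖ξ‖)
        ≤ ‖a t‖ * ‖b (ξ - t)‖ * (C * (M.wt (k * ‖t‖) * M.wt (k * ‖ξ - t‖))) := by gcongr; exact hs ξ t
      _ = C * (M.wt (k * ‖t‖) * ‖a t‖) * (M.wt (k * ‖ξ - t‖) * ‖b (ξ - t)‖) := by ring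
      _ ≤ C * (M.wt (k * ‖t‖) * ‖a t‖) * B := by gcongr; exact hb _
      _ = _ := by ring
  refine (norm_integral_le_of_norm_le (ha.const_mul _) (Eventually.of_forall key)).trans_eq ?_
  rw [integral_const_mul]
  ring

/-- A band-limited function `p = 𝓕 a` in `L¹`: the inverse Fourier transform of `p ^ (m + 1)` is supported
in the ball of radius `(m + 1) R` and bounded by `‖p‖_∞ ^ m ‖p‖₁`. -/
theorem fourierInv_pow_of_bandLimited {a : E d → ℂ} (ha : Continuous a) {R : ℝ}
    (hs : ∀ ξ, R < ‖ξ‖ → a ξ = 0) (hp : Integrable (𝓕 a)) {B : ℝ} (hB : ∀ x, ‖𝓕 a x‖ ≤ B) (m : ℕ) :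
    Integrable (fun x => 𝓕 a x ^ (m + 1)) ∧
      (∀ ξ, (m + 1) * R < ‖ξ‖ → 𝓕⁻ (fun x => 𝓕 a x ^ (m + 1)) ξ = 0) ∧
      ∀ ξ, ‖𝓕⁻ (fun x => 𝓕 a x ^ (m + 1)) ξ‖ ≤ B ^ m * ∫ x, ‖𝓕 a x‖ := by
  have hac : HasCompactSupport a :=
    HasCompactSupport.of_support_subset_isCompact (isCompact_closedBall 0 R) fun ξ hξ => by
      rw [mem_closedBall_zero_iff]
      by_contra! h
      exact hξ (hs ξ h)
  have hai : Integrable a := ha.integrable_of_hasCompactSupport hac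
  have hpc : Continuous (𝓕 a) := continuous_fourier hai
  have hB0 : 0 ≤ B := (norm_nonneg _).trans (hB 0)
  have hle : ∀ x, ‖𝓕 a x ^ (m + 1)‖ ≤ B ^ m * ‖𝓕 a x‖ := fun x => by
    rw [norm_pow, pow_succ]
    gcongr
    exact hB x
  have hint : ∀ m : ℕ, Integrable fun x => 𝓕 a x ^ (m + 1) := fun m => by
    refine (hp.norm.const_mul (B ^ m)).mono' (hpc.pow _).aestronglyMeasurable
      (Eventually.of_forall fun x => ?_)
    rw [norm_pow, pow_succ]
    gcongr
    exact hB x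
  refine ⟨hint m, ?_, fun ξ => ?_⟩
  · clear hle
    induction m with
    | zero =>
      intro ξ hξ
      simp only [zero_add, pow_one]
      rw [ha.fourierInv_fourier_eq hai hp]
      exact hs ξ (by simpa using hξ)
    | succ m ih =>
      intro ξ hξ
      have e : (fun x => 𝓕 a x ^ (m + 1 + 1)) = fun x => 𝓕 a x * 𝓕 a x ^ (m + 1) := by
        ext x; rw [pow_succ']
      rw [e, fourierInv_fourier_mul hai (hint m), conv]
      refine integral_eq_zero_of_ae (Eventually.of_forall fun t => ?_)
      rcases lt_or_ge R ‖t‖ with h | h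
      · simp [hs t h]
      · have : ‖ξ‖ ≤ ‖t‖ + ‖ξ - t‖ := by
          calc ‖ξ‖ = ‖t + (ξ - t)‖ := by simp
            _ ≤ _ := norm_add_le _ _
        push_cast at hξ
        simp [ih (ξ - t) (by linarith)]
  · refine (norm_fourierInv_le _ ξ).trans ?_
    rw [← integral_const_mul]
    exact integral_mono (hint m).norm (hp.norm.const_mul _) hle

/-- Powers of band-limited functions have the expected geometric growth, since the weights `e^{M(k|ξ|)}`
grow subexponentially. -/
theorem exists_bandLimited_pow_le {a : E d → ℂ} (ha : Continuous a) {R : ℝ} (hR : 0 ≤ R)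
    (hs : ∀ ξ, R < ‖ξ‖ → a ξ = 0) (hp : Integrable (𝓕 a)) {B : ℝ} (hB0 : 0 < B) (hB : ∀ x, ‖𝓕 a x‖ ≤ B)
    {k : ℝ} (hk : 0 ≤ k) {t : ℝ} (ht : 1 < t) : ∃ D ≥ 0, ∀ m : ℕ, RapidL1 M (𝓕⁻ fun x => 𝓕 a x ^ (m + 1)) ∧
      𝓕 (𝓕⁻ fun x => 𝓕 a x ^ (m + 1)) = (fun x => 𝓕 a x ^ (m + 1)) ∧
      ∫ ξ, M.wt (k * ‖ξ‖) * ‖𝓕⁻ (fun x => 𝓕 a x ^ (m + 1)) ξ‖ ≤ D * (B * t) ^ (m + 1) := by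
  obtain ⟨A, hA, K, hK, hAK⟩ := M.exists_wt_mul_wt_le hk zero_le_one
  have hlog := Real.log_pos ht
  -- the rate is chosen such that the weight is at most `C t ^ (m + 1)` on the ball of radius `(m + 1) R`
  obtain ⟨C, hC, hCε⟩ := M.exists_wt_le_exp (ε := Real.log t / (K * R + 1)) (by positivity)
  set I := ∫ ξ : E d, (M.wt (1 * ‖ξ‖))⁻¹ with hI
  have hi := M.integrable_inv_wt (d := d) one_pos
  have hI0 : 0 ≤ I := integral_nonneg fun ξ => inv_nonneg.2 (M.wt_pos _).le
  set P := ∫ x, ‖𝓕 a x‖ with hP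
  have hP0 : 0 ≤ P := integral_nonneg fun _ => norm_nonneg _
  have hac : HasCompactSupport a :=
    HasCompactSupport.of_support_subset_isCompact (isCompact_closedBall 0 R) fun ξ hξ => by
      rw [mem_closedBall_zero_iff]
      by_contra! h
      exact hξ (hs ξ h)
  have hai : Integrable a := ha.integrable_of_hasCompactSupport hac
  have hpc : Continuous (𝓕 a) := continuous_fourier hai
  refine ⟨P / B * (A * C) * I, by positivity, fun m => ?_⟩
  obtain ⟨h1, h2, h3⟩ := fourierInv_pow_of_bandLimited ha hs hp hB m
  set A' := 𝓕⁻ fun x => 𝓕 a x ^ (m + 1) with hA'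
  have hc : Continuous A' := continuous_fourierInv h1
  have hcs : HasCompactSupport A' :=
    HasCompactSupport.of_support_subset_isCompact (isCompact_closedBall 0 ((m + 1) * R)) fun ξ hξ => by
      rw [mem_closedBall_zero_iff]
      by_contra! h
      exact hξ (h2 ξ h)
  have hrap := rapidL1_of_hasCompactSupport M hc hcs
  have hinv : 𝓕 A' = fun x => 𝓕 a x ^ (m + 1) := by
    refine (hpc.pow _).fourier_fourierInv_eq h1 ?_
    have := hrap.integrable.comp_neg
    refine this.congr (Eventually.of_forall fun ξ => ?_)
    simp only [hA', Real.fourierInv_eq_fourier_neg, neg_neg]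
    rfl
  refine ⟨hrap, hinv, ?_⟩
  have key : ∀ ξ, M.wt (k * ‖ξ‖) * ‖A' ξ‖
      ≤ B ^ m * P * (A * (C * t ^ (m + 1))) * (M.wt (1 * ‖ξ‖))⁻¹ := by
    intro ξ
    have hw1 := M.wt_pos (1 * ‖ξ‖)
    rcases lt_or_ge ((m + 1) * R) ‖ξ‖ with h | h
    · rw [h2 ξ h, norm_zero, mul_zero]
      positivity
    · rw [← div_eq_mul_inv, le_div_iff₀ hw1]
      have h4 : M.wt (K * ‖ξ‖) ≤ C * t ^ (m + 1) := by
        refine (hCε _ (by positivity)).trans ?_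
        gcongr
        rw [← Real.exp_log (by linarith : 0 < t), ← Real.exp_nat_mul, Real.log_exp]
        refine Real.exp_le_exp.2 ?_
        rw [div_mul_eq_mul_div, div_le_iff₀ (by positivity)]
        push_cast
        have h5 : K * ‖ξ‖ ≤ (m + 1) * (K * R) := by
          calc K * ‖ξ‖ ≤ K * ((m + 1) * R) := by gcongr
            _ = _ := by ring
        have h6 : (m + 1) * (K * R) ≤ (m + 1) * (K * R + 1) := by gcongr; linarith
        calc Real.log t * (K * ‖ξ‖) ≤ Real.log t * ((m + 1) * (K * R + 1)) := by
              exact mul_le_mul_of_nonneg_left (h5.trans h6) hlog.le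
          _ = _ := by ring
      have h7 := hAK ‖ξ‖ (norm_nonneg _)
      calc M.wt (k * ‖ξ‖) * ‖A' ξ‖ * M.wt (1 * ‖ξ‖)
          = ‖A' ξ‖ * (M.wt (k * ‖ξ‖) * M.wt (1 * ‖ξ‖)) := by ring
        _ ≤ (B ^ m * P) * (A * M.wt (K * ‖ξ‖)) :=
          mul_le_mul (h3 ξ) h7 (mul_nonneg (M.wt_pos _).le hw1.le) (by positivity)
        _ ≤ _ := by gcongr
  refine (integral_mono_of_nonneg (Eventually.of_forall fun ξ => ?_) (hi.const_mul _)
    (Eventually.of_forall key)).trans_eq ?_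
  · have := M.wt_pos (k * ‖ξ‖)
    simp only [Pi.zero_apply]
    positivity
  · rw [integral_const_mul, ← hI, mul_pow, pow_succ B]
    field_simp

theorem continuous_of_ud {f : E d → ℂ} (hf : UD M f) : Continuous f := hf.1.continuous

theorem TestFun.rapidL1 (φ : TestFun M d) : RapidL1 M (φ : E d → ℂ) :=
  rapidL1_of_hasCompactSupport M φ.2.1.continuous φ.2.2.1

theorem TestFun.ud_fourierInv (φ : TestFun M d) : UD M (𝓕⁻ (φ : E d → ℂ)) := by
  have h : RapidL1 M fun x => (φ : E d → ℂ) (-x) :=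
    rapidL1_of_hasCompactSupport M (φ.2.1.continuous.comp continuous_neg)
      (φ.2.2.1.comp_homeomorph (Homeomorph.neg (E d)))
  rw [Real.fourierInv_eq_fourier_comp_neg]
  exact h.ud_fourier

/-- Frequency cut-off: a rapidly decreasing function is a compactly supported one plus a remainder that is
small in a weighted `L¹` space. -/
theorem exists_frequency_cutoff {a : E d → ℂ} (ha : RapidL1 M a) {k : ℝ} (hk : 0 ≤ k) {δ : ℝ} (hδ : 0 < δ) :
    ∃ θ : TestFun M d, ∫ ξ, M.wt (k * ‖ξ‖) * ‖a ξ - (θ : E d → ℂ) ξ * a ξ‖ ≤ δ := by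
  have hθ := fun n : ℕ => exists_cutoff M (isCompact_closedBall (0 : E d) n) isOpen_univ (subset_univ _)
  choose θ h1 h2 h3 using hθ
  have hlim : Tendsto (fun n => ∫ ξ, M.wt (k * ‖ξ‖) * ‖a ξ - (θ n : E d → ℂ) ξ * a ξ‖) atTop
      (𝓝 (∫ _ : E d, (0 : ℝ))) := by
    refine tendsto_integral_of_dominated_convergence (fun ξ => 2 * (M.wt (k * ‖ξ‖) * ‖a ξ‖)) (fun n => ?_)
      ((ha.2 k hk).const_mul 2) (fun n => Eventually.of_forall fun ξ => ?_) (Eventually.of_forall fun ξ => ?_)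
    · exact (M.measurable_wt_norm k).aestronglyMeasurable.mul
        (ha.1.sub ((θ n).2.1.continuous.aestronglyMeasurable.mul ha.1)).norm
    · have hw := M.wt_pos (k * ‖ξ‖)
      rw [Real.norm_of_nonneg (by positivity), mul_left_comm]
      gcongr
      refine (norm_sub_le _ _).trans ?_
      rw [norm_mul]
      have := mul_le_mul_of_nonneg_right (h3 n ξ) (norm_nonneg (a ξ))
      linarith
    · refine tendsto_const_nhds.congr' ?_
      filter_upwards [eventually_ge_atTop ⌈‖ξ‖⌉₊] with n hn
      have hξ : ξ ∈ Metric.closedBall (0 : E d) n := by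
        rw [mem_closedBall_zero_iff]
        exact Nat.ceil_le.1 hn
      rw [(eventually_nhdsSet_iff_forall.1 (h2 n) ξ hξ).self_of_nhds]
      simp
  rw [integral_zero] at hlim
  obtain ⟨n, hn⟩ := (hlim.eventually (ge_mem_nhds hδ)).exists
  exact ⟨θ n, hn⟩

/-- If `|r| ≤ 1/2`, the Fourier transforms of `r ^ n s` decay geometrically in each weighted space: the
spectral radius of `r` in the Beurling algebras is the supremum of `|r|`. -/
theorem TestFun.exists_fourierInv_pow_le (hsub : Submultiplicative (M.expWeight (d := d))) (r s : TestFun M d)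
    (hr : ∀ x, ‖(r : E d → ℂ) x‖ ≤ 1 / 2) {k : ℝ} (hk : 0 ≤ k) : ∃ D, ∀ (n : ℕ) (ξ : E d),
      M.wt (k * ‖ξ‖) * ‖𝓕⁻ (fun x => (r : E d → ℂ) x ^ n * (s : E d → ℂ) x) ξ‖ ≤ D * (3 / 4) ^ n := by
  obtain ⟨C, hC, hCk⟩ := hsub.exists_wt_le
  have hC0 : 0 < C := by linarith
  set a := 𝓕⁻ (r : E d → ℂ) with ha
  have har : Rapid M a := TestFun.rapid_fourierInv r
  have haF : 𝓕 a = (r : E d → ℂ) := TestFun.fourier_fourierInv r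
  -- `r = p + e`, where `p = 𝓕 a₁` is band-limited with `|p| ≤ 11/20`,
  -- and `e = 𝓕 a₂` is small in the Beurling algebra
  obtain ⟨θ, hθ⟩ := exists_frequency_cutoff har.rapidL1 hk (δ := 1 / (20 * C)) (by positivity)
  set a₁ : TestFun M d := TestFun.mulUD θ (TestFun.ud_fourierInv r) with ha₁
  set a₂ : E d → ℂ := a + (-1 : ℂ) • (a₁ : E d → ℂ) with ha₂
  have hL₂ : RapidL1 M a₂ := har.rapidL1.add ((TestFun.rapidL1 a₁).const_smul _)
  have ha₂' : ∀ ξ, a₂ ξ = a ξ - (θ : E d → ℂ) ξ * a ξ := fun ξ => by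
    simp only [ha₂, ha₁, Pi.add_apply, Pi.smul_apply, TestFun.mulUD_apply, smul_eq_mul]
    ring
  have hδ : ∫ ξ, M.wt (k * ‖ξ‖) * ‖a₂ ξ‖ ≤ 1 / (20 * C) := by simpa only [ha₂'] using hθ
  set p := 𝓕 (a₁ : E d → ℂ) with hp
  set e := 𝓕 a₂ with he
  have hre : ∀ x, (r : E d → ℂ) x = p x + e x := fun x => by
    rw [← haF, he, ha₂, fourier_add har.integrable (((TestFun.rapidL1 a₁).const_smul _).integrable),
      fourier_const_smul]
    simp only [Pi.add_apply, Pi.smul_apply, smul_eq_mul, ← hp]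
    ring
  have hen : ∀ x, ‖e x‖ ≤ 1 / 20 := fun x => by
    refine (norm_fourier_le _ x).trans ?_
    have h1 : ∫ ξ, ‖a₂ ξ‖ ≤ ∫ ξ, M.wt (k * ‖ξ‖) * ‖a₂ ξ‖ :=
      integral_mono hL₂.integrable.norm (hL₂.2 k hk) fun ξ =>
        le_mul_of_one_le_left (norm_nonneg _) (M.one_le_wt _)
    refine h1.trans (hδ.trans ?_)
    rw [div_le_div_iff₀ (by positivity) (by norm_num)]
    linarith
  have hpn : ∀ x, ‖p x‖ ≤ 11 / 20 := fun x => by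
    have : p x = (r : E d → ℂ) x - e x := by rw [hre]; ring
    rw [this]
    refine (norm_sub_le _ _).trans ?_
    linarith [hr x, hen x]
  obtain ⟨R, hR⟩ := a₁.2.2.1.isCompact.isBounded.exists_norm_le
  obtain ⟨D, hD, hDm⟩ := exists_bandLimited_pow_le (M := M) a₁.2.1.continuous (R := max R 0) (le_max_right _ _)
    (fun ξ hξ => by
      by_contra hne
      exact absurd (hR ξ (subset_tsupport _ hne)) (not_le.2 ((le_max_left _ _).trans_lt hξ)))
    (TestFun.rapid_fourier a₁).integrable (B := 11 / 20) (by norm_num) hpn hk (t := 12 / 11) (by norm_num)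
  obtain ⟨S, hS⟩ := (TestFun.rapid_fourierInv s).2 k hk
  have hS0 : 0 ≤ S := (mul_nonneg (M.wt_pos _).le (norm_nonneg _)).trans (hS 0)
  have hpud : UD M p := (TestFun.rapidL1 a₁).ud_fourier
  have hint : ∀ n m : ℕ, Integrable fun x => (r : E d → ℂ) x ^ n * (p x ^ m * (s : E d → ℂ) x) := fun n m =>
    ((r.2.1.continuous.pow n).mul ((continuous_of_ud hpud).pow m |>.mul s.2.1.continuous)).integrable_of_hasCompactSupport
      (s.2.2.1.mul_left.mul_left)
  -- replacing one factor `r` by `p + e` at a time costs `3/5 + 1/20 ≤ 3/4`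
  have hcl : ∀ n m : ℕ, ∀ ξ, M.wt (k * ‖ξ‖) *
      ‖𝓕⁻ (fun x => (r : E d → ℂ) x ^ n * (p x ^ m * (s : E d → ℂ) x)) ξ‖
        ≤ (C * D + 1) * S * (3 / 5) ^ m * (3 / 4) ^ n := by
    intro n
    induction n with
    | zero =>
      intro m ξ
      simp only [pow_zero, one_mul, mul_one]
      cases m with
      | zero =>
        simp only [pow_zero, one_mul, mul_one]
        have : 0 ≤ C * D * S := by positivity
        have := hS ξ
        linarith
      | succ m =>
        obtain ⟨h1, h2, h3⟩ := hDm m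
        have e1 : 𝓕⁻ (fun x => p x ^ (m + 1) * (s : E d → ℂ) x) ξ
            = conv (𝓕⁻ fun x => p x ^ (m + 1)) (𝓕⁻ (s : E d → ℂ)) ξ := by
          rw [← fourierInv_fourier_mul h1.integrable (TestFun.integrable s), h2]
        rw [e1]
        refine (wt_mul_norm_conv_le hC0.le (hCk k hk) (h1.2 k hk) hS ξ).trans ?_
        rw [show (11 / 20 * (12 / 11) : ℝ) = 3 / 5 by norm_num] at h3
        calc _ ≤ C * (D * (3 / 5) ^ (m + 1)) * S := by gcongr
          _ = C * D * S * (3 / 5) ^ (m + 1) := by ring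
          _ ≤ _ := by gcongr; linarith
    | succ n ih =>
      intro m ξ
      have e1 : (fun x => (r : E d → ℂ) x ^ (n + 1) * (p x ^ m * (s : E d → ℂ) x))
          = (fun x => (r : E d → ℂ) x ^ n * (p x ^ (m + 1) * (s : E d → ℂ) x))
            + fun x => 𝓕 a₂ x * ((r : E d → ℂ) x ^ n * (p x ^ m * (s : E d → ℂ) x)) := by
        ext x
        simp only [Pi.add_apply, ← he]
        rw [pow_succ (r.1 x), pow_succ, show (r : E d → ℂ) x ^ n * (r : E d → ℂ) x = (r : E d → ℂ) x ^ n * (p x + e x)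
          by rw [← hre]]
        ring
      have hi2 : Integrable fun x => 𝓕 a₂ x * ((r : E d → ℂ) x ^ n * (p x ^ m * (s : E d → ℂ) x)) :=
        (hint n m).bdd_mul (c := 1 / 20) (continuous_fourier hL₂.integrable).aestronglyMeasurable
          (Eventually.of_forall hen)
      rw [e1, fourierInv_add (hint n (m + 1)) hi2, Pi.add_apply, fourierInv_fourier_mul hL₂.integrable (hint n m)]
      have hw := M.wt_pos (k * ‖ξ‖)
      have h5 := wt_mul_norm_conv_le hC0.le (hCk k hk) (hL₂.2 k hk) (ih m) ξ
      have h6 : C * (∫ ξ, M.wt (k * ‖ξ‖) * ‖a₂ ξ‖) ≤ 1 / 20 := by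
        calc _ ≤ C * (1 / (20 * C)) := by gcongr
          _ = 1 / 20 := by field_simp
      set Q := (C * D + 1) * S * (3 / 5) ^ m * (3 / 4) ^ n with hQ
      have hQ0 : 0 ≤ Q := by positivity
      calc _ ≤ M.wt (k * ‖ξ‖) * (‖𝓕⁻ (fun x => (r : E d → ℂ) x ^ n * (p x ^ (m + 1) * (s : E d → ℂ) x)) ξ‖
            + ‖conv a₂ (𝓕⁻ fun x => (r : E d → ℂ) x ^ n * (p x ^ m * (s : E d → ℂ) x)) ξ‖) := by
            gcongr; exact norm_add_le _ _
        _ ≤ (C * D + 1) * S * (3 / 5) ^ (m + 1) * (3 / 4) ^ n + 1 / 20 * Q := by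
            rw [mul_add]
            exact add_le_add (ih (m + 1) ξ) (h5.trans (by gcongr))
        _ = 3 / 5 * Q + 1 / 20 * Q := by rw [hQ, pow_succ]; ring
        _ ≤ 3 / 4 * Q := by linarith
        _ = _ := by rw [hQ, pow_succ (3 / 4 : ℝ)]; ring
  refine ⟨(C * D + 1) * S, fun n ξ => ?_⟩
  have := hcl n 0 ξ
  simpa only [pow_zero, one_mul, mul_one] using this

/-- The inverse Fourier transform of `s / (1 - r)` is the Neumann series `∑ 𝓕⁻ (r ^ n s)`. -/
theorem TestFun.exists_rapid_fourier_eq (hsub : Submultiplicative (M.expWeight (d := d))) (r s : TestFun M d)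
    (hr : ∀ x, ‖(r : E d → ℂ) x‖ ≤ 1 / 2) :
    ∃ b, Rapid M b ∧ ∀ x, 𝓕 b x = (1 - (r : E d → ℂ) x)⁻¹ * (s : E d → ℂ) x := by
  set c : ℕ → E d → ℂ := fun n => 𝓕⁻ fun x => (r : E d → ℂ) x ^ n * (s : E d → ℂ) x with hc
  have hg : ∀ n, ∃ g : TestFun M d, (g : E d → ℂ) = fun x => (r : E d → ℂ) x ^ n * (s : E d → ℂ) x := fun n => by
    have h : UD M fun x => (r : E d → ℂ) x ^ n := by
      simpa using UD.prod (Finset.range n) fun _ => TestFun.ud r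
    refine ⟨TestFun.mulUD s h, ?_⟩
    ext x
    rw [TestFun.mulUD_apply, mul_comm]
  choose g hg using hg
  have hcg : ∀ n, c n = 𝓕⁻ (g n : E d → ℂ) := fun n => by rw [hg]
  have hcc : ∀ n, Continuous (c n) := fun n => by
    rw [hcg]
    exact continuous_fourierInv (TestFun.integrable (g n))
  have hci : ∀ n, Integrable (c n) := fun n => by
    rw [hcg]
    exact (TestFun.rapid_fourierInv (g n)).integrable
  have hgeo : Summable fun n : ℕ => (3 / 4 : ℝ) ^ n := summable_geometric_of_lt_one (by norm_num) (by norm_num)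
  have hgs : ∑' n : ℕ, (3 / 4 : ℝ) ^ n = 4 := by
    rw [tsum_geometric_of_lt_one (by norm_num) (by norm_num)]; norm_num
  have hcb : ∀ k, 0 ≤ k → ∃ D, ∀ n ξ, ‖c n ξ‖ ≤ D * (M.wt (k * ‖ξ‖))⁻¹ * (3 / 4) ^ n := by
    intro k hk
    obtain ⟨D, hD⟩ := TestFun.exists_fourierInv_pow_le hsub r s hr hk
    refine ⟨D, fun n ξ => ?_⟩
    have hw := M.wt_pos (k * ‖ξ‖)
    rw [mul_right_comm, ← div_eq_mul_inv, le_div_iff₀ hw, mul_comm]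
    exact hD n ξ
  have hsum : ∀ ξ, Summable fun n => c n ξ := fun ξ => by
    obtain ⟨D, hD⟩ := hcb 0 le_rfl
    exact Summable.of_norm_bounded (hgeo.mul_left _) fun n => hD n ξ
  set b : E d → ℂ := fun ξ => ∑' n, c n ξ with hb
  have hbb : ∀ k, 0 ≤ k → ∃ D, ∀ ξ, M.wt (k * ‖ξ‖) * ‖b ξ‖ ≤ D := by
    intro k hk
    obtain ⟨D, hD⟩ := hcb k hk
    refine ⟨D * 4, fun ξ => ?_⟩
    have hw := M.wt_pos (k * ‖ξ‖)
    have h1 : ‖b ξ‖ ≤ D * (M.wt (k * ‖ξ‖))⁻¹ * 4 := by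
      rw [← hgs, ← tsum_mul_left]
      exact tsum_of_norm_bounded (hgeo.mul_left _).hasSum fun n => hD n ξ
    calc _ ≤ M.wt (k * ‖ξ‖) * (D * (M.wt (k * ‖ξ‖))⁻¹ * 4) := by gcongr
      _ = D * 4 := by field_simp
  have hbc : Continuous b := by
    obtain ⟨D, hD⟩ := hcb 0 le_rfl
    refine continuous_tsum hcc (hgeo.mul_left (D * (M.wt 0)⁻¹)) fun n ξ => ?_
    simpa using hD n ξ
  have hbr : Rapid M b := ⟨hbc.aestronglyMeasurable, hbb⟩
  have hFb : ∀ x, HasSum (fun n => (r : E d → ℂ) x ^ n * (s : E d → ℂ) x) (𝓕 b x) := by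
    intro x
    obtain ⟨D, hD⟩ := hcb 1 zero_le_one
    have hF : ∀ n, (r : E d → ℂ) x ^ n * (s : E d → ℂ) x = 𝓕 (c n) x := fun n => by
      rw [hcg, TestFun.fourier_fourierInv (g n), hg]
    simp only [hF, Real.fourier_eq]
    have hi := (M.integrable_inv_wt (d := d) one_pos).const_mul D
    refine hasSum_integral_of_dominated_convergence
      (fun n ξ => D * (M.wt (1 * ‖ξ‖))⁻¹ * (3 / 4) ^ n)
      (fun n => (integrable_char_smul (hci n) x).1)
      (fun n => Eventually.of_forall fun ξ => ?_) (Eventually.of_forall fun ξ => hgeo.mul_left _) ?_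
      (Eventually.of_forall fun ξ => ?_)
    · rw [Circle.norm_smul]
      exact hD n ξ
    · simp only [tsum_mul_left, hgs]
      exact hi.mul_const 4
    · exact (hsum ξ).hasSum.const_smul _
  have hval : ∀ x, HasSum (fun n => (r : E d → ℂ) x ^ n * (s : E d → ℂ) x)
      ((1 - (r : E d → ℂ) x)⁻¹ * (s : E d → ℂ) x) := fun x => by
    have h1 : ‖(r : E d → ℂ) x‖ < 1 := by linarith [hr x]
    exact (hasSum_geometric_of_norm_lt_one h1).mul_right _
  have hval' : ∀ x, 𝓕 b x = (1 - (r : E d → ℂ) x)⁻¹ * (s : E d → ℂ) x := fun x =>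
    HasSum.unique (hFb x) (hval x)
  clear_value b
  exact ⟨b, hbr, hval'⟩

/-- The quotient of a test function by `1 - r` is a test function, if `|r| ≤ 1/2`. -/
theorem TestFun.exists_mul_one_sub_eq (hsub : Submultiplicative (M.expWeight (d := d))) (r s : TestFun M d)
    (hr : ∀ x, ‖(r : E d → ℂ) x‖ ≤ 1 / 2) :
    ∃ Ψ : TestFun M d, ∀ x, (Ψ : E d → ℂ) x * (1 - (r : E d → ℂ) x) = (s : E d → ℂ) x := by
  obtain ⟨b, hb, hval⟩ := TestFun.exists_rapid_fourier_eq hsub r s hr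
  have hne : ∀ x, 1 - (r : E d → ℂ) x ≠ 0 := fun x h => by
    have h1 : (r : E d → ℂ) x = 1 := (sub_eq_zero.1 h).symm
    have := hr x
    rw [h1, norm_one] at this
    norm_num at this
  have hu := hb.rapidL1.ud_fourier
  have hcs : HasCompactSupport (𝓕 b) := by
    have e : 𝓕 b = fun x => (1 - (r : E d → ℂ) x)⁻¹ * (s : E d → ℂ) x := funext hval
    rw [e]
    exact s.2.2.1.mul_left
  refine ⟨⟨𝓕 b, hu.1, hcs, hu.2⟩, fun x => ?_⟩
  change 𝓕 b x * _ = _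
  rw [hval, mul_right_comm, inv_mul_cancel₀ (hne x), one_mul]

/-- Local division by a test function `χ`: near `y`, it is a constant multiple of `1 - r` with `r` small. -/
theorem TestFun.exists_eq_mul (hsub : Submultiplicative (M.expWeight (d := d))) (χ : TestFun M d) {y : E d}
    (hy : (χ : E d → ℂ) y ≠ 0) : ∃ V, IsOpen V ∧ y ∈ V ∧ ∀ s : TestFun M d, tsupport (s : E d → ℂ) ⊆ V →
      ∃ Ψ : TestFun M d, s = TestFun.mulUD χ (TestFun.ud Ψ) := by
  set c := (χ : E d → ℂ) y with hc
  set W : Set (E d) := {x | ‖1 - c⁻¹ * (χ : E d → ℂ) x‖ < 1 / 2} with hW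
  have hWo : IsOpen W := by
    have := χ.2.1.continuous
    exact isOpen_lt (by fun_prop) continuous_const
  have hyW : {y} ⊆ W := by
    rw [singleton_subset_iff]
    simp [hW, ← hc, inv_mul_cancel₀ hy]
  obtain ⟨ρ, h1, h2, h3⟩ := exists_cutoff M isCompact_singleton hWo hyW
  rw [nhdsSet_singleton] at h2
  have hud : UD M fun x => 1 + -c⁻¹ * (χ : E d → ℂ) x := by
    have h4 := (UD.const (M := M) (-c⁻¹)).mul (TestFun.ud χ)
    refine ⟨contDiff_const.add h4.1, fun h hh => ?_⟩
    obtain ⟨B, hB⟩ := h4.2 h hh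
    obtain ⟨B', hB'⟩ := (UD.const (M := M) (d := d) 1).2 h hh
    exact ⟨_, hB'.add contDiff_const h4.1 hB⟩
  -- `1 - r = χ / χ(y)` where `ρ = 1`
  set r : TestFun M d := TestFun.mulUD ρ hud with hr
  have hrn : ∀ x, ‖(r : E d → ℂ) x‖ ≤ 1 / 2 := fun x => by
    rw [hr, TestFun.mulUD_apply, norm_mul]
    by_cases hx : x ∈ tsupport (ρ : E d → ℂ)
    · have h5 : ‖1 - c⁻¹ * (χ : E d → ℂ) x‖ < 1 / 2 := h1 hx
      rw [neg_mul, ← sub_eq_add_neg]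
      have := mul_le_mul (h3 x) h5.le (norm_nonneg _) zero_le_one
      linarith
    · rw [image_eq_zero_of_notMem_tsupport hx, norm_zero, zero_mul]
      norm_num
  obtain ⟨V, hV, hVo, hyV⟩ := eventually_nhds_iff.1 h2
  refine ⟨V, hVo, hyV, fun s hs => ?_⟩
  obtain ⟨Ψ, hΨ⟩ := TestFun.exists_mul_one_sub_eq hsub r s hrn
  refine ⟨c⁻¹ • Ψ, ?_⟩
  ext x
  rw [TestFun.mulUD_apply]
  simp only [Submodule.coe_smul, Pi.smul_apply, smul_eq_mul]
  by_cases hx : x ∈ V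
  · rw [← hΨ x, hr, TestFun.mulUD_apply, hV x hx]
    ring
  · have h0 : (s : E d → ℂ) x = 0 := image_eq_zero_of_notMem_tsupport fun h => hx (hs h)
    have h4 := hΨ x
    rw [h0] at h4
    have h5 : 1 - (r : E d → ℂ) x ≠ 0 := fun h => by
      have h6 : (r : E d → ℂ) x = 1 := (sub_eq_zero.1 h).symm
      have := hrn x
      rw [h6, norm_one] at this
      norm_num at this
    rw [h0, (mul_eq_zero.1 h4).resolve_right h5]
    ring

end Division

/-! ### Convolution of ultradistributions -/

section Convolution

open scoped Pointwise

variable {M : DefiningSequence} {d : ℕ}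

theorem isCompact_sub {K L : Set (E d)} (hK : IsCompact K) (hL : IsCompact L) : IsCompact (K - L) := by
  rw [sub_eq_add_neg]
  exact hK.add hL.neg

theorem UltraGrowth.mul_rapid {F a : E d → ℂ} (hF : UltraGrowth M F) (ha : Rapid M a) :
    Rapid M fun ξ => F ξ * a ξ := by
  obtain ⟨hm, k, hk, C, hC, H⟩ := hF
  refine ⟨hm.mul ha.1, fun l hl => ?_⟩
  obtain ⟨A, hA, K, hK, hAK⟩ := M.exists_wt_mul_wt_le hl hk
  obtain ⟨B, hB⟩ := ha.2 K (by linarith)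
  refine ⟨C * A * B, fun ξ => ?_⟩
  have h1 := M.wt_pos (l * ‖ξ‖)
  have h2 := hAK ‖ξ‖ (norm_nonneg _)
  rw [norm_mul]
  calc M.wt (l * ‖ξ‖) * (‖F ξ‖ * ‖a ξ‖) ≤ M.wt (l * ‖ξ‖) * (C * M.wt (k * ‖ξ‖) * ‖a ξ‖) := by
        gcongr; exact H ξ
    _ = C * (M.wt (l * ‖ξ‖) * M.wt (k * ‖ξ‖)) * ‖a ξ‖ := by ring
    _ ≤ C * (A * M.wt (K * ‖ξ‖)) * ‖a ξ‖ := by gcongr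
    _ = C * A * (M.wt (K * ‖ξ‖) * ‖a ξ‖) := by ring
    _ ≤ _ := by gcongr; exact hB ξ

theorem Rapid.char_smul {a : E d → ℂ} (ha : Rapid M a) (x : E d) :
    Rapid M fun ξ => Real.fourierChar (-inner ℝ ξ x) • a ξ := by
  have hc : Continuous fun ξ : E d => (Real.fourierChar (-inner ℝ ξ x) : Circle) := by fun_prop
  refine ⟨hc.aestronglyMeasurable.smul ha.1, fun k hk => ?_⟩
  simpa only [Circle.norm_smul] using ha.2 k hk

theorem fourier_char_neg_smul (a : E d → ℂ) (x y : E d) :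
    𝓕 (fun ξ => Real.fourierChar (-inner ℝ ξ x) • a ξ) y = 𝓕 a (x + y) := by
  simp only [Real.fourier_eq]
  congr 1
  ext ξ
  rw [smul_smul, ← AddChar.map_add_eq_mul, inner_add_right]
  congr 2
  ring

/-- The function `x ↦ ⟨f(y), φ(x + y)⟩` on the Fourier side. -/
theorem IsFourierOf.apply_translate {f : UDist M d} {χ : TestFun M d} {F : E d → ℂ} (h : IsFourierOf f χ F)
    {φ : TestFun M d} {x : E d} (hχ : ∀ y, (φ : E d → ℂ) (x + y) ≠ 0 → (χ : E d → ℂ) y = 1) :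
    f (TestFun.translate x φ) = 𝓕 (fun ξ => F ξ * 𝓕⁻ (φ : E d → ℂ) ξ) x := by
  have ha := (TestFun.rapid_fourierInv φ).char_smul x
  have e : TestFun.translate x φ = TestFun.mulUD χ ha.rapidL1.ud_fourier := by
    ext y
    rw [TestFun.mulUD_apply, fourier_char_neg_smul, TestFun.fourier_fourierInv φ]
    change (φ : E d → ℂ) (x + y) = _
    by_cases hy : (φ : E d → ℂ) (x + y) = 0
    · rw [hy, mul_zero]
    · rw [hχ y hy, one_mul]
  rw [e, h _ ha, Real.fourier_eq]
  congr 1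
  ext ξ
  simp only [Circle.smul_def, smul_eq_mul]
  ring

/-- On a compact set of points `x`, and for `φ` with a fixed compact support, `⟨f(y), φ(x + y)⟩` involves only one
localization of `f`. -/
theorem UDist.exists_apply_translate_eq (f : UDist M d) {K L : Set (E d)} (hK : IsCompact K) (hL : IsCompact L) :
    ∃ F, UltraGrowth M F ∧ ∀ φ : TestFun M d, tsupport (φ : E d → ℂ) ⊆ K → ∀ x ∈ L,
      f (TestFun.translate x φ) = 𝓕 (fun ξ => F ξ * 𝓕⁻ (φ : E d → ℂ) ξ) x := by
  obtain ⟨χ, -, h1, -⟩ := exists_cutoff M (isCompact_sub hK hL) isOpen_univ (subset_univ _)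
  obtain ⟨F, hF, h⟩ := UDist.exists_isFourierOf f χ
  have h' : IsFourierOf f χ F := fun a ha => h a ha.rapidL1
  refine ⟨F, hF, fun φ hφ x hx => h'.apply_translate fun y hy => ?_⟩
  refine (eventually_nhdsSet_iff_forall.1 h1 y ⟨x + y, hφ (subset_tsupport _ hy), x, hx, ?_⟩).self_of_nhds
  simp

theorem UDist.mul_apply_translate_eq (f : UDist M d) (χ : TestFun M d) {φ : TestFun M d} {b : E d → ℂ}
    (hb : RapidL1 M b) (h : ∀ x ∈ tsupport (χ : E d → ℂ), f (TestFun.translate x φ) = 𝓕 b x) :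
    (fun x => (χ : E d → ℂ) x * f (TestFun.translate x φ)) = (TestFun.mulUD χ hb.ud_fourier : E d → ℂ) := by
  ext x
  rw [TestFun.mulUD_apply]
  by_cases hx : x ∈ tsupport (χ : E d → ℂ)
  · rw [h x hx]
  · rw [image_eq_zero_of_notMem_tsupport hx, zero_mul, zero_mul]

/-- The test function `x ↦ χ(x) ⟨f(y), φ(x + y)⟩`; on the support of `χ`, the second factor is the Fourier
transform of a rapidly decreasing function. -/
def UDist.convTest (f : UDist M d) (χ φ : TestFun M d) : TestFun M d :=
  ⟨fun x => (χ : E d → ℂ) x * f (TestFun.translate x φ), by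
    obtain ⟨F, hF, h⟩ := UDist.exists_apply_translate_eq f φ.2.2.1 χ.2.2.1
    rw [UDist.mul_apply_translate_eq f χ (hF.mul_rapid (TestFun.rapid_fourierInv φ)).rapidL1
      (h φ subset_rfl)]
    exact Subtype.property _⟩

theorem UDist.convTest_apply (f : UDist M d) (χ φ : TestFun M d) (x : E d) :
    (UDist.convTest f χ φ : E d → ℂ) x = (χ : E d → ℂ) x * f (TestFun.translate x φ) := rfl

theorem UDist.convTest_eq (f : UDist M d) (χ : TestFun M d) {φ : TestFun M d} {b : E d → ℂ}
    (hb : RapidL1 M b) (h : ∀ x ∈ tsupport (χ : E d → ℂ), f (TestFun.translate x φ) = 𝓕 b x) :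
    UDist.convTest f χ φ = TestFun.mulUD χ hb.ud_fourier :=
  Subtype.ext (UDist.mul_apply_translate_eq f χ hb h)

theorem UDist.convTest_add_right (f : UDist M d) (χ φ ψ : TestFun M d) :
    UDist.convTest f χ (φ + ψ) = UDist.convTest f χ φ + UDist.convTest f χ ψ := by
  ext x
  change (χ : E d → ℂ) x * f (TestFun.translate x φ + TestFun.translate x ψ) =
    (χ : E d → ℂ) x * f (TestFun.translate x φ) + (χ : E d → ℂ) x * f (TestFun.translate x ψ)
  rw [UDist.map_add f, mul_add]

theorem UDist.convTest_smul_right (f : UDist M d) (χ : TestFun M d) (c : ℂ) (φ : TestFun M d) :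
    UDist.convTest f χ (c • φ) = c • UDist.convTest f χ φ := by
  ext x
  change (χ : E d → ℂ) x * f (c • TestFun.translate x φ) = c * ((χ : E d → ℂ) x * f (TestFun.translate x φ))
  rw [UDist.map_smul f]
  ring

theorem UDist.convTest_add_left (f : UDist M d) (χ χ' φ : TestFun M d) :
    UDist.convTest f (χ + χ') φ = UDist.convTest f χ φ + UDist.convTest f χ' φ := by
  ext x
  exact add_mul _ _ _

theorem UDist.tsupport_convTest_subset (f : UDist M d) (χ φ : TestFun M d) :
    tsupport (UDist.convTest f χ φ : E d → ℂ) ⊆ tsupport (χ : E d → ℂ) := tsupport_mul_subset_left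

theorem UDist.apply_translate_eq_zero (f : UDist M d) {φ : TestFun M d} {x : E d}
    (h : ∀ y ∈ UDist.supp f, x + y ∉ tsupport (φ : E d → ℂ)) : f (TestFun.translate x φ) = 0 := by
  refine UDist.apply_eq_zero f (disjoint_left.2 fun y hy hyf => h y hyf ?_)
  exact tsupport_comp_subset_preimage (φ : E d → ℂ) (continuous_const.add continuous_id) hy

/-- The points `x ∈ supp f₁` with `x + y ∈ K` for some `y ∈ supp f₂`. -/
def convSet (f₁ f₂ : UDist M d) (K : Set (E d)) : Set (E d) :=
  {x | x ∈ UDist.supp f₁ ∧ ∃ y ∈ UDist.supp f₂, x + y ∈ K}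

theorem isClosed_exists_add_mem {S K : Set (E d)} (hS : IsClosed S) (hK : IsCompact K) :
    IsClosed {x | ∃ y ∈ S, x + y ∈ K} := by
  have e : {x | ∃ y ∈ S, x + y ∈ K} = K + -S := by
    ext x
    constructor
    · rintro ⟨y, hy, hx⟩
      exact ⟨x + y, hx, -y, by simpa using hy, by simp⟩
    · rintro ⟨z, hz, y, hy, rfl⟩
      exact ⟨-y, hy, by simpa using hz⟩
  rw [e]
  exact hS.neg.add_left_of_isCompact hK

theorem isCompact_convSet {f₁ f₂ : UDist M d} (h : IsCompact (UDist.supp f₁) ∨ IsCompact (UDist.supp f₂))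
    {K : Set (E d)} (hK : IsCompact K) : IsCompact (convSet f₁ f₂ K) := by
  have h2 := isClosed_exists_add_mem (UDist.isClosed_supp f₂) hK
  rcases h with h | h
  · exact h.inter_right h2
  · refine (isCompact_sub hK h).of_isClosed_subset ((UDist.isClosed_supp f₁).inter h2) ?_
    rintro x ⟨-, y, hy, hx⟩
    exact ⟨x + y, hx, y, hy, by simp⟩

theorem convSet_mono {f₁ f₂ : UDist M d} {K L : Set (E d)} (h : K ⊆ L) : convSet f₁ f₂ K ⊆ convSet f₁ f₂ L :=
  fun _ ⟨hx, y, hy, hxy⟩ => ⟨hx, y, hy, h hxy⟩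

/-- The value `⟨f₁(x), χ(x) ⟨f₂(y), φ(x + y)⟩⟩` does not depend on the cut-off function `χ`. -/
theorem UDist.apply_convTest_congr (f₁ f₂ : UDist M d) {χ χ' φ : TestFun M d}
    (h : ∀ᶠ x in 𝓝ˢ (convSet f₁ f₂ (tsupport (φ : E d → ℂ))), (χ : E d → ℂ) x = 1)
    (h' : ∀ᶠ x in 𝓝ˢ (convSet f₁ f₂ (tsupport (φ : E d → ℂ))), (χ' : E d → ℂ) x = 1) :
    f₁ (UDist.convTest f₂ χ φ) = f₁ (UDist.convTest f₂ χ' φ) := by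
  refine UDist.apply_congr f₁ fun x hx => ?_
  by_cases hx' : ∃ y ∈ UDist.supp f₂, x + y ∈ tsupport (φ : E d → ℂ)
  · filter_upwards [eventually_nhdsSet_iff_forall.1 h x ⟨hx, hx'⟩,
      eventually_nhdsSet_iff_forall.1 h' x ⟨hx, hx'⟩] with z h1 h2
    rw [UDist.convTest_apply, UDist.convTest_apply, h1, h2]
  · have hc := isClosed_exists_add_mem (UDist.isClosed_supp f₂) φ.2.2.1.isCompact
    filter_upwards [hc.isOpen_compl.mem_nhds hx'] with z hz
    have : f₂ (TestFun.translate z φ) = 0 :=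
      UDist.apply_translate_eq_zero f₂ fun y hy hzy => hz ⟨y, hy, hzy⟩
    rw [UDist.convTest_apply, UDist.convTest_apply, this, mul_zero, mul_zero]

/-- Bounds for the pairing, uniform in `φ` with a fixed compact support. -/
theorem UDist.exists_norm_apply_convTest_le (f₁ f₂ : UDist M d) (χ : TestFun M d) {K : Set (E d)}
    (hK : IsCompact K) : ∃ h > 0, ∃ C, ∀ φ : TestFun M d, tsupport (φ : E d → ℂ) ⊆ K →
      ∀ B, UDBound M (φ : E d → ℂ) h B → ‖f₁ (UDist.convTest f₂ χ φ)‖ ≤ C * B := by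
  obtain ⟨F, hF, h⟩ := UDist.exists_apply_translate_eq f₂ hK χ.2.2.1.isCompact
  obtain ⟨k, hk, C, hC, hf⟩ := UDist.exists_norm_apply_fourier_le f₁ χ
  obtain ⟨hm, l, hl, A, hA, hFA⟩ := id hF
  obtain ⟨A', hA', L, hL, hAL⟩ := M.exists_wt_mul_wt_le hk hl
  obtain ⟨A'', hA'', N, hN, hAN⟩ := M.exists_wt_mul_wt_le (show (0 : ℝ) ≤ L by linarith) zero_le_one
  have hpi := Real.pi_pos
  have hh : 0 < 2 * Real.pi / N := by positivity
  obtain ⟨D, hD, H⟩ := UDBound.exists_wt_mul_fourier_le M hK hh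
  refine ⟨2 * Real.pi / N, hh, C * (A * A' * A'' * D * ∫ ξ : E d, (M.wt (1 * ‖ξ‖))⁻¹), fun φ hφ B hB => ?_⟩
  have hr := hF.mul_rapid (TestFun.rapid_fourierInv φ)
  rw [UDist.convTest_eq f₂ χ hr.rapidL1 (h φ hφ)]
  refine (hf _ hr.rapidL1).trans ?_
  rw [mul_assoc C]
  refine mul_le_mul_of_nonneg_left ?_ hC
  have e : A * A' * A'' * D * (∫ ξ : E d, (M.wt (1 * ‖ξ‖))⁻¹) * B
      = ∫ ξ : E d, A * A' * A'' * D * B * (M.wt (1 * ‖ξ‖))⁻¹ := by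
    rw [integral_const_mul]; ring
  rw [e]
  refine integral_mono (hr.rapidL1.2 k hk) ((M.integrable_inv_wt one_pos).const_mul _) fun ξ => ?_
  have h1 := norm_wt_mul_fourierInv_le (H φ B hφ hB) ξ
  rw [show 2 * Real.pi / (2 * Real.pi / N) = N by field_simp] at h1
  have w1 := M.wt_pos (1 * ‖ξ‖)
  have w2 := M.wt_pos (k * ‖ξ‖)
  have h2 := hAL ‖ξ‖ (norm_nonneg _)
  have h3 := hAN ‖ξ‖ (norm_nonneg _)
  change M.wt (k * ‖ξ‖) * ‖F ξ * 𝓕⁻ (φ : E d → ℂ) ξ‖ ≤ _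
  rw [← div_eq_mul_inv, le_div_iff₀ w1, norm_mul]
  calc M.wt (k * ‖ξ‖) * (‖F ξ‖ * ‖𝓕⁻ (φ : E d → ℂ) ξ‖) * M.wt (1 * ‖ξ‖)
      ≤ M.wt (k * ‖ξ‖) * (A * M.wt (l * ‖ξ‖) * ‖𝓕⁻ (φ : E d → ℂ) ξ‖) * M.wt (1 * ‖ξ‖) := by
        gcongr; exact hFA ξ
    _ = A * (M.wt (k * ‖ξ‖) * M.wt (l * ‖ξ‖)) * ‖𝓕⁻ (φ : E d → ℂ) ξ‖ * M.wt (1 * ‖ξ‖) := by ring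
    _ ≤ A * (A' * M.wt (L * ‖ξ‖)) * ‖𝓕⁻ (φ : E d → ℂ) ξ‖ * M.wt (1 * ‖ξ‖) := by gcongr
    _ = A * A' * (M.wt (L * ‖ξ‖) * M.wt (1 * ‖ξ‖)) * ‖𝓕⁻ (φ : E d → ℂ) ξ‖ := by ring
    _ ≤ A * A' * (A'' * M.wt (N * ‖ξ‖)) * ‖𝓕⁻ (φ : E d → ℂ) ξ‖ := by gcongr
    _ = A * A' * A'' * (M.wt (N * ‖ξ‖) * ‖𝓕⁻ (φ : E d → ℂ) ξ‖) := by ring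
    _ ≤ A * A' * A'' * (D * B) := by gcongr
    _ = _ := by ring

/-- The convolution of two ultradistributions, one of them with compact support. -/
theorem UDist.exists_convolution {f₁ f₂ : UDist M d} (hc : IsCompact (UDist.supp f₁) ∨ IsCompact (UDist.supp f₂)) :
    ∃ w : UDist M d, ∀ φ χ : TestFun M d,
      (∀ᶠ x in 𝓝ˢ (convSet f₁ f₂ (tsupport (φ : E d → ℂ))), (χ : E d → ℂ) x = 1) →
        w φ = f₁ (UDist.convTest f₂ χ φ) := by
  have hex : ∀ K : Set (E d), IsCompact K → ∃ χ : TestFun M d, ∀ φ : TestFun M d, tsupport (φ : E d → ℂ) ⊆ K →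
      ∀ᶠ x in 𝓝ˢ (convSet f₁ f₂ (tsupport (φ : E d → ℂ))), (χ : E d → ℂ) x = 1 := fun K hK => by
    obtain ⟨χ, -, h, -⟩ := exists_cutoff M (isCompact_convSet hc hK) isOpen_univ (subset_univ _)
    exact ⟨χ, fun φ hφ => h.filter_mono (nhdsSet_mono (convSet_mono hφ))⟩
  choose! X hX using hex
  set v : TestFun M d → ℂ := fun φ => f₁ (UDist.convTest f₂ (X (tsupport (φ : E d → ℂ))) φ) with hv
  have key : ∀ φ χ : TestFun M d,
      (∀ᶠ x in 𝓝ˢ (convSet f₁ f₂ (tsupport (φ : E d → ℂ))), (χ : E d → ℂ) x = 1) →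
        v φ = f₁ (UDist.convTest f₂ χ φ) := fun φ χ h =>
    UDist.apply_convTest_congr f₁ f₂ (hX _ φ.2.2.1 φ subset_rfl) h
  refine ⟨⟨{ toFun := v, map_add' := fun φ ψ => ?_, map_smul' := fun c φ => ?_ }, fun K hK => ?_⟩, key⟩
  · have hK : IsCompact (tsupport (φ : E d → ℂ) ∪ tsupport (ψ : E d → ℂ)) := φ.2.2.1.isCompact.union ψ.2.2.1
    rw [key _ _ (hX _ hK φ subset_union_left), key _ _ (hX _ hK ψ subset_union_right),
      key _ _ (hX _ hK (φ + ψ) (tsupport_add _ _)), UDist.convTest_add_right]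
    exact UDist.map_add f₁ _ _
  · rw [key _ _ (hX _ φ.2.2.1 φ subset_rfl),
      key _ _ (hX _ φ.2.2.1 (c • φ) (closure_mono (Function.support_const_smul_subset c _))),
      UDist.convTest_smul_right]
    exact UDist.map_smul f₁ _ _
  · obtain ⟨h, hh, C, H⟩ := UDist.exists_norm_apply_convTest_le f₁ f₂ (X K) hK
    refine ⟨h, hh, C, fun φ hφ B hB => ?_⟩
    change ‖v φ‖ ≤ _
    rw [key φ _ (hX K hK φ hφ)]
    exact H φ hφ B hB

theorem IsConvolution.eq {f₁ f₂ w w' : UDist M d} (hc : IsCompact (UDist.supp f₁) ∨ IsCompact (UDist.supp f₂))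
    (h : IsConvolution f₁ f₂ w) (h' : IsConvolution f₁ f₂ w') : w = w' := by
  ext φ
  obtain ⟨χ, -, hχ, -⟩ := exists_cutoff M (isCompact_convSet hc φ.2.2.1) isOpen_univ (subset_univ _)
  obtain ⟨θ, h1, h2⟩ := h φ χ hχ
  obtain ⟨θ', h1', h2'⟩ := h' φ χ hχ
  have e : θ = θ' := by
    ext x
    rw [h1, h1']
  rw [e] at h2
  exact h2.trans h2'.symm

end Convolution

/-! ### Convolution estimates on cones -/

section Localization

variable {M : DefiningSequence} {d : ℕ}

theorem aemeasurable_enorm_mul_sub {F : E d → ℂ} {b : E d → ℝ≥0∞} (hF : AEStronglyMeasurable F)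
    (hb : Measurable b) :
    AEMeasurable (Function.uncurry fun ξ η : E d => ‖F η‖ₑ * b (ξ - η)) (volume.prod volume) :=
  hF.comp_snd.enorm.mul (hb.comp (measurable_fst.sub measurable_snd)).aemeasurable

/-- Young's inequality for the convolution of `L^q` and `L^1`, qualitatively. -/
theorem eLpNorm_lintegral_mul_sub_lt_top {q : ℝ≥0∞} (hq : 1 ≤ q) {F : E d → ℂ} {b : E d → ℝ≥0∞}
    (hF : AEStronglyMeasurable F) (hb : Measurable b) (hFq : eLpNorm F q volume < ∞) (hbi : ∫⁻ η, b η < ∞) :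
    eLpNorm (fun ξ => ∫⁻ η, ‖F η‖ₑ * b (ξ - η)) q volume < ∞ := by
  have hbm : ∀ ξ, Measurable fun η => b (ξ - η) := fun ξ => hb.comp (measurable_const.sub measurable_id)
  have hI : ∀ ξ, ∫⁻ η, b (ξ - η) = ∫⁻ η, b η := fun ξ => lintegral_sub_left_eq_self b ξ
  rcases eq_or_ne q ∞ with rfl | hq'
  · have h1 : ∀ ξ, ∫⁻ η, ‖F η‖ₑ * b (ξ - η) ≤ eLpNorm F ∞ volume * ∫⁻ η, b η := fun ξ => by
      rw [← hI ξ, ← lintegral_const_mul _ (hbm ξ)]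
      refine lintegral_mono_ae ?_
      filter_upwards [ae_le_eLpNormEssSup (f := F) (μ := volume)] with η hη
      rw [eLpNorm_exponent_top]
      gcongr
    refine (eLpNorm_le_of_ae_enorm_bound (Eventually.of_forall h1)).trans_lt ?_
    simpa using ENNReal.mul_lt_top hFq hbi
  · have hq0 : q ≠ 0 := by positivity
    rw [eLpNorm_lt_top_iff_lintegral_rpow_enorm_lt_top hq0 hq'] at hFq ⊢
    set r := q.toReal with hr
    have hr1 : 1 ≤ r := by simpa using ENNReal.toReal_mono hq' hq
    have hr0 : 0 < r := by linarith
    set I := ∫⁻ η, b η with hIdef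
    -- Jensen's inequality for the measure with density `b (ξ - ·)`
    have key : ∀ ξ, ‖∫⁻ η, ‖F η‖ₑ * b (ξ - η)‖ₑ ^ r ≤ (∫⁻ η, ‖F η‖ₑ ^ r * b (ξ - η)) * I ^ (r - 1) := by
      intro ξ
      set ν := volume.withDensity fun η => b (ξ - η) with hν
      have hw : ∀ g : E d → ℝ≥0∞, AEMeasurable g → ∫⁻ η, g η ∂ν = ∫⁻ η, g η * b (ξ - η) := fun g hg => by
        rw [hν, lintegral_withDensity_eq_lintegral_mul₀ (hbm ξ).aemeasurable hg]
        simp only [Pi.mul_apply, mul_comm]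
      have hνu : ν univ = I := by
        rw [hν, withDensity_apply _ MeasurableSet.univ, Measure.restrict_univ, hI]
      have h1 := eLpNorm_le_eLpNorm_mul_rpow_measure_univ (μ := ν) hq
        (hF.mono_ac (withDensity_absolutelyContinuous _ _))
      rw [eLpNorm_one_eq_lintegral_enorm, hw _ hF.enorm, eLpNorm_eq_lintegral_rpow_enorm_toReal hq0 hq',
        hw _ (hF.enorm.pow_const _), hνu, ← hr] at h1
      rw [enorm_eq_self]
      refine (ENNReal.rpow_le_rpow h1 hr0.le).trans_eq ?_
      rw [ENNReal.mul_rpow_of_nonneg _ _ hr0.le, ← ENNReal.rpow_mul, ← ENNReal.rpow_mul,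
        one_div_mul_cancel hr0.ne', ENNReal.rpow_one]
      congr 2
      rw [ENNReal.toReal_one]
      field_simp
    refine (lintegral_mono key).trans_lt ?_
    have hm : AEMeasurable (Function.uncurry fun ξ η : E d => ‖F η‖ₑ ^ r * b (ξ - η)) (volume.prod volume) :=
      (hF.comp_snd.enorm.pow_const r).mul (hb.comp (measurable_fst.sub measurable_snd)).aemeasurable
    have hIr : I ^ (r - 1) < ∞ := ENNReal.rpow_lt_top_of_nonneg (by linarith) hbi.ne
    rw [lintegral_mul_const' _ _ hIr.ne, lintegral_lintegral_swap hm]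
    have e : ∀ η, ∫⁻ ξ, ‖F η‖ₑ ^ r * b (ξ - η) = ‖F η‖ₑ ^ r * I := fun η => by
      have hbm' : Measurable fun ξ => b (ξ - η) := hb.comp (measurable_id.sub measurable_const)
      rw [lintegral_const_mul _ hbm', lintegral_sub_right_eq_self b η]
    simp only [e]
    rw [lintegral_mul_const' _ _ hbi.ne]
    exact ENNReal.mul_lt_top (ENNReal.mul_lt_top hFq hbi) hIr

/-- A smaller cone, whose points are far from the complement of the given one. -/
theorem IsOpenCone.exists_subcone {Γ : Set (E d)} (h : IsOpenCone Γ) {ξ₀ : E d} (hξ : ξ₀ ∈ Γ) :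
    ∃ Γ', IsOpenCone Γ' ∧ ξ₀ ∈ Γ' ∧ Γ' ⊆ Γ ∧ ∃ c ≥ 0, ∀ ξ ∈ Γ', ∀ η ∉ Γ,
      ‖ξ‖ ≤ c * ‖ξ - η‖ ∧ ‖η‖ ≤ c * ‖ξ - η‖ := by
  obtain ⟨hΓ, h0, hc⟩ := h
  obtain ⟨ε, hε, hb⟩ := Metric.isOpen_iff.1 hΓ ξ₀ hξ
  set δ := ε / 2 with hδ
  have hδ0 : 0 < δ := by positivity
  have hb' : Metric.ball ξ₀ δ ⊆ Γ := (Metric.ball_subset_ball (by linarith)).trans hb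
  have hsub : ∀ ξ, ∀ t > (0 : ℝ), t • ξ ∈ Γ → ξ ∈ Γ := fun ξ t ht hξ => by
    have := hc _ hξ t⁻¹ (by positivity)
    rwa [inv_smul_smul₀ ht.ne'] at this
  -- the cone generated by a ball of half the radius
  refine ⟨{ξ | ∃ t > (0 : ℝ), t • ξ ∈ Metric.ball ξ₀ δ}, ⟨?_, ?_, ?_⟩, ⟨1, one_pos, by simpa using hδ0⟩, ?_,
    (‖ξ₀‖ + δ) / δ + 1, by positivity, ?_⟩
  · have e : {ξ : E d | ∃ t > (0 : ℝ), t • ξ ∈ Metric.ball ξ₀ δ}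
        = ⋃ t : ℝ, ⋃ _ : 0 < t, (fun ξ : E d => t • ξ) ⁻¹' Metric.ball ξ₀ δ := by
      ext ξ
      simp
    rw [e]
    exact isOpen_iUnion fun t => isOpen_iUnion fun _ => Metric.isOpen_ball.preimage (continuous_const_smul t)
  · rintro ⟨t, -, ht⟩
    rw [smul_zero] at ht
    exact h0 (hb' ht)
  · rintro ξ ⟨t, ht, hξ⟩ s hs
    refine ⟨t / s, by positivity, ?_⟩
    rwa [smul_smul, div_mul_cancel₀ _ hs.ne']
  · rintro ξ ⟨t, ht, hξ⟩
    exact hsub ξ t ht (hb' hξ)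
  · rintro ξ ⟨t, ht, hξ⟩ η hη
    have h1 : ε ≤ ‖t • η - ξ₀‖ := by
      by_contra hlt
      exact hη (hsub η t ht (hb (by rw [mem_ball_iff_norm]; exact not_le.1 hlt)))
    rw [mem_ball_iff_norm] at hξ
    have h2 : δ ≤ t * ‖ξ - η‖ := by
      have h3 : ‖t • η - ξ₀‖ ≤ ‖t • (ξ - η)‖ + ‖t • ξ - ξ₀‖ := by
        calc ‖t • η - ξ₀‖ = ‖-(t • (ξ - η)) + (t • ξ - ξ₀)‖ := by rw [smul_sub]; congr 1; abel
          _ ≤ _ := (norm_add_le _ _).trans_eq (by rw [norm_neg])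
      rw [norm_smul, Real.norm_of_nonneg ht.le] at h3
      linarith
    have h4 : t * ‖ξ‖ ≤ ‖ξ₀‖ + δ := by
      have h3 : ‖t • ξ‖ ≤ ‖t • ξ - ξ₀‖ + ‖ξ₀‖ := by
        calc ‖t • ξ‖ = ‖(t • ξ - ξ₀) + ξ₀‖ := by simp
          _ ≤ _ := norm_add_le _ _
      rw [norm_smul, Real.norm_of_nonneg ht.le] at h3
      linarith
    have h5 : ‖ξ‖ ≤ (‖ξ₀‖ + δ) / δ * ‖ξ - η‖ := by
      refine le_of_mul_le_mul_left ?_ ht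
      calc t * ‖ξ‖ ≤ ‖ξ₀‖ + δ := h4
        _ = (‖ξ₀‖ + δ) / δ * δ := by field_simp
        _ ≤ (‖ξ₀‖ + δ) / δ * (t * ‖ξ - η‖) := by gcongr
        _ = _ := by ring
    have h6 : ‖η‖ ≤ ‖ξ‖ + ‖ξ - η‖ := by
      calc ‖η‖ = ‖ξ - (ξ - η)‖ := by simp
        _ ≤ _ := norm_sub_le _ _
    rw [add_mul, one_mul]
    exact ⟨h5.trans (by linarith [norm_nonneg (ξ - η)]), by linarith⟩

/-- Convolution with a rapidly decreasing function preserves weighted integrability on a cone, up to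
shrinking the cone: the part of `F` outside the cone contributes a rapidly decreasing term. -/
theorem exists_cone_eLpNorm_conv_lt_top {q : ℝ≥0∞} (hq : 1 ≤ q) (ω : ModerateWeight M d) {F a : E d → ℂ}
    (hF : UltraGrowth M F) (ha : Rapid M a) (hac : Continuous a) {Γ : Set (E d)} (hΓ : IsOpenCone Γ) {ξ₀ : E d}
    (hξ₀ : ξ₀ ∈ Γ) (h : eLpNorm (fun ξ => F ξ * (ω ξ : ℂ)) q (volume.restrict Γ) < ∞) :
    ∃ Γ', IsOpenCone Γ' ∧ ξ₀ ∈ Γ' ∧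
      eLpNorm (fun ξ => conv F a ξ * (ω ξ : ℂ)) q (volume.restrict Γ') < ∞ := by
  obtain ⟨Γ', hΓ', hξ', -, c, hc, hcΓ⟩ := hΓ.exists_subcone hξ₀
  refine ⟨Γ', hΓ', hξ', ?_⟩
  obtain ⟨hFm, k, hk, C, hC, hFC⟩ := hF
  obtain ⟨Cω, hω⟩ := ω.moderate
  obtain ⟨Cw, hCw, hωw⟩ := ω.exists_le_wt
  have hΓm : MeasurableSet Γ := hΓ.1.measurableSet
  set b : E d → ℝ≥0∞ := fun ζ => ENNReal.ofReal (Cω * (M.wt (1 * ‖ζ‖) * ‖a ζ‖)) with hb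
  have hbm : Measurable b :=
    (((M.measurable_wt_norm 1).mul hac.norm.measurable).const_mul Cω).ennreal_ofReal
  have hbi : ∫⁻ ζ, b ζ < ∞ := ((ha.rapidL1.2 1 zero_le_one).const_mul Cω).lintegral_lt_top
  have hFω : AEStronglyMeasurable fun ξ => F ξ * (ω ξ : ℂ) := hFm.mul ω.aestronglyMeasurable_ofReal
  have hY := eLpNorm_lintegral_mul_sub_lt_top hq (hFω.indicator hΓm) hbm
    (by rwa [eLpNorm_indicator_eq_eLpNorm_restrict hΓm]) hbi
  -- the decay of `a` dominates the growth of `F` and `ω` when `η` lies outside the cone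
  obtain ⟨D, hD, hfar⟩ : ∃ D ≥ 0, ∀ ξ ∈ Γ', ∀ η ∉ Γ,
      ‖F η‖ * ‖a (ξ - η)‖ * ω ξ ≤ D * ((M.wt (1 * ‖ξ‖))⁻¹ * (M.wt (1 * ‖η‖))⁻¹) := by
    obtain ⟨A₁, hA₁, K₁, hK₁, H₁⟩ := M.exists_wt_mul_wt_le hc hc
    obtain ⟨A₂, hA₂, K₂, hK₂, H₂⟩ := M.exists_wt_mul_wt_le (mul_nonneg hk hc) hc
    obtain ⟨A₃, hA₃, K₃, hK₃, H₃⟩ := M.exists_wt_mul_wt_le (show (0 : ℝ) ≤ K₁ by linarith)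
      (show (0 : ℝ) ≤ K₂ by linarith)
    obtain ⟨B, hB⟩ := ha.2 K₃ (by linarith)
    have hB0 : 0 ≤ B := (mul_nonneg (M.wt_pos _).le (norm_nonneg _)).trans (hB 0)
    refine ⟨C * Cw * (A₁ * A₂ * A₃ * B), by positivity, fun ξ hξ η hη => ?_⟩
    obtain ⟨h1, h2⟩ := hcΓ ξ hξ η hη
    set ρ := ‖ξ - η‖ with hρ
    have hρ0 : 0 ≤ ρ := norm_nonneg _
    have w1 := M.wt_pos (1 * ‖ξ‖)
    have w2 := M.wt_pos (1 * ‖η‖)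
    have w3 := M.wt_pos (c * ρ)
    have w4 := M.wt_pos (k * c * ρ)
    have hξc : M.wt (1 * ‖ξ‖) ≤ M.wt (c * ρ) := M.wt_mono (by positivity) (by rwa [one_mul])
    have hηc : M.wt (1 * ‖η‖) ≤ M.wt (c * ρ) := M.wt_mono (by positivity) (by rwa [one_mul])
    have hηk : M.wt (k * ‖η‖) ≤ M.wt (k * c * ρ) := M.wt_mono (by positivity) (by rw [mul_assoc]; gcongr)
    have hF1 : ‖F η‖ ≤ C * M.wt (k * c * ρ) := (hFC η).trans (by gcongr)
    have hω1 : ω ξ ≤ Cw * M.wt (c * ρ) := (hωw ξ).1.trans (by rw [one_mul] at hξc; gcongr)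
    have hωp := ω.pos ξ
    rw [← mul_inv, ← div_eq_mul_inv, le_div_iff₀ (by positivity)]
    have hH := hB (ξ - η)
    rw [← hρ] at hH
    have wK1 := M.wt_pos (K₁ * ρ)
    have wK2 := M.wt_pos (K₂ * ρ)
    calc ‖F η‖ * ‖a (ξ - η)‖ * ω ξ * (M.wt (1 * ‖ξ‖) * M.wt (1 * ‖η‖))
        ≤ C * M.wt (k * c * ρ) * ‖a (ξ - η)‖ * (Cw * M.wt (c * ρ)) * (M.wt (c * ρ) * M.wt (c * ρ)) := by
          gcongr
      _ = C * Cw * ((M.wt (c * ρ) * M.wt (c * ρ)) * (M.wt (k * c * ρ) * M.wt (c * ρ)) * ‖a (ξ - η)‖) := by ring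
      _ ≤ C * Cw * ((A₁ * M.wt (K₁ * ρ)) * (A₂ * M.wt (K₂ * ρ)) * ‖a (ξ - η)‖) := by
          refine mul_le_mul_of_nonneg_left (mul_le_mul_of_nonneg_right ?_ (norm_nonneg _)) (by positivity)
          exact mul_le_mul (H₁ ρ hρ0) (H₂ ρ hρ0) (by positivity) (by positivity)
      _ = C * Cw * (A₁ * A₂ * (M.wt (K₁ * ρ) * M.wt (K₂ * ρ)) * ‖a (ξ - η)‖) := by ring
      _ ≤ C * Cw * (A₁ * A₂ * (A₃ * M.wt (K₃ * ρ)) * ‖a (ξ - η)‖) := by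
          refine mul_le_mul_of_nonneg_left (mul_le_mul_of_nonneg_right ?_ (norm_nonneg _)) (by positivity)
          exact mul_le_mul_of_nonneg_left (H₃ ρ hρ0) (by positivity)
      _ = C * Cw * (A₁ * A₂ * A₃ * (M.wt (K₃ * ρ) * ‖a (ξ - η)‖)) := by ring
      _ ≤ _ := by gcongr
  set J := ∫⁻ η : E d, ENNReal.ofReal (D * (M.wt (1 * ‖η‖))⁻¹) with hJ
  have hJi : J < ∞ := ((M.integrable_inv_wt one_pos).const_mul D).lintegral_lt_top
  set G₁ : E d → ℝ≥0∞ := fun ξ => ∫⁻ η, ‖Γ.indicator (fun ξ => F ξ * (ω ξ : ℂ)) η‖ₑ * b (ξ - η) with hG₁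
  set G₂ : E d → ℝ := fun ξ => J.toReal * (M.wt (1 * ‖ξ‖))⁻¹ with hG₂
  have hG₂n : ∀ ξ, 0 ≤ G₂ ξ := fun ξ => mul_nonneg ENNReal.toReal_nonneg (inv_nonneg.2 (M.wt_pos _).le)
  have hbound : ∀ ξ ∈ Γ', ‖conv F a ξ * (ω ξ : ℂ)‖ₑ ≤ ‖(G₁ + fun ξ => ‖G₂ ξ‖ₑ) ξ‖ₑ := by
    intro ξ hξ
    have hωe : ‖(ω ξ : ℂ)‖ₑ = ENNReal.ofReal (ω ξ) := by
      rw [← ofReal_norm, Complex.norm_real, Real.norm_of_nonneg (ω.pos ξ).le]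
    have h1 : ‖conv F a ξ * (ω ξ : ℂ)‖ₑ ≤ ∫⁻ η, ‖F η * a (ξ - η) * (ω ξ : ℂ)‖ₑ := by
      rw [conv, ← integral_mul_const]
      exact enorm_integral_le_lintegral_enorm _
    refine h1.trans ?_
    rw [enorm_eq_self, Pi.add_apply, ← lintegral_add_compl _ hΓm]
    refine add_le_add ?_ ?_
    · rw [hG₁, ← lintegral_indicator hΓm]
      refine lintegral_mono fun η => ?_
      by_cases hη : η ∈ Γ
      · rw [indicator_of_mem hη, indicator_of_mem hη, hb, ← ofReal_norm, ← ofReal_norm,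
          ← ENNReal.ofReal_mul (norm_nonneg _)]
        refine ENNReal.ofReal_le_ofReal ?_
        have h2 := hω (ξ - η) η
        rw [sub_add_cancel] at h2
        change ω ξ ≤ Cω * (M.wt ‖ξ - η‖ * ω η) at h2
        simp only [norm_mul, Complex.norm_real, Real.norm_of_nonneg (ω.pos _).le, one_mul]
        calc ‖F η‖ * ‖a (ξ - η)‖ * ω ξ ≤ ‖F η‖ * ‖a (ξ - η)‖ * (Cω * (M.wt ‖ξ - η‖ * ω η)) := by gcongr
          _ = _ := by ring
      · rw [indicator_of_notMem hη]
        exact zero_le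
    · have h3 : ∫⁻ η in Γᶜ, ‖F η * a (ξ - η) * (ω ξ : ℂ)‖ₑ
          ≤ ∫⁻ η in Γᶜ, ENNReal.ofReal (M.wt (1 * ‖ξ‖))⁻¹ * ENNReal.ofReal (D * (M.wt (1 * ‖η‖))⁻¹) := by
        refine setLIntegral_mono_ae' hΓm.compl (Eventually.of_forall fun η hη => ?_)
        rw [← ofReal_norm, ← ENNReal.ofReal_mul (inv_nonneg.2 (M.wt_pos _).le)]
        refine ENNReal.ofReal_le_ofReal ?_
        rw [norm_mul, norm_mul, Complex.norm_real, Real.norm_of_nonneg (ω.pos _).le]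
        refine (hfar ξ hξ η hη).trans_eq ?_
        ring
      refine h3.trans ((setLIntegral_le_lintegral _ _).trans_eq ?_)
      rw [lintegral_const_mul' _ _ ENNReal.ofReal_ne_top, ← hJ, ← ofReal_norm, Real.norm_of_nonneg (hG₂n ξ), hG₂,
        ENNReal.ofReal_mul ENNReal.toReal_nonneg, ENNReal.ofReal_toReal hJi.ne, mul_comm]
  refine (eLpNorm_mono_enorm_ae (ae_restrict_of_forall_mem hΓ'.1.measurableSet hbound)).trans_lt ?_
  refine (eLpNorm_mono_measure _ Measure.restrict_le_self).trans_lt ?_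
  have hG₂m : AEStronglyMeasurable G₂ := (((M.measurable_wt_norm 1).inv).const_mul _).aestronglyMeasurable
  have hG₁m : AEMeasurable G₁ :=
    (aemeasurable_enorm_mul_sub (hFω.indicator hΓm) hbm).lintegral_prod_right'
  refine (eLpNorm_add_le hG₁m.aestronglyMeasurable hG₂m.enorm.aestronglyMeasurable hq).trans_lt
    (ENNReal.add_lt_top.2 ⟨hY, ?_⟩)
  rw [eLpNorm_enorm]
  have hG₂c : MemLp (fun ξ => (G₂ ξ : ℂ)) q (volume : Measure (E d)) := by
    refine memLp_of_le_inv_wt (M := M) one_pos (C := J.toReal)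
      (Complex.continuous_ofReal.comp_aestronglyMeasurable hG₂m) (fun ξ => ?_) hq
    rw [Complex.norm_real, Real.norm_of_nonneg (hG₂n ξ)]
  refine lt_of_le_of_lt (eLpNorm_mono_enorm_ae (Eventually.of_forall fun ξ => ?_)) hG₂c.2
  rw [← ofReal_norm, ← ofReal_norm, Complex.norm_real]

end Localization

/-! ### Wave-front sets of convolutions -/

section WaveFrontConv

variable {M : DefiningSequence} {d : ℕ}

theorem IsFourierOf.hasFourier {f : UDist M d} {χ : TestFun M d} {F : E d → ℂ} (h : IsFourierOf f χ F)
    (hF : UltraTempered M F) : HasFourier (UDist.cutoff χ f) F := by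
  refine ⟨hF.1, fun ψ => ⟨hF.integrable_mul (GS.rapid_fourierInv ψ), ?_⟩⟩
  rw [← h _ (GS.rapid_fourierInv ψ)]
  change f (TestFun.mulGS χ ψ) = _
  congr 1
  ext x
  rw [TestFun.mulUD_apply, GS.fourier_fourierInv M ψ]
  rfl

theorem mem_regularDirections_iff {q : ℝ≥0∞} {ω : ModerateWeight M d} {u : GSDual d} {ξ₀ : E d} :
    ξ₀ ∈ regularDirections q ω u ↔ ∃ Γ, IsOpenCone Γ ∧ ξ₀ ∈ Γ ∧ ∃ g, HasFourier u g ∧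
      eLpNorm (fun ξ => g ξ * (ω ξ : ℂ)) q (volume.restrict Γ) < ∞ := by
  constructor
  · rintro ⟨Γ, hΓ, hξ, h⟩
    exact ⟨Γ, hΓ, hξ, exists_hasFourier_of_flSeminorm_lt_top h⟩
  · rintro ⟨Γ, hΓ, hξ, g, hg, h⟩
    exact ⟨Γ, hΓ, hξ, (hg.flSeminorm_eq q ω Γ).trans_lt h⟩

/-- Outside the wave-front set, the defining property holds for cut-off functions that are equal to `1` near the
base point. -/
theorem exists_cutoff_of_notMem_waveFrontSet (hsub : Submultiplicative (M.expWeight (d := d))) {q : ℝ≥0∞}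
    (hq : 1 ≤ q) {ω : ModerateWeight M d} {f : UDist M d} {y ξ₀ : E d} (hξ₀ : ξ₀ ≠ 0)
    (h : (y, ξ₀) ∉ waveFrontSet q ω f) :
    ∃ r > 0, ∃ s : TestFun M d, (∀ z ∈ Metric.ball y r, (s : E d → ℂ) z = 1) ∧
      ∃ F, UltraGrowth M F ∧ IsFourierOf f s F ∧ ∃ Γ, IsOpenCone Γ ∧ ξ₀ ∈ Γ ∧
        eLpNorm (fun ξ => F ξ * (ω ξ : ℂ)) q (volume.restrict Γ) < ∞ := by
  obtain ⟨χ, hχ, hreg⟩ : ∃ χ : TestFun M d, (χ : E d → ℂ) y ≠ 0 ∧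
      ξ₀ ∈ regularDirections q ω (UDist.cutoff χ f) := by
    by_contra hne
    push Not at hne
    exact h ⟨hξ₀, fun φ hφ => ⟨hξ₀, hne φ hφ⟩⟩
  obtain ⟨V, hV, hyV, hdiv⟩ := TestFun.exists_eq_mul hsub χ hχ
  obtain ⟨ε, hε, hεV⟩ := Metric.isOpen_iff.1 hV y hyV
  obtain ⟨s, hs, hs1, -⟩ := exists_cutoff M (isCompact_closedBall y (ε / 2)) hV
    ((Metric.closedBall_subset_ball (half_lt_self hε)).trans hεV)
  obtain ⟨Ψ, hΨ⟩ := hdiv s hs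
  obtain ⟨F, hF, hFχ⟩ := UDist.exists_isFourierOf f χ
  have hFχ' : IsFourierOf f χ F := fun a ha => hFχ a ha.rapidL1
  obtain ⟨Γ, hΓ, hξΓ, hΓF⟩ := hreg
  rw [(hFχ'.hasFourier hF.ultraTempered).flSeminorm_eq] at hΓF
  -- `s f = Ψ χ f`, whose Fourier transform is the convolution of that of `χ f` with `𝓕 Ψ`
  obtain ⟨h1, h2⟩ := hFχ'.mul hF.ultraTempered Ψ
  obtain ⟨Γ', hΓ', hξΓ', h3⟩ := exists_cone_eLpNorm_conv_lt_top hq ω hF (TestFun.rapid_fourier Ψ)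
    (continuous_fourier (TestFun.integrable Ψ)) hΓ hξΓ hΓF
  refine ⟨ε / 2, half_pos hε, s, fun z hz => ?_, _, h1, fun a ha => ?_, Γ', hΓ', hξΓ', h3⟩
  · exact (eventually_nhdsSet_iff_forall.1 hs1 z (Metric.ball_subset_closedBall hz)).self_of_nhds
  · rw [hΨ]
    exact h2 a ha.rapidL1

/-- The functional `v` has a Fourier transform that is a function in the weighted `L^q` space on a conical
neighbourhood of `ξ₀`. -/
def RegularToward (q : ℝ≥0∞) (ω : ModerateWeight M d) (ξ₀ : E d) (v : GS d → ℂ) : Prop :=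
  ∃ Γ, IsOpenCone Γ ∧ ξ₀ ∈ Γ ∧ ∃ g, UltraGrowth M g ∧ (∀ ψ : GS d, v ψ = ∫ ξ, g ξ * 𝓕⁻ (ψ : E d → ℂ) ξ) ∧
    eLpNorm (fun ξ => g ξ * (ω ξ : ℂ)) q (volume.restrict Γ) < ∞

theorem UltraGrowth.add {F G : E d → ℂ} (hF : UltraGrowth M F) (hG : UltraGrowth M G) : UltraGrowth M (F + G) := by
  obtain ⟨hFm, k, hk, C, hC, HF⟩ := hF
  obtain ⟨hGm, l, hl, D, hD, HG⟩ := hG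
  refine ⟨hFm.add hGm, max k l, le_max_of_le_left hk, C + D, by positivity, fun ξ => ?_⟩
  have h1 : M.wt (k * ‖ξ‖) ≤ M.wt (max k l * ‖ξ‖) := M.wt_mono (by positivity) (by gcongr; exact le_max_left _ _)
  have h2 : M.wt (l * ‖ξ‖) ≤ M.wt (max k l * ‖ξ‖) := M.wt_mono (by positivity) (by gcongr; exact le_max_right _ _)
  calc ‖(F + G) ξ‖ ≤ ‖F ξ‖ + ‖G ξ‖ := norm_add_le (F ξ) (G ξ)
    _ ≤ C * M.wt (k * ‖ξ‖) + D * M.wt (l * ‖ξ‖) := by linarith [HF ξ, HG ξ]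
    _ ≤ C * M.wt (max k l * ‖ξ‖) + D * M.wt (max k l * ‖ξ‖) := by gcongr
    _ = _ := by ring

theorem UltraGrowth.mul {F G : E d → ℂ} (hF : UltraGrowth M F) (hG : UltraGrowth M G) :
    UltraGrowth M fun ξ => F ξ * G ξ := by
  obtain ⟨hFm, k, hk, C, hC, HF⟩ := hF
  obtain ⟨hGm, l, hl, D, hD, HG⟩ := hG
  obtain ⟨A, hA, K, hK, hAK⟩ := M.exists_wt_mul_wt_le hk hl
  refine ⟨hFm.mul hGm, K, by linarith, C * D * A, by positivity, fun ξ => ?_⟩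
  have h1 := M.wt_pos (k * ‖ξ‖)
  rw [norm_mul]
  calc ‖F ξ‖ * ‖G ξ‖ ≤ C * M.wt (k * ‖ξ‖) * (D * M.wt (l * ‖ξ‖)) :=
        mul_le_mul (HF ξ) (HG ξ) (norm_nonneg _) (by positivity)
    _ = C * D * (M.wt (k * ‖ξ‖) * M.wt (l * ‖ξ‖)) := by ring
    _ ≤ C * D * (A * M.wt (K * ‖ξ‖)) :=
      mul_le_mul_of_nonneg_left (hAK _ (norm_nonneg ξ)) (by positivity)
    _ = _ := by ring

theorem RegularToward.zero (q : ℝ≥0∞) (ω : ModerateWeight M d) {ξ₀ : E d} (hξ₀ : ξ₀ ≠ 0) :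
    RegularToward q ω ξ₀ fun _ => 0 := by
  refine ⟨{0}ᶜ, ⟨isOpen_compl_singleton, by simp, fun ξ hξ t ht => smul_ne_zero ht.ne' hξ⟩, hξ₀, 0,
    ⟨aestronglyMeasurable_const, 0, le_rfl, 0, le_rfl, fun ξ => by simp⟩, fun ψ => by simp, by simp⟩

theorem RegularToward.add {q : ℝ≥0∞} (hq : 1 ≤ q) {ω : ModerateWeight M d} {ξ₀ : E d} {u v : GS d → ℂ}
    (hu : RegularToward q ω ξ₀ u) (hv : RegularToward q ω ξ₀ v) : RegularToward q ω ξ₀ fun ψ => u ψ + v ψ := by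
  obtain ⟨Γ, hΓ, hξ, g, hg, h1, h2⟩ := hu
  obtain ⟨Γ', hΓ', hξ', g', hg', h1', h2'⟩ := hv
  refine ⟨Γ ∩ Γ', ⟨hΓ.1.inter hΓ'.1, fun h => hΓ.2.1 h.1, fun ξ hξ t ht => ⟨hΓ.2.2 ξ hξ.1 t ht, hΓ'.2.2 ξ hξ.2 t ht⟩⟩,
    ⟨hξ, hξ'⟩, g + g', hg.add hg', fun ψ => ?_, ?_⟩
  · have hr := GS.rapid_fourierInv (M := M) ψ
    simp only [h1, h1', Pi.add_apply, add_mul]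
    exact (integral_add (hg.ultraTempered.integrable_mul hr) (hg'.ultraTempered.integrable_mul hr)).symm
  · have hm := ω.aestronglyMeasurable_ofReal
    have e : (fun ξ => (g + g') ξ * (ω ξ : ℂ)) = (fun ξ => g ξ * (ω ξ : ℂ)) + fun ξ => g' ξ * (ω ξ : ℂ) := by
      ext ξ
      exact add_mul _ _ _
    rw [e]
    refine (eLpNorm_add_le (hg.1.mul hm).restrict (hg'.1.mul hm).restrict hq).trans_lt
      (ENNReal.add_lt_top.2 ⟨?_, ?_⟩)
    · exact (eLpNorm_mono_measure _ (Measure.restrict_mono inter_subset_left le_rfl)).trans_lt h2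
    · exact (eLpNorm_mono_measure _ (Measure.restrict_mono inter_subset_right le_rfl)).trans_lt h2'

/-- If `f₁` is localized near `x` and the convolution near `x + y`, then only the localization of `f₂` near `y`
matters. On the Fourier side, the localized convolution is `(F₁ F₂) * 𝓕 φ`, and Hölder's inequality applies to
`F₁ F₂`. -/
theorem exists_ball_regularToward {q q₁ q₂ : ℝ≥0∞} [Fact (1 ≤ q)] [Fact (1 ≤ q₁)] [Fact (1 ≤ q₂)]
    (hq : 1 / q₁ + 1 / q₂ = 1 / q) {ω ω₁ ω₂ : ModerateWeight M d} {C : ℝ} (hC : ∀ ξ, ω ξ ≤ C * (ω₁ ξ * ω₂ ξ))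
    (hsub : Submultiplicative (M.expWeight (d := d))) {f₁ f₂ : UDist M d} (hf₁ : f₁ ∈ FLloc q₁ ω₁) (x : E d)
    {y ξ₀ : E d} (hξ₀ : ξ₀ ≠ 0) (h : (y, ξ₀) ∉ waveFrontSet q₂ ω₂ f₂) :
    ∃ r > 0, ∀ ρ φ : TestFun M d, tsupport (ρ : E d → ℂ) ⊆ Metric.ball x r →
      tsupport (φ : E d → ℂ) ⊆ Metric.ball (x + y) r →
        RegularToward q ω ξ₀ fun ψ => f₁ (UDist.convTest f₂ ρ (TestFun.mulGS φ ψ)) := by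
  obtain ⟨r, hr, s, hs, F, hF, hFs, Γ, hΓ, hξΓ, hΓF⟩ :=
    exists_cutoff_of_notMem_waveFrontSet hsub Fact.out hξ₀ h
  refine ⟨r / 2, half_pos hr, fun ρ φ hρ hφ => ?_⟩
  obtain ⟨F₁, hF₁, hFρ⟩ := UDist.exists_isFourierOf f₁ ρ
  have hFρ' : IsFourierOf f₁ ρ F₁ := fun a ha => hFρ a ha.rapidL1
  have h₁ : eLpNorm (fun ξ => F₁ ξ * (ω₁ ξ : ℂ)) q₁ (volume.restrict Γ) < ∞ := by
    have h2 : flSeminorm q₁ ω₁ univ (UDist.cutoff ρ f₁) < ∞ := hf₁ ρ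
    rw [(hFρ'.hasFourier hF₁.ultraTempered).flSeminorm_eq] at h2
    exact (eLpNorm_mono_measure _ (Measure.restrict_mono (subset_univ _) le_rfl)).trans_lt h2
  have h₂ := (eLpNorm_mul_weight_le hC hq (μ := volume.restrict Γ) Measure.restrict_le_self hF₁.1 hF.1).trans_lt
    (ENNReal.mul_lt_top ENNReal.ofReal_lt_top (ENNReal.mul_lt_top h₁ hΓF))
  have hG := hF₁.mul hF
  have hφr := TestFun.rapid_fourier φ
  have hφi := TestFun.rapid_fourierInv φ
  obtain ⟨Γ', hΓ', hξΓ', h3⟩ := exists_cone_eLpNorm_conv_lt_top (Fact.out : 1 ≤ q) ω hG hφr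
    (continuous_fourier (TestFun.integrable φ)) hΓ hξΓ h₂
  refine ⟨Γ', hΓ', hξΓ', _, ⟨aestronglyMeasurable_conv hG.1 hφr.1, hG.ultraTempered.exists_norm_conv_le hφr⟩,
    fun ψ => ?_, h3⟩
  -- `z = (x' + z) - x'` lies within `r` of `y`, where `s = 1`
  have htr : ∀ x' ∈ tsupport (ρ : E d → ℂ), f₂ (TestFun.translate x' (TestFun.mulGS φ ψ))
      = 𝓕 (fun ξ => F ξ * 𝓕⁻ (TestFun.mulGS φ ψ : E d → ℂ) ξ) x' := by
    refine fun x' hx' => hFs.apply_translate fun z hz => hs z ?_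
    have hz' : (φ : E d → ℂ) (x' + z) ≠ 0 := fun h0 => hz (by
      change (φ : E d → ℂ) (x' + z) * _ = 0
      rw [h0, zero_mul])
    have h4 := hφ (subset_tsupport _ hz')
    have h5 := hρ hx'
    rw [mem_ball_iff_norm] at h4 h5 ⊢
    calc ‖z - y‖ = ‖(x' + z - (x + y)) - (x' - x)‖ := by congr 1; abel
      _ ≤ ‖x' + z - (x + y)‖ + ‖x' - x‖ := norm_sub_le _ _
      _ < r := by linarith
  have hb := hF.mul_rapid (TestFun.rapid_fourierInv (TestFun.mulGS φ ψ))
  have e1 : (fun ζ => 𝓕⁻ (φ : E d → ℂ) (-ζ)) = 𝓕 (φ : E d → ℂ) := by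
    ext ζ
    rw [Real.fourierInv_eq_fourier_neg, neg_neg]
  have e2 : ∀ ξ, 𝓕⁻ (TestFun.mulGS φ ψ : E d → ℂ) ξ = conv (𝓕⁻ (φ : E d → ℂ)) (𝓕⁻ (ψ : E d → ℂ)) ξ := fun ξ => by
    rw [← fourierInv_fourier_mul hφi.integrable (GS.integrable ψ), TestFun.fourier_fourierInv φ]
    rfl
  change f₁ (UDist.convTest f₂ ρ (TestFun.mulGS φ ψ)) = _
  rw [UDist.convTest_eq f₂ ρ hb.rapidL1 htr, hFρ' _ hb, ← e1,
    ← hG.ultraTempered.integral_mul_conv hφi (GS.rapid_fourierInv ψ).rapidL1]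
  simp only [e2, mul_assoc]

/-- Compactness of the support of the cut-off function reduces the convolution to the local situation. -/
theorem exists_ball_regularToward_convTest {q q₁ q₂ : ℝ≥0∞} [Fact (1 ≤ q)] [Fact (1 ≤ q₁)] [Fact (1 ≤ q₂)]
    (hq : 1 / q₁ + 1 / q₂ = 1 / q) {ω ω₁ ω₂ : ModerateWeight M d} {C : ℝ} (hC : ∀ ξ, ω ξ ≤ C * (ω₁ ξ * ω₂ ξ))
    (hsub : Submultiplicative (M.expWeight (d := d))) {f₁ f₂ : UDist M d} (hf₁ : f₁ ∈ FLloc q₁ ω₁)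
    {x₀ ξ₀ : E d} (hξ₀ : ξ₀ ≠ 0) (h : ∀ x ∈ UDist.supp f₁, (x₀ - x, ξ₀) ∉ waveFrontSet q₂ ω₂ f₂)
    (χ : TestFun M d) : ∃ r > 0, ∀ φ : TestFun M d, tsupport (φ : E d → ℂ) ⊆ Metric.ball x₀ r →
      RegularToward q ω ξ₀ fun ψ => f₁ (UDist.convTest f₂ χ (TestFun.mulGS φ ψ)) := by
  suffices H : ∃ U, IsOpen U ∧ tsupport (χ : E d → ℂ) ⊆ U ∧ ∃ r > 0, ∀ ρ φ : TestFun M d,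
      tsupport (ρ : E d → ℂ) ⊆ U → tsupport (φ : E d → ℂ) ⊆ Metric.ball x₀ r →
        RegularToward q ω ξ₀ fun ψ => f₁ (UDist.convTest f₂ ρ (TestFun.mulGS φ ψ)) by
    obtain ⟨U, -, hU, r, hr, H⟩ := H
    exact ⟨r, hr, fun φ hφ => H χ φ hU hφ⟩
  have hzero : ∀ ρ : TestFun M d, Disjoint (tsupport (ρ : E d → ℂ)) (UDist.supp f₁) → ∀ φ : TestFun M d,
      RegularToward q ω ξ₀ fun ψ => f₁ (UDist.convTest f₂ ρ (TestFun.mulGS φ ψ)) := fun ρ hρ φ => by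
    have e : (fun ψ => f₁ (UDist.convTest f₂ ρ (TestFun.mulGS φ ψ))) = fun _ => (0 : ℂ) := by
      ext ψ
      exact UDist.apply_eq_zero f₁ (hρ.mono_left (UDist.tsupport_convTest_subset f₂ _ _))
    rw [e]
    exact RegularToward.zero q ω hξ₀
  refine IsCompact.induction_on (p := fun S => ∃ U, IsOpen U ∧ S ⊆ U ∧ ∃ r > 0, ∀ ρ φ : TestFun M d,
      tsupport (ρ : E d → ℂ) ⊆ U → tsupport (φ : E d → ℂ) ⊆ Metric.ball x₀ r →
        RegularToward q ω ξ₀ fun ψ => f₁ (UDist.convTest f₂ ρ (TestFun.mulGS φ ψ))) χ.2.2.1.isCompact ?_ ?_ ?_ ?_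
  · exact ⟨∅, isOpen_empty, subset_rfl, 1, one_pos, fun ρ φ hρ _ =>
      hzero ρ (disjoint_of_subset_left hρ (empty_disjoint _)) φ⟩
  · rintro S T hST ⟨U, hU, hTU, H⟩
    exact ⟨U, hU, hST.trans hTU, H⟩
  · rintro S T ⟨U, hU, hSU, r, hr, H⟩ ⟨V, hV, hTV, r', hr', H'⟩
    refine ⟨U ∪ V, hU.union hV, union_subset_union hSU hTV, min r r', lt_min hr hr', fun ρ φ hρ hφ => ?_⟩
    obtain ⟨σ, h1, h2⟩ := TestFun.exists_split ρ hU hV hρ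
    have h3 : tsupport (TestFun.mulUD ρ (TestFun.ud σ) : E d → ℂ) ⊆ U := by
      refine subset_trans ?_ h1
      exact tsupport_mul_subset_right
    have h4 := (H _ φ h3 (hφ.trans (Metric.ball_subset_ball (min_le_left _ _)))).add Fact.out
      (H' _ φ h2 (hφ.trans (Metric.ball_subset_ball (min_le_right _ _))))
    have e : (fun ψ => f₁ (UDist.convTest f₂ ρ (TestFun.mulGS φ ψ)))
        = fun ψ => f₁ (UDist.convTest f₂ (TestFun.mulUD ρ (TestFun.ud σ)) (TestFun.mulGS φ ψ))
          + f₁ (UDist.convTest f₂ (TestFun.remove σ ρ) (TestFun.mulGS φ ψ)) := by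
      ext ψ
      rw [← UDist.map_add f₁, ← UDist.convTest_add_left, TestFun.mulUD_add_remove]
    rw [e]
    exact h4
  · intro x _
    by_cases hx : x ∈ UDist.supp f₁
    · obtain ⟨r, hr, H⟩ := exists_ball_regularToward hq hC hsub hf₁ x hξ₀ (h x hx)
      rw [add_sub_cancel] at H
      exact ⟨Metric.ball x r, mem_nhdsWithin_of_mem_nhds (Metric.ball_mem_nhds x hr), _, Metric.isOpen_ball,
        subset_rfl, r, hr, H⟩
    · have hU := (UDist.isClosed_supp f₁).isOpen_compl
      exact ⟨(UDist.supp f₁)ᶜ, mem_nhdsWithin_of_mem_nhds (hU.mem_nhds hx), _, hU, subset_rfl, 1, one_pos,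
        fun ρ φ hρ _ => hzero ρ (disjoint_left.2 fun z hz => hρ hz) φ⟩

/-- The wave-front set of a convolution. -/
theorem waveFrontSet_convolution_subset {q q₁ q₂ : ℝ≥0∞} [Fact (1 ≤ q)] [Fact (1 ≤ q₁)] [Fact (1 ≤ q₂)]
    (hq : 1 / q₁ + 1 / q₂ = 1 / q) {ω ω₁ ω₂ : ModerateWeight M d} {C : ℝ} (hC : ∀ ξ, ω ξ ≤ C * (ω₁ ξ * ω₂ ξ))
    (hsub : Submultiplicative (M.expWeight (d := d))) {f₁ f₂ : UDist M d} (hf₁ : f₁ ∈ FLloc q₁ ω₁)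
    (hc : IsCompact (UDist.supp f₁) ∨ IsCompact (UDist.supp f₂)) {w : UDist M d}
    (hw : ∀ φ χ : TestFun M d,
      (∀ᶠ x in 𝓝ˢ (convSet f₁ f₂ (tsupport (φ : E d → ℂ))), (χ : E d → ℂ) x = 1) →
        w φ = f₁ (UDist.convTest f₂ χ φ)) :
    waveFrontSet q ω w ⊆
      {p | ∃ x ∈ UDist.supp f₁, ∃ y, (y, p.2) ∈ waveFrontSet q₂ ω₂ f₂ ∧ p.1 = x + y} := by
  rintro ⟨x₀, ξ₀⟩ ⟨hξ₀, hp⟩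
  by_contra hne
  have h : ∀ x ∈ UDist.supp f₁, (x₀ - x, ξ₀) ∉ waveFrontSet q₂ ω₂ f₂ := fun x hx hmem =>
    hne ⟨x, hx, x₀ - x, hmem, (add_sub_cancel x x₀).symm⟩
  have hK := isCompact_closedBall x₀ (1 : ℝ)
  obtain ⟨χ, -, hχ, -⟩ := exists_cutoff M (isCompact_convSet hc hK) isOpen_univ (subset_univ _)
  obtain ⟨r, hr, H⟩ := exists_ball_regularToward_convTest hq hC hsub hf₁ hξ₀ h χ
  obtain ⟨φ, hφ, hφ1, -⟩ := exists_cutoff M (isCompact_singleton (x := x₀)) Metric.isOpen_ball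
    (singleton_subset_iff.2 (Metric.mem_ball_self (lt_min hr one_pos)))
  have hφ0 : (φ : E d → ℂ) x₀ ≠ 0 := by
    rw [(eventually_nhdsSet_iff_forall.1 hφ1 x₀ rfl).self_of_nhds]
    exact one_ne_zero
  obtain ⟨Γ, hΓ, hξΓ, g, hg, h1, h2⟩ := H φ (hφ.trans (Metric.ball_subset_ball (min_le_left _ _)))
  refine (hp φ hφ0).2 (mem_regularDirections_iff.2 ⟨Γ, hΓ, hξΓ, g, ⟨hg.1, fun ψ =>
    ⟨hg.ultraTempered.integrable_mul (GS.rapid_fourierInv ψ), ?_⟩⟩, h2⟩)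
  rw [← h1 ψ]
  refine hw (TestFun.mulGS φ ψ) χ (hχ.filter_mono (nhdsSet_mono (convSet_mono ?_)))
  have h3 : tsupport (TestFun.mulGS φ ψ : E d → ℂ) ⊆ tsupport (φ : E d → ℂ) := tsupport_mul_subset_left
  exact h3.trans (hφ.trans ((Metric.ball_subset_ball (min_le_right _ _)).trans Metric.ball_subset_closedBall))

end WaveFrontConv

end UltraWF

theorem mainTheorem6 (M : DefiningSequence) (d : ℕ) (q q₁ q₂ : ℝ≥0∞)
    [Fact (1 ≤ q)] [Fact (1 ≤ q₁)] [Fact (1 ≤ q₂)] (hq : 1 / q₁ + 1 / q₂ = 1 / q)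
    (ω ω₁ ω₂ : ModerateWeight M d) (hω : ∃ C, ∀ ξ, ω ξ ≤ C * (ω₁ ξ * ω₂ ξ)) :
    (∃ T : FL q₁ ω₁ →ₗ[ℂ] FL q₂ ω₂ →ₗ[ℂ] FL q ω,
      Continuous (fun p : FL q₁ ω₁ × FL q₂ ω₂ => T p.1 p.2) ∧
      ExtendsConv (fun p : FL q₁ ω₁ × FL q₂ ω₂ => T p.1 p.2) ∧
      ExtendsConvLeft (fun p : FL q₁ ω₁ × FL q₂ ω₂ => T p.1 p.2) ∧
      ExtendsConvRight (fun p : FL q₁ ω₁ × FL q₂ ω₂ => T p.1 p.2) ∧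
      (q₁ < ∞ → ∀ T' : FL q₁ ω₁ × FL q₂ ω₂ → FL q ω, Continuous T' → ExtendsConvLeft T' →
        T' = fun p => T p.1 p.2) ∧
      (q₂ < ∞ → ∀ T' : FL q₁ ω₁ × FL q₂ ω₂ → FL q ω, Continuous T' → ExtendsConvRight T' →
        T' = fun p => T p.1 p.2) ∧
      (q₁ < ∞ → q₂ < ∞ → ∀ T' : FL q₁ ω₁ × FL q₂ ω₂ → FL q ω, Continuous T' → ExtendsConv T' →
        T' = fun p => T p.1 p.2)) ∧
    (Submultiplicative (M.expWeight (d := d)) →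
      ∀ f₁ ∈ FLloc q₁ ω₁, ∀ f₂ : UDist M d, IsCompact (UDist.supp f₁) ∨ IsCompact (UDist.supp f₂) →
        ∃ w : UDist M d, IsConvolution f₁ f₂ w ∧ (∀ w', IsConvolution f₁ f₂ w' → w' = w) ∧
          waveFrontSet q ω w ⊆
            {p | ∃ x ∈ UDist.supp f₁, ∃ y, (y, p.2) ∈ waveFrontSet q₂ ω₂ f₂ ∧ p.1 = x + y}) := by
  obtain ⟨C, hC⟩ := hω
  refine ⟨⟨FL.mulₗ hC hq, FL.continuous_mulₗ hC hq, FL.extendsConv_mulₗ hC hq,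
    FL.extendsConvLeft_mulₗ hC hq, FL.extendsConvRight_mulₗ hC hq, fun h₁ T' hT' h' => ?_,
    fun h₂ T' hT' h' => ?_, fun h₁ h₂ T' hT' h' => ?_⟩, ?_⟩
  · exact (FL.extendsConvLeft_mulₗ hC hq).eq (FL.continuous_mulₗ hC hq) hT' h' h₁
  · exact (FL.extendsConvRight_mulₗ hC hq).eq (FL.continuous_mulₗ hC hq) hT' h' h₂
  · exact (FL.extendsConv_mulₗ hC hq).eq (FL.continuous_mulₗ hC hq) hT' h' h₁ h₂
  · intro hsub f₁ hf₁ f₂ hc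
    obtain ⟨w, hw⟩ := UDist.exists_convolution hc
    have hconv : IsConvolution f₁ f₂ w := fun φ χ h => ⟨UDist.convTest f₂ χ φ, fun _ => rfl, hw φ χ h⟩
    exact ⟨w, hconv, fun w' hw' => hw'.eq hc hconv, waveFrontSet_convolution_subset hq hC hsub hf₁ hc hw⟩
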